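/- An \emph{Undirected Geography} position is a pair $(G,s)$ of a finite undirected simple graph $G=(V,E)$ and a vertex $s\in V$, on which a token stands. A move takes the token from its current vertex to an adjacent vertex and deletes the vertex it has left. In a \emph{disjunctive sum} of finitely many positions, the player to move makes a move in exactly one of the components. Two players alternate, and a player who cannot move loses. An option (a position reachable by one move) is \emph{winning} if the player who moved to it can then force a win. There are an algorithm and a polynomial $p$ such that, for every $k\ge 0$ and every collection $(G_1,s_1),\dots,(G_k,s_k)$ of Undirected Geography positions on graphs of maximum degree at most three, given by the number $k$, the numbers of vertices, the starting vertices and the adjacency matrices, the algorithm determines whether the player to move in the disjunctive sum $(G_1,s_1)+\dots+(G_k,s_k)$ has a winning option and, if so, returns one (a component and the vertex to which its token should be moved), in time at most $p\bigl(|V(G_1)|+\dots+|V(G_k)|\bigr)$. Here time is the number of instructions executed by a random access machine (with addition, subtraction and indirect addressing, but without multiplication), for which polynomial time is the same as for Turing machines. -/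

import Mathlib

/-! ### Impartial games under normal play -/

/-- The current player has a winning strategy at `p`, in the game whose options are given by
`Move` (`Move p q` says that `q` is an option of `p`; a player who cannot move loses): there is an
option `q` such that, whatever the opponent answers, the current player can win again. -/
inductive Winning {P : Type} (Move : P → P → Prop) : P → Prop
  | intro (p q : P) (hpq : Move p q) (hq : ∀ r, Move q r → Winning Move r) : Winning Move p

/-- The player who has just moved to `q` wins: every option of `q` is a win for the player who
then has to move. In particular this holds at terminal positions. -/
def PreviousPlayerWins {P : Type} (Move : P → P → Prop) (q : P) : Prop :=
  ∀ r, Move q r → Winning Move r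

/-- `q` is a winning option of `p`. -/
def IsWinningOption {P : Type} (Move : P → P → Prop) (p q : P) : Prop :=
  Move p q ∧ PreviousPlayerWins Move q

/-- The disjunctive sum of a family of games: a move is a move in exactly one component, the other
components being left alone. -/
def SumMove {ι : Type} [DecidableEq ι] {P : ι → Type} (Move : ∀ i, P i → P i → Prop)
    (p q : ∀ i, P i) : Prop :=
  ∃ (i : ι) (x : P i), Move i (p i) x ∧ q = Function.update p i x

/-! ### Undirected Geography -/

/-- A state in the course of a game of Undirected Geography on a graph with vertex type `V`: the
vertices that have not been removed, and the vertex that carries the token. -/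
structure GeographyState (V : Type) where
  remaining : Finset V
  token : V

/-- A move of Undirected Geography: the vertex that the token occupies is removed, and the token
goes to a neighbour of it that is still present. -/
def GeographyMove {V : Type} [DecidableEq V] (G : SimpleGraph V) (p q : GeographyState V) : Prop :=
  G.Adj p.token q.token ∧ q.token ∈ p.remaining ∧ q.remaining = p.remaining.erase p.token

/-- An Undirected Geography position `(G, s)`: a finite undirected graph, with its vertices numbered
`0, …, n - 1`, and a starting vertex. -/
structure Geography where
  n : ℕ
  graph : SimpleGraph (Fin n)
  start : Fin n

namespace Geography

/-- The maximum degree of the graph is at most `d`. -/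
def MaxDegreeLE (g : Geography) (d : ℕ) : Prop :=
  ∀ v, (g.graph.neighborSet v).ncard ≤ d

/-- The initial state: all vertices are present and the token is on the starting vertex. -/
def init (g : Geography) : GeographyState (Fin g.n) :=
  ⟨Finset.univ, g.start⟩

/-- The state reached from the initial one by moving the token to `v`. -/
def after (g : Geography) (v : Fin g.n) : GeographyState (Fin g.n) :=
  ⟨Finset.univ.erase g.start, v⟩

open Classical in
/-- The description of `(G, s)` as input data: the number of vertices, the starting vertex, and the
adjacency matrix, row by row. -/
noncomputable def encode (g : Geography) : List ℕ :=
  g.n :: (g.start : ℕ) :: (List.finRange g.n).flatMap fun u =>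
    (List.finRange g.n).map fun v => if g.graph.Adj u v then 1 else 0

end Geography

/-- The initial position of the disjunctive sum of the games `C 0, …, C (k - 1)`. -/
def sumInit {k : ℕ} (C : Fin k → Geography) : ∀ i, GeographyState (Fin (C i).n) :=
  fun i => (C i).init

/-- The moves in the disjunctive sum of the games `C 0, …, C (k - 1)`. -/
def GeographySumMove {k : ℕ} (C : Fin k → Geography) :
    (∀ i, GeographyState (Fin (C i).n)) → (∀ i, GeographyState (Fin (C i).n)) → Prop :=
  SumMove fun i => GeographyMove (C i).graph

/-- The description of the collection as input data: the number of games, then the games. -/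
noncomputable def encodeSum {k : ℕ} (C : Fin k → Geography) : List ℕ :=
  k :: (List.finRange k).flatMap fun i => (C i).encode

/-- The total number of vertices. -/
def totalVertices {k : ℕ} (C : Fin k → Geography) : ℕ :=
  ∑ i, (C i).n

/-! ### Random access machines

The textbook random access machine: countably many registers that hold natural numbers, a read-only
input, indirect addressing, addition and (truncated) subtraction, and conditional jumps, one unit of
time per instruction. There is no multiplication, so that every number occurring in the first `t`
steps has at most `t` bits more than those in the program and in the input, and polynomial time
is the same as for Turing machines. -/

namespace RAM

inductive Instr
  /-- `R[d] := c` -/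
  | const (d c : ℕ)
  /-- `R[d] := R[a]` -/
  | copy (d a : ℕ)
  /-- `R[d] := R[a] + R[b]` -/
  | add (d a b : ℕ)
  /-- `R[d] := max (R[a] - R[b]) 0` -/
  | sub (d a b : ℕ)
  /-- `R[d] := R[R[a]]` -/
  | load (d a : ℕ)
  /-- `R[R[a]] := R[b]` -/
  | store (a b : ℕ)
  /-- `R[d] := input[R[a]]`, where the input is continued by zeros -/
  | read (d a : ℕ)
  /-- go to instruction `l` -/
  | jump (l : ℕ)
  /-- if `R[a] = 0` then go to instruction `l` -/
  | jumpZero (a l : ℕ)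

/-- A program is a finite list of instructions, numbered from `0`. -/
abbrev Program := List Instr

/-- A configuration: the number of the next instruction, and the contents of the registers. -/
structure Config where
  pc : ℕ
  reg : ℕ → ℕ

/-- The effect of one instruction on a configuration, for the input `x`. -/
def exec (x : List ℕ) (c : Config) : Instr → Config
  | .const d a => ⟨c.pc + 1, Function.update c.reg d a⟩
  | .copy d a => ⟨c.pc + 1, Function.update c.reg d (c.reg a)⟩
  | .add d a b => ⟨c.pc + 1, Function.update c.reg d (c.reg a + c.reg b)⟩
  | .sub d a b => ⟨c.pc + 1, Function.update c.reg d (c.reg a - c.reg b)⟩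
  | .load d a => ⟨c.pc + 1, Function.update c.reg d (c.reg (c.reg a))⟩
  | .store a b => ⟨c.pc + 1, Function.update c.reg (c.reg a) (c.reg b)⟩
  | .read d a => ⟨c.pc + 1, Function.update c.reg d (x.getD (c.reg a) 0)⟩
  | .jump l => ⟨l, c.reg⟩
  | .jumpZero a l => ⟨if c.reg a = 0 then l else c.pc + 1, c.reg⟩

/-- The machine has halted: there is no instruction with the number `pc`. -/
def Halted (prog : Program) (c : Config) : Prop :=
  prog.length ≤ c.pc

/-- One step of the computation. A configuration that has halted does not change any more. -/
def step (prog : Program) (x : List ℕ) (c : Config) : Config :=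
  match prog[c.pc]? with
  | some ins => exec x c ins
  | none => c

/-- The configuration after `t` steps on the input `x`; at the start all registers are zero and the
first instruction is the next one. -/
def run (prog : Program) (x : List ℕ) (t : ℕ) : Config :=
  (step prog x)^[t] ⟨0, fun _ => 0⟩

end RAM

/-! ### Strategic determination -/

/-- The registers `R` hold a correct answer to the strategic determination problem for the sum of
the games `C`: either `R[0] = 1`, and moving the token of the game number `R[1]` to the vertex
number `R[2]` is a winning option, or `R[0] = 0`, and there is no winning option. -/
def IsStrategicAnswer {k : ℕ} (C : Fin k → Geography) (R : ℕ → ℕ) : Prop :=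
  (R 0 = 1 ∧ ∃ (i : Fin k) (v : Fin (C i).n), R 1 = i ∧ R 2 = v ∧
    IsWinningOption (GeographySumMove C) (sumInit C)
      (Function.update (sumInit C) i ((C i).after v))) ∨
  (R 0 = 0 ∧ ¬ ∃ q, IsWinningOption (GeographySumMove C) (sumInit C) q)

/-! By the theory of Sprague and Grundy, a sum is decided by the nim sum `X` of the values of its
components, and a move in a component of value `g` is winning exactly if it leads to the value `X
^^^ g`. So it suffices to compute, in polynomial time, the values of all starting positions and of
their options.

Whether a single position is a win is a question about matchings: the player to move wins if and
only if every maximum matching covers the token, that is, if the token raises the matching number of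
the other vertices (`gval_ne_zero_iff`). The degree bound turns this test into exact values. After a
move the vertex just left is missing among the neighbours of the token, so there are at most two
options and the value is at most 2. If a position and one of its options both have nonzero values,
these are different numbers in {1, 2} and add up to 3 (`gval_add_gval`). A play through options of
nonzero value therefore alternates between 1 and 2 and ends at a position all of whose options lose,
which has value 1; the parity of its length gives the value at its beginning (`Imp.eval_chain`). The
value of a starting position, at most 3, is the mex of its options.

Maximum matchings are built by adding one vertex at a time and searching for an augmenting path from
it. The search is a form of Edmonds' algorithm that keeps no blossoms: each outer vertex `z` carries
a whole matching that misses `z`, and an edge between two outer vertices starts a walk of rotations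
round an odd cycle, which makes every vertex that it uncovers outer. Blossoms exist only in the
proof, as a partition of the outer vertices into odd classes that outnumber the inner vertices
(`BForest`). If a walk finds nothing new, its edge lies within one class (`BForest.blk_eq_of_walk`);
once this holds for all edges between outer vertices and the search cannot grow, a count in the
manner of the Tutte–Berge formula excludes a larger matching (`BForest.nu_eq`).

The algorithm is written in a small language with arrays and bounded loops, whose translation into
machine code is verified once and for all (`Imp.Stmt.run_code`). Within a component all loops run up
to the number of its vertices, which gives a polynomial bound for the time (`Imp.Stmt.cost_le`). -/

/-! ### Sums of impartial games -/

/-- A position that the player to move wins has an option from which the opponent does not win. -/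
theorem Winning.not_previousPlayerWins {P : Type} {Move : P → P → Prop} {p : P}
    (h : Winning Move p) : ¬ PreviousPlayerWins Move p := by
  induction h with
  | intro p q hpq hq ih =>
    intro hp
    cases hp q hpq with
    | intro _ r hqr hr => exact ih r hqr hr

/-- The nim sum of the first `k` values of `f`. -/
def nimSum (f : ℕ → ℕ) : ℕ → ℕ
  | 0 => 0
  | k + 1 => nimSum f k ^^^ f k

theorem nimSum_congr {f g : ℕ → ℕ} {k : ℕ} (h : ∀ j < k, f j = g j) : nimSum f k = nimSum g k := by
  induction k with
  | zero => rfl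
  | succ k ih => rw [nimSum, nimSum, ih fun j hj => h j (by omega), h k (by omega)]

/-- Nim addition is its own inverse, so adding the old value takes it out of the sum. -/
theorem nimSum_update (f : ℕ → ℕ) {k j : ℕ} (hj : j < k) (v : ℕ) :
    nimSum (Function.update f j v) k = nimSum f k ^^^ f j ^^^ v := by
  induction k with
  | zero => omega
  | succ k ih =>
    rw [nimSum, nimSum]
    rcases Nat.lt_succ_iff_lt_or_eq.1 hj with h | rfl
    · rw [ih h, Function.update_of_ne (by omega)]
      ac_rfl
    · rw [Function.update_self,
        nimSum_congr fun i hi => Function.update_of_ne (Nat.ne_of_lt hi) v f,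
        Nat.xor_assoc (nimSum f j), Nat.xor_self, Nat.xor_zero]

/-- This is the winning move in Nim, applied later with `t = 0`. A number below `a ^^^ b` can be
reached by lowering `a` or by lowering `b`; the target is general because the induction passes to a
different one. -/
theorem exists_lt_of_lt_nimSum {f : ℕ → ℕ} {k t : ℕ} (h : t < nimSum f k) :
    ∃ j < k, ∃ v < f j, nimSum f k ^^^ f j ^^^ v = t := by
  induction k generalizing t with
  | zero => simp [nimSum] at h
  | succ k ih =>
    rw [nimSum] at h
    rcases Nat.lt_xor_cases h with h | h
    · obtain ⟨j, hj, v, hv, e⟩ := ih h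
      refine ⟨j, by omega, v, hv, ?_⟩
      rw [nimSum]
      calc nimSum f k ^^^ f k ^^^ f j ^^^ v = (nimSum f k ^^^ f j ^^^ v) ^^^ f k := by ac_rfl
        _ = t := by rw [e, Nat.xor_assoc, Nat.xor_self, Nat.xor_zero]
    · refine ⟨k, by omega, _, h, ?_⟩
      rw [nimSum, Nat.xor_assoc (nimSum f k), Nat.xor_self, Nat.xor_zero, Nat.xor_comm t,
        ← Nat.xor_assoc, Nat.xor_self, Nat.zero_xor]

/-- The Grundy values of the components of a position of a sum. -/
def componentValues {k : ℕ} {P : Fin k → Type} (g : ∀ i, P i → ℕ) (p : ∀ i, P i) (j : ℕ) : ℕ :=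
  if h : j < k then g ⟨j, h⟩ (p ⟨j, h⟩) else 0

theorem componentValues_update {k : ℕ} {P : Fin k → Type} (g : ∀ i, P i → ℕ) (p : ∀ i, P i)
    (i : Fin k) (x : P i) : componentValues g (Function.update p i x) =
      Function.update (componentValues g p) i (g i x) := by
  funext j
  unfold componentValues
  by_cases hj : j < k
  · by_cases hji : j = i
    · subst hji
      simp
    · rw [Function.update_of_ne hji, dif_pos hj, dif_pos hj,
        Function.update_of_ne (fun h => hji (congrArg Fin.val h))]
  · rw [Function.update_of_ne (by omega), dif_neg hj, dif_neg hj]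

/-- `g` is the Grundy function of a game. -/
structure IsGrundy {P : Type} (Move : P → P → Prop) (g : P → ℕ) : Prop where
  ne : ∀ {p q}, Move p q → g q ≠ g p
  exists_eq : ∀ {p m}, m < g p → ∃ q, Move p q ∧ g q = m

theorem nimSum_update_option {k : ℕ} {P : Fin k → Type} (g : ∀ i, P i → ℕ) (p : ∀ i, P i)
    (i : Fin k) (x : P i) :
    nimSum (componentValues g (Function.update p i x)) k =
      nimSum (componentValues g p) k ^^^ g i (p i) ^^^ g i x := by
  rw [componentValues_update, nimSum_update _ i.2]
  simp [componentValues]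

/-- The theorem of Sprague and Grundy for sums of games of finite length. -/
theorem winning_sumMove_iff {k : ℕ} {P : Fin k → Type} {Move : ∀ i, P i → P i → Prop}
    (μ : ∀ i, P i → ℕ) (hμ : ∀ i p q, Move i p q → μ i q < μ i p) {g : ∀ i, P i → ℕ}
    (hg : ∀ i, IsGrundy (Move i) (g i)) (p : ∀ i, P i) :
    Winning (SumMove Move) p ↔ nimSum (componentValues g p) k ≠ 0 := by
  have dec : ∀ p q, SumMove Move p q → ∑ i, μ i (q i) < ∑ i, μ i (p i) := by
    rintro p _ ⟨i, x, hx, rfl⟩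
    refine Finset.sum_lt_sum (fun j _ => ?_) ⟨i, Finset.mem_univ _, ?_⟩
    · by_cases hj : j = i
      · subst hj
        simpa using (hμ _ _ _ hx).le
      · simp [hj]
    · simpa using hμ _ _ _ hx
  have opt : ∀ p q, SumMove Move p q → nimSum (componentValues g p) k = 0 →
      nimSum (componentValues g q) k ≠ 0 := by
    rintro p _ ⟨i, x, hx, rfl⟩ h0
    rw [nimSum_update_option, h0, Nat.zero_xor]
    intro h
    exact (hg i).ne hx (Nat.xor_eq_zero_iff.1 h).symm
  induction hn : ∑ i, μ i (p i) using Nat.strong_induction_on generalizing p with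
  | _ n ih =>
    subst hn
    constructor
    · intro hw h0
      exact hw.not_previousPlayerWins fun q hq => (ih _ (dec p q hq) q rfl).2 (opt p q hq h0)
    · intro h
      obtain ⟨j, hj, v, hv, e⟩ := exists_lt_of_lt_nimSum (Nat.pos_of_ne_zero h)
      have hv' : v < g ⟨j, hj⟩ (p ⟨j, hj⟩) := by simpa [componentValues, hj] using hv
      obtain ⟨x, hx, rfl⟩ := (hg ⟨j, hj⟩).exists_eq hv'
      refine .intro p (Function.update p ⟨j, hj⟩ x) ⟨_, x, hx, rfl⟩ fun r hr => ?_
      -- The induction hypothesis is applied two moves later, because `Winning` refers only to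
      -- positions in which the same player is to move.
      refine (ih _ ((dec _ r hr).trans (dec p _ ⟨_, x, hx, rfl⟩)) r rfl).2 (opt _ r hr ?_)
      rw [nimSum_update_option]
      simpa [componentValues, hj] using e

theorem previousPlayerWins_sumMove_iff {k : ℕ} {P : Fin k → Type} {Move : ∀ i, P i → P i → Prop}
    (μ : ∀ i, P i → ℕ) (hμ : ∀ i p q, Move i p q → μ i q < μ i p) {g : ∀ i, P i → ℕ}
    (hg : ∀ i, IsGrundy (Move i) (g i)) (p : ∀ i, P i) :
    PreviousPlayerWins (SumMove Move) p ↔ nimSum (componentValues g p) k = 0 := by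
  constructor
  · intro h
    by_contra h0
    exact ((winning_sumMove_iff μ hμ hg p).2 h0).not_previousPlayerWins h
  · intro h0
    rintro _ ⟨i, x, hx, rfl⟩
    rw [winning_sumMove_iff μ hμ hg, nimSum_update_option, h0, Nat.zero_xor]
    intro h
    exact (hg i).ne hx (Nat.xor_eq_zero_iff.1 h).symm

/-! ### Matchings -/

/-- `adj` is the adjacency relation of a graph on `0, …, n - 1`. -/
structure IsGraphRel (adj : ℕ → ℕ → Prop) (n : ℕ) : Prop where
  symm : ∀ {u v}, adj u v → adj v u
  irrefl : ∀ v, ¬ adj v v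
  lt : ∀ {u v}, adj u v → u < n

/-- A matching of the graph induced on `S`, as the involution that exchanges the ends of its edges;
its fixed points are the uncovered vertices. -/
structure IsMatch (adj : ℕ → ℕ → Prop) (S : Finset ℕ) (m : ℕ → ℕ) : Prop where
  inv : ∀ v, m (m v) = v
  out : ∀ v, v ∉ S → m v = v
  adj : ∀ v, m v ≠ v → adj v (m v)

/-- The vertices in `S` covered by a matching. -/
def moved (S : Finset ℕ) (m : ℕ → ℕ) : Finset ℕ :=
  S.filter fun v => m v ≠ v

theorem mem_moved {S : Finset ℕ} {m : ℕ → ℕ} {v : ℕ} : v ∈ moved S m ↔ v ∈ S ∧ m v ≠ v := by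
  simp [moved]

theorem even_card_of_involution {B : Finset ℕ} {f : ℕ → ℕ} (mem : ∀ v ∈ B, f v ∈ B)
    (inv : ∀ v ∈ B, f (f v) = v) (ne : ∀ v ∈ B, f v ≠ v) : Even B.card := by
  -- The two terms of a pair cancel, since `1 + 1 = 0` in `ZMod 2`.
  have h : ∑ _v ∈ B, (1 : ZMod 2) = 0 :=
    Finset.sum_involution (fun v _ => f v) (fun _ _ => by decide) (fun v hv _ => ne v hv)
      (fun v hv => mem v hv) (fun v hv => inv v hv)
  rw [Finset.sum_const, nsmul_one, ZMod.natCast_eq_zero_iff] at h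
  exact even_iff_two_dvd.2 h

namespace IsMatch

variable {adj : ℕ → ℕ → Prop} {S : Finset ℕ} {m : ℕ → ℕ}

theorem id (adj : ℕ → ℕ → Prop) (S : Finset ℕ) : IsMatch adj S fun v => v :=
  ⟨fun _ => rfl, fun _ _ => rfl, fun _ h => absurd rfl h⟩

theorem mono {S' : Finset ℕ} (h : IsMatch adj S m) (hS : S ⊆ S') : IsMatch adj S' m :=
  ⟨h.inv, fun v hv => h.out v fun h' => hv (hS h'), h.adj⟩

theorem mem (h : IsMatch adj S m) {v : ℕ} (hv : v ∈ S) : m v ∈ S := by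
  by_contra h'
  have := h.out _ h'
  rw [h.inv] at this
  exact h' (this ▸ hv)

theorem even_card_moved (h : IsMatch adj S m) : Even (moved S m).card := by
  refine even_card_of_involution (f := m) (fun v hv => ?_) (fun v _ => h.inv v)
    (fun v hv => (mem_moved.1 hv).2)
  rw [mem_moved] at hv ⊢
  exact ⟨h.mem hv.1, fun e => hv.2 (by rw [h.inv] at e; exact e.symm)⟩

theorem moved_eq_of_subset {S' : Finset ℕ} (h : IsMatch adj S m) (hS : S ⊆ S') :
    moved S' m = moved S m := by
  ext v
  rw [mem_moved, mem_moved]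
  exact ⟨fun hv => ⟨by_contra fun h' => hv.2 (h.out v h'), hv.2⟩, fun hv => ⟨hS hv.1, hv.2⟩⟩

theorem erase (h : IsMatch adj S m) {v : ℕ} (hv : m v = v) : IsMatch adj (S.erase v) m :=
  ⟨h.inv, fun u hu => by
    by_cases huv : u = v
    · rw [huv, hv]
    · exact h.out u fun h' => hu (Finset.mem_erase.2 ⟨huv, h'⟩), h.adj⟩

theorem link (h : IsMatch adj S m) (hs : ∀ {u v}, adj u v → adj v u) {v w : ℕ} (hv : v ∉ S)
    (hw : w ∉ S) (hne : v ≠ w) (hvw : adj v w) :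
    IsMatch adj (insert v (insert w S)) (Function.update (Function.update m v w) w v) ∧
      moved (insert v (insert w S)) (Function.update (Function.update m v w) w v) =
        insert v (insert w (moved S m)) := by
  have key : ∀ u, u ∈ S ∨ u = v ∨ u = w ∨ (m u = u ∧ u ≠ v ∧ u ≠ w) := fun u => by
    have := h.out u
    tauto
  have hmv := h.out v hv
  have hmw := h.out w hw
  have hinv := h.inv
  refine ⟨⟨fun u => ?_, fun u hu => ?_, fun u hu => ?_⟩, ?_⟩
  · have h1 : m u = v → u = v := fun e => by rw [← hinv u, e, hmv]
    have h2 : m u = w → u = w := fun e => by rw [← hinv u, e, hmw]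
    have := hinv u
    simp only [Function.update_apply]
    split_ifs <;> simp_all
  · simp only [Finset.mem_insert, not_or] at hu
    simp [hu.1, hu.2.1, h.out u hu.2.2]
  · have := h.adj u
    have := hs hvw
    simp only [Function.update_apply] at hu ⊢
    split_ifs at hu ⊢ <;> simp_all
  · ext u
    simp only [mem_moved, Finset.mem_insert, Function.update_apply]
    by_cases h1 : u = w
    · subst h1
      simp [hne]
    · by_cases h2 : u = v
      · subst h2
        simp [hne, hne.symm]
      · simp [h1, h2]

/-- Both ends of the edge leave `S` as well, so that what remains can be compared with `nu` of a
smaller set. -/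
theorem unlink (h : IsMatch adj S m) {v : ℕ} (hv : m v ≠ v) :
    ∃ m', IsMatch adj ((S.erase v).erase (m v)) m' ∧
      (moved S m).card = (moved ((S.erase v).erase (m v)) m').card + 2 := by
  have hinv := h.inv
  have hvS : v ∈ S := by_contra fun h' => hv (h.out v h')
  have h1 : ∀ u, m u = v ↔ u = m v := fun u =>
    ⟨fun e => by rw [← hinv u, e], fun e => by rw [e, hinv]⟩
  have h2 : ∀ u, m u = m v ↔ u = v := fun u =>
    ⟨fun e => by rw [← hinv u, e, hinv], fun e => by rw [e]⟩
  refine ⟨fun u => if u = v ∨ u = m v then u else m u, ⟨fun u => ?_, fun u hu => ?_, fun u hu => ?_⟩,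
    ?_⟩
  · by_cases hu : u = v ∨ u = m v
    · simp [hu]
    · have : ¬ (m u = v ∨ m u = m v) := by rw [h1, h2]; tauto
      simp only [hu, if_false, this, hinv]
  · simp only [Finset.mem_erase] at hu
    by_cases h' : u = v ∨ u = m v
    · simp [h']
    · simp only [h', if_false]
      exact h.out u (by tauto)
  · by_cases h' : u = v ∨ u = m v
    · simp [h'] at hu
    · simp only [h', if_false] at hu ⊢
      exact h.adj u hu
  · have : moved S m = insert v (insert (m v) (moved ((S.erase v).erase (m v))
        fun u => if u = v ∨ u = m v then u else m u)) := by
      ext u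
      simp only [mem_moved, Finset.mem_insert, Finset.mem_erase]
      by_cases e1 : u = v
      · subst e1
        simp [hv, hvS]
      · by_cases e2 : u = m v
        · subst e2
          simp [hinv, h.mem hvS, hv.symm]
        · simp [e1, e2]
    rw [this, Finset.card_insert_of_notMem, Finset.card_insert_of_notMem]
    · simp [mem_moved]
    · simp [mem_moved, hv.symm]

end IsMatch

/-- The largest number of vertices that a matching of the graph induced on `S` covers. -/
noncomputable def nu (adj : ℕ → ℕ → Prop) (S : Finset ℕ) : ℕ :=
  sSup {k | ∃ m, IsMatch adj S m ∧ (moved S m).card = k}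

section nu

variable {adj : ℕ → ℕ → Prop} {S : Finset ℕ}

theorem bddAbove_card_moved (adj : ℕ → ℕ → Prop) (S : Finset ℕ) :
    BddAbove {k | ∃ m, IsMatch adj S m ∧ (moved S m).card = k} :=
  ⟨S.card, by rintro _ ⟨m, _, rfl⟩; exact Finset.card_filter_le _ _⟩

theorem IsMatch.le_nu {m : ℕ → ℕ} (h : IsMatch adj S m) : (moved S m).card ≤ nu adj S :=
  le_csSup (bddAbove_card_moved adj S) ⟨m, h, rfl⟩

theorem exists_isMatch_eq_nu (adj : ℕ → ℕ → Prop) (S : Finset ℕ) :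
    ∃ m, IsMatch adj S m ∧ (moved S m).card = nu adj S :=
  Nat.sSup_mem (s := {k | ∃ m, IsMatch adj S m ∧ (moved S m).card = k})
    ⟨_, _, IsMatch.id adj S, rfl⟩ (bddAbove_card_moved adj S)

theorem even_nu (adj : ℕ → ℕ → Prop) (S : Finset ℕ) : Even (nu adj S) := by
  obtain ⟨m, hm, e⟩ := exists_isMatch_eq_nu adj S
  exact e ▸ hm.even_card_moved

theorem nu_mono {S' : Finset ℕ} (h : S ⊆ S') : nu adj S ≤ nu adj S' := by
  obtain ⟨m, hm, e⟩ := exists_isMatch_eq_nu adj S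
  rw [← e, ← hm.moved_eq_of_subset h]
  exact (hm.mono h).le_nu

theorem nu_empty (adj : ℕ → ℕ → Prop) : nu adj ∅ = 0 := by
  obtain ⟨m, _, e⟩ := exists_isMatch_eq_nu adj ∅
  rw [← e]
  rfl

/-- A maximum matching of the larger graph that is larger covers the new vertex. -/
theorem exists_of_nu_lt {v : ℕ} (hv : v ∉ S) (h : nu adj S < nu adj (insert v S)) :
    ∃ w ∈ S, adj v w ∧ nu adj (insert v S) ≤ nu adj (S.erase w) + 2 := by
  obtain ⟨m, hm, e⟩ := exists_isMatch_eq_nu adj (insert v S)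
  have hmv : m v ≠ v := fun h' => by
    have h1 := hm.erase h'
    rw [Finset.erase_insert hv] at h1
    have := h1.le_nu
    rw [← h1.moved_eq_of_subset (Finset.subset_insert v S)] at this
    omega
  obtain ⟨m', hm', e'⟩ := hm.unlink hmv
  rw [Finset.erase_insert hv] at hm' e'
  refine ⟨m v, ?_, hm.adj v hmv, ?_⟩
  · have := hm.mem (Finset.mem_insert_self v S)
    exact (Finset.mem_insert.1 this).resolve_left hmv
  · have := hm'.le_nu
    omega

theorem nu_insert_le {v : ℕ} : nu adj (insert v S) ≤ nu adj S + 2 := by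
  by_cases hv : v ∈ S
  · rw [Finset.insert_eq_of_mem hv]
    omega
  by_cases h : nu adj S < nu adj (insert v S)
  · obtain ⟨w, _, _, h'⟩ := exists_of_nu_lt hv h
    exact h'.trans (Nat.add_le_add_right (nu_mono (Finset.erase_subset w S)) 2)
  · omega

/-- The recursion for the matching number that corresponds to the moves of Geography. -/
theorem nu_lt_nu_insert_iff (hs : ∀ {u v}, adj u v → adj v u) {v : ℕ} (hv : v ∉ S) :
    nu adj S < nu adj (insert v S) ↔ ∃ w ∈ S, adj v w ∧ nu adj (S.erase w) = nu adj S := by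
  constructor
  · intro h
    obtain ⟨w, hw, hvw, h'⟩ := exists_of_nu_lt hv h
    refine ⟨w, hw, hvw, le_antisymm (nu_mono (Finset.erase_subset w S)) ?_⟩
    -- All three numbers are even, so the strict inequality is a gap of at least 2, which makes up
    -- for the edge `v w` that is lost.
    obtain ⟨a, ha⟩ := even_nu adj S
    obtain ⟨b, hb⟩ := even_nu adj (S.erase w)
    obtain ⟨c, hc⟩ := even_nu adj (insert v S)
    omega
  · rintro ⟨w, hw, hvw, e⟩
    obtain ⟨m, hm, e'⟩ := exists_isMatch_eq_nu adj (S.erase w)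
    have hne : v ≠ w := fun h => hv (h ▸ hw)
    have hve : v ∉ S.erase w := fun h => hv (Finset.mem_of_mem_erase h)
    obtain ⟨h1, h2⟩ := hm.link hs hve (Finset.notMem_erase w S) hne hvw
    have := h1.le_nu
    rw [h2, Finset.card_insert_of_notMem, Finset.card_insert_of_notMem, Finset.insert_erase hw]
      at this
    · omega
    · simp [mem_moved]
    · simp [mem_moved, hne, hv]

end nu

/-! ### Grundy values of Undirected Geography -/

/-- The Grundy value of the position with the token on `v`, where `S` is the set of the other
vertices that remain. -/
noncomputable def gval (adj : ℕ → ℕ → Prop) (S : Finset ℕ) (v : ℕ) : ℕ :=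
  sInf {a | ∀ w, ∀ _ : w ∈ S, adj v w → gval adj (S.erase w) w ≠ a}
termination_by S.card
decreasing_by exact Finset.card_erase_lt_of_mem (by assumption)

section gval

variable {adj : ℕ → ℕ → Prop} {S : Finset ℕ} {v : ℕ}

theorem gval_ne {w : ℕ} (hw : w ∈ S) (hvw : adj v w) : gval adj (S.erase w) w ≠ gval adj S v := by
  have h : gval adj S v ∈ {a | ∀ w, ∀ _ : w ∈ S, adj v w → gval adj (S.erase w) w ≠ a} := by
    rw [gval]
    refine Nat.sInf_mem ?_
    -- There are finitely many options, so some number is not the value of any of them.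
    obtain ⟨a, ha⟩ := Infinite.exists_notMem_finset (S.image fun w => gval adj (S.erase w) w)
    exact ⟨a, fun w hw _ e => ha (Finset.mem_image.2 ⟨w, hw, e⟩)⟩
  exact h w hw hvw

theorem exists_of_lt_gval {a : ℕ} (h : a < gval adj S v) :
    ∃ w ∈ S, adj v w ∧ gval adj (S.erase w) w = a := by
  rw [gval] at h
  have := Nat.notMem_of_lt_sInf h
  simpa using this

theorem gval_eq_of {a : ℕ} (h1 : ∀ w ∈ S, adj v w → gval adj (S.erase w) w ≠ a)
    (h2 : ∀ b < a, ∃ w ∈ S, adj v w ∧ gval adj (S.erase w) w = b) : gval adj S v = a := by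
  rcases lt_trichotomy (gval adj S v) a with h | h | h
  · obtain ⟨w, hw, hvw, e⟩ := h2 _ h
    exact absurd e (gval_ne hw hvw)
  · exact h
  · obtain ⟨w, hw, hvw, e⟩ := exists_of_lt_gval h
    exact absurd e (h1 w hw hvw)

-- Every number below the mex is the value of an option, so the mex is at most the number of
-- options.
open Classical in
theorem gval_le_card : gval adj S v ≤ (S.filter (adj v)).card := by
  have : Finset.range (gval adj S v) ⊆
      (S.filter (adj v)).image fun w => gval adj (S.erase w) w := by
    intro a ha
    obtain ⟨w, hw, hvw, e⟩ := exists_of_lt_gval (Finset.mem_range.1 ha)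
    exact Finset.mem_image.2 ⟨w, Finset.mem_filter.2 ⟨hw, hvw⟩, e⟩
  simpa using (Finset.card_le_card this).trans Finset.card_image_le

theorem gval_ne_zero_iff_exists :
    gval adj S v ≠ 0 ↔ ∃ w ∈ S, adj v w ∧ gval adj (S.erase w) w = 0 := by
  constructor
  · exact fun h => exists_of_lt_gval (Nat.pos_of_ne_zero h)
  · rintro ⟨w, hw, hvw, e⟩ h
    exact gval_ne hw hvw (e.trans h.symm)

/-- The player to move wins Undirected Geography if and only if every maximum matching covers the
token. -/
theorem gval_ne_zero_iff (hs : ∀ {u v}, adj u v → adj v u) (hv : v ∉ S) :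
    gval adj S v ≠ 0 ↔ nu adj S < nu adj (insert v S) := by
  induction hn : S.card using Nat.strong_induction_on generalizing S v with
  | _ n ih =>
    subst hn
    rw [gval_ne_zero_iff_exists, nu_lt_nu_insert_iff (adj := adj) hs hv]
    refine exists_congr fun w => and_congr_right fun hw => and_congr_right fun _ => ?_
    -- The option `w` is losing exactly if deleting `w` keeps the matching number of `S`, and this
    -- is the condition in `nu_lt_nu_insert_iff`.
    have := ih _ (Finset.card_erase_lt_of_mem hw) (Finset.notMem_erase w S) rfl
    rw [Finset.insert_erase hw] at this
    have hle := nu_mono (adj := adj) (Finset.erase_subset w S)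
    constructor
    · intro h
      by_contra h'
      exact this.2 (lt_of_le_of_ne hle h') h
    · intro h
      by_contra h'
      exact absurd (this.1 h') (by omega)

theorem gval_eq_one (h0 : gval adj S v ≠ 0)
    (h : ∀ w ∈ S, adj v w → gval adj (S.erase w) w = 0) : gval adj S v = 1 :=
  gval_eq_of (fun w hw hvw => by simp [h w hw hvw]) fun b hb => by
    obtain rfl : b = 0 := by omega
    exact gval_ne_zero_iff_exists.1 h0

open Classical in
/-- If the token has at most two neighbours left, the value of a winning position is determined by
the value of the option that is not losing. -/
theorem gval_add_gval (h0 : gval adj S v ≠ 0) (hd : (S.filter (adj v)).card ≤ 2) {w : ℕ}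
    (hw : w ∈ S) (hvw : adj v w) (hw0 : gval adj (S.erase w) w ≠ 0)
    (hdw : ((S.erase w).filter (adj w)).card ≤ 2) :
    gval adj S v + gval adj (S.erase w) w = 3 := by
  obtain ⟨z, hz, hvz, ez⟩ := gval_ne_zero_iff_exists.1 h0
  have hzw : z ≠ w := fun e => hw0 (e ▸ ez)
  have hall : ∀ u ∈ S, adj v u → u = z ∨ u = w := by
    intro u hu hvu
    by_contra h
    rw [not_or] at h
    have : ({u, z, w} : Finset ℕ) ⊆ S.filter (adj v) := by
      intro t ht
      simp only [Finset.mem_insert, Finset.mem_singleton] at ht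
      rcases ht with rfl | rfl | rfl <;> simp [*]
    have h3 := Finset.card_le_card this
    rw [Finset.card_eq_three.2 ⟨u, z, w, h.1, h.2, hzw, rfl⟩] at h3
    omega
  -- Both values are 1 or 2, and an option never has the value of its position.
  have hle := (gval_le_card (adj := adj) (S := S.erase w) (v := w)).trans hdw
  have hv2 := (gval_le_card (adj := adj) (S := S) (v := v)).trans hd
  have hne := gval_ne hw hvw
  have h12 : gval adj S v = 2 → gval adj (S.erase w) w = 1 := by
    intro h
    obtain ⟨u, hu, hvu, e⟩ := exists_of_lt_gval (show 1 < gval adj S v by omega)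
    rcases hall u hu hvu with rfl | rfl <;> omega
  omega

end gval

/-! ### Alternating forests with blossoms

A search for an augmenting path from an exposed vertex reaches a set `D` of outer and a set `A` of
inner vertices. Every outer vertex `z` comes with a matching `N z` that leaves `z` uncovered
and has as many edges as the matching `M` from which the search started. -/

/-- The state of a search. The function `blk` partitions the outer vertices into blossoms; an inner
vertex `a` is joined to the blossoms of `c a` and `p a`. The set `Z` consists of the outer vertices
for which a matching is known. -/
structure BForest (adj : ℕ → ℕ → Prop) (M : ℕ → ℕ) (Z D A : Finset ℕ) (N : ℕ → ℕ → ℕ)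
    (blk c p : ℕ → ℕ) : Prop where
  disj : ∀ v ∈ D, v ∉ A
  sub : Z ⊆ D
  inv : ∀ z ∈ Z, ∀ v, N z (N z v) = v
  adj : ∀ z ∈ Z, ∀ v, N z v ≠ v → adj v (N z v)
  self : ∀ z ∈ Z, N z z = z
  fix : ∀ z ∈ Z, ∀ v, v ∈ D ∨ v ∈ A → N z v = v → v = z
  out : ∀ z ∈ Z, ∀ v, v ∉ D → v ∉ A → N z v = M v
  stab : ∀ z ∈ Z, ∀ v, v ∈ D ∨ v ∈ A → N z v ∈ D ∨ N z v ∈ A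
  tree : ∀ z ∈ Z, ∀ a ∈ A, N z a = c a ∨ N z a = p a
  cmem : ∀ a ∈ A, c a ∈ Z
  pmem : ∀ a ∈ A, p a ∈ Z
  same : ∀ z ∈ Z, ∀ v ∈ D, N z v ∈ D → blk (N z v) = blk v
  odd : ∀ b ∈ D.image blk, Odd (D.filter fun v => blk v = b).card
  card : A.card + 1 ≤ (D.image blk).card

namespace BForest

variable {adj : ℕ → ℕ → Prop} {M : ℕ → ℕ} {Z D A : Finset ℕ} {N : ℕ → ℕ → ℕ} {blk c p : ℕ → ℕ}

theorem init {r : ℕ} (inv : ∀ v, M (M v) = v) (hadj : ∀ v, M v ≠ v → adj v (M v)) (hr : M r = r)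
    (hN : ∀ v, N r v = M v) : BForest adj M {r} {r} ∅ N blk c p := by
  constructor <;> simp_all [Finset.filter_singleton]

/-- An odd class cannot be paired within itself by `N z`, which misses none of its vertices; by
`same` and `stab`, an edge of `N z` that leaves the class ends in an inner vertex. -/
theorem exists_inner (h : BForest adj M Z D A N blk c p) {z b : ℕ} (hz : z ∈ Z)
    (hb : b ∈ D.image blk) (hbz : b ≠ blk z) : ∃ a ∈ A, blk (N z a) = b := by
  by_contra! hno
  refine Nat.not_even_iff_odd.2 (h.odd b hb) (even_card_of_involution (f := N z)
    (fun v hv => ?_) (fun v _ => h.inv z hz v) fun v hv e => ?_)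
  · rw [Finset.mem_filter] at hv ⊢
    rcases h.stab z hz v (.inl hv.1) with h' | h'
    · exact ⟨h', (h.same z hz v hv.1 h').trans hv.2⟩
    · exact absurd hv.2 (by simpa [h.inv z hz] using hno _ h')
  · rw [Finset.mem_filter] at hv
    exact hbz (by rw [← hv.2, h.fix z hz v (.inl hv.1) e])

/-- No edge of `N z` joins an inner vertex to the blossom of `z`. -/
theorem inner_ne (h : BForest adj M Z D A N blk c p) {z a : ℕ} (hz : z ∈ Z) (ha : a ∈ A) :
    blk (N z a) ≠ blk z := by
  intro e
  -- The classes other than that of `z` are at least as many as the inner vertices, and `N z` joins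
  -- each of them to an inner vertex of its own. If `a` were joined to the class of `z`, one inner
  -- vertex would be lacking.
  have hsub : (D.image blk).erase (blk z) ⊆ (A.erase a).image fun a => blk (N z a) := by
    intro b hb
    rw [Finset.mem_erase] at hb
    obtain ⟨a', ha', e'⟩ := h.exists_inner hz hb.2 hb.1
    refine Finset.mem_image.2 ⟨a', Finset.mem_erase.2 ⟨?_, ha'⟩, e'⟩
    rintro rfl
    exact hb.1 (e'.symm.trans e)
  have h1 := (Finset.card_le_card hsub).trans Finset.card_image_le
  rw [Finset.card_erase_of_mem ha,
    Finset.card_erase_of_mem (Finset.mem_image_of_mem _ (h.sub hz))] at h1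
  have h2 := h.card
  have h3 := Finset.card_pos.2 ⟨a, ha⟩
  omega

/-- The matching `N (c a)` joins `a` to `c a` or to `p a`, but by `inner_ne` not to the class of `c
a`. -/
theorem blk_ne (h : BForest adj M Z D A N blk c p) {a : ℕ} (ha : a ∈ A) :
    blk (c a) ≠ blk (p a) := by
  intro e
  refine h.inner_ne (h.cmem a ha) ha ?_
  rcases h.tree _ (h.cmem a ha) a ha with e' | e' <;> rw [e']
  exact e.symm

/-- Joining the two blossoms at an inner vertex, which becomes an outer vertex. -/
theorem merge (h : BForest adj M Z D A N blk c p) {a : ℕ} (ha : a ∈ A) :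
    ∃ blk', BForest adj M Z (insert a D) (A.erase a) N blk' c p := by
  have haD : a ∉ D := fun h' => h.disj a h' ha
  have hne := h.blk_ne ha
  have hcD := h.sub (h.cmem a ha)
  have hpD := h.sub (h.pmem a ha)
  have hca : c a ≠ a := fun e => haD (e ▸ hcD)
  have hpa : p a ≠ a := fun e => haD (e ▸ hpD)
  -- The union of the two classes and `a` keeps the name of the class of `c a`.
  obtain ⟨blk', hb⟩ : ∃ blk' : ℕ → ℕ,
      ∀ v, blk' v = if v = a ∨ blk v = blk (p a) then blk (c a) else blk v := ⟨_, fun _ => rfl⟩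
  have hba : blk' a = blk (c a) := by simp [hb]
  have hbc : blk' (c a) = blk (c a) := by simp [hb]
  have hbp : blk' (p a) = blk (c a) := by simp [hb]
  have hmono : ∀ u ∈ D, ∀ v ∈ D, blk u = blk v → blk' u = blk' v := by
    intro u hu v hv e
    have h1 : u ≠ a := fun e => haD (e ▸ hu)
    have h2 : v ≠ a := fun e => haD (e ▸ hv)
    simp [hb, h1, h2, e]
  have himage : (insert a D).image blk' = (D.image blk).erase (blk (p a)) := by
    ext b
    simp only [Finset.mem_image, Finset.mem_insert, Finset.mem_erase]
    constructor
    · rintro ⟨v, rfl | hv, rfl⟩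
      · exact ⟨hba ▸ hne, c v, hcD, hba.symm⟩
      · rw [hb]
        split_ifs with h'
        · exact ⟨hne, c a, hcD, rfl⟩
        · exact ⟨fun e => h' (.inr e), v, hv, rfl⟩
    · rintro ⟨h1, v, hv, rfl⟩
      refine ⟨v, .inr hv, ?_⟩
      rw [hb, if_neg]
      rintro (rfl | e)
      exacts [haD hv, h1 e]
  refine ⟨blk', ⟨?_, ?_, h.inv, h.adj, h.self, ?_, ?_, ?_, ?_, ?_, ?_, ?_, ?_, ?_⟩⟩
  · intro v hv hv'
    rw [Finset.mem_erase] at hv'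
    exact h.disj v ((Finset.mem_insert.1 hv).resolve_left hv'.1) hv'.2
  · exact h.sub.trans (Finset.subset_insert _ _)
  · intro z hz v hv
    refine h.fix z hz v ?_
    rcases hv with hv | hv
    · rcases Finset.mem_insert.1 hv with rfl | hv
      exacts [.inr ha, .inl hv]
    · exact .inr (Finset.mem_of_mem_erase hv)
  · intro z hz v hv hv'
    rw [Finset.mem_insert, not_or] at hv
    exact h.out z hz v hv.2 fun h' => hv' (Finset.mem_erase.2 ⟨hv.1, h'⟩)
  · intro z hz v hv
    have : v ∈ D ∨ v ∈ A := by
      rcases hv with hv | hv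
      · rcases Finset.mem_insert.1 hv with rfl | hv
        exacts [.inr ha, .inl hv]
      · exact .inr (Finset.mem_of_mem_erase hv)
    rw [Finset.mem_insert, Finset.mem_erase]
    have := h.stab z hz v this
    tauto
  · exact fun z hz b hb' => h.tree z hz b (Finset.mem_of_mem_erase hb')
  · exact fun b hb' => h.cmem b (Finset.mem_of_mem_erase hb')
  · exact fun b hb' => h.pmem b (Finset.mem_of_mem_erase hb')
  · intro z hz v hv hv'
    -- By `tree` the partner of `a` is `c a` or `p a`, and the new class contains both.
    have key : ∀ u ∈ D, N z u = a → blk' u = blk' a := by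
      intro u _ e
      have e' : N z a = u := by rw [← e, h.inv z hz]
      rcases h.tree z hz a ha with e2 | e2
      · rw [← e', e2, hbc, hba]
      · rw [← e', e2, hbp, hba]
    rcases Finset.mem_insert.1 hv with rfl | hv
    · rcases Finset.mem_insert.1 hv' with e | hv'
      · rw [e]
      · exact key _ hv' (h.inv z hz v)
    · rcases Finset.mem_insert.1 hv' with e | hv'
      · rw [e]
        exact (key v hv e).symm
      · exact hmono _ hv' _ hv (h.same z hz v hv hv')
  · intro b hb'
    rw [himage, Finset.mem_erase] at hb'
    by_cases hbc' : b = blk (c a)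
    · subst hbc'
      have : ((insert a D).filter fun v => blk' v = blk (c a)) =
          insert a ((D.filter fun v => blk v = blk (c a)) ∪ D.filter fun v => blk v = blk (p a)) := by
        ext v
        simp only [Finset.mem_filter, Finset.mem_insert, Finset.mem_union, hb]
        by_cases hva : v = a
        · simp [hva]
        · by_cases hvp : blk v = blk (p a)
          · simp only [hva, hvp, or_true, if_true, and_true, false_or]
            tauto
          · simp [hva, hvp]
      rw [this, Finset.card_insert_of_notMem (by simp [haD]), Finset.card_union_of_disjoint]
      · have h1 := h.odd _ (Finset.mem_image_of_mem blk hcD)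
        have h2 := h.odd _ (Finset.mem_image_of_mem blk hpD)
        exact (h1.add_odd h2).add_one
      · rw [Finset.disjoint_left]
        intro v hv hv'
        rw [Finset.mem_filter] at hv hv'
        exact hne (hv.2.symm.trans hv'.2)
    · have : ((insert a D).filter fun v => blk' v = b) = D.filter fun v => blk v = b := by
        ext v
        simp only [Finset.mem_filter, Finset.mem_insert, hb]
        by_cases hva : v = a
        · simp [hva, haD, Ne.symm hbc']
        · by_cases hvp : blk v = blk (p a)
          · simp [hvp, Ne.symm hbc', Ne.symm hb'.1]
          · simp [hva, hvp]
      rw [this]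
      exact h.odd b hb'.2
  · rw [himage, Finset.card_erase_of_mem ha,
      Finset.card_erase_of_mem (Finset.mem_image_of_mem blk hpD)]
    have h2 := h.card
    have h3 := Finset.card_pos.2 ⟨a, ha⟩
    omega

/-- `Z` does not change: when a blossom is formed, the classes are joined before matchings for the
new outer vertices are supplied. -/
theorem merge_all (h : BForest adj M Z D A N blk c p) (I : Finset ℕ) (hI : I ⊆ A) :
    ∃ blk', BForest adj M Z (D ∪ I) (A \ I) N blk' c p := by
  induction I using Finset.induction_on with
  | empty => exact ⟨blk, by simpa using h⟩
  | insert a I haI ih =>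
    obtain ⟨blk', h'⟩ := ih ((Finset.subset_insert a I).trans hI)
    obtain ⟨blk'', h''⟩ := h'.merge (a := a)
      (Finset.mem_sdiff.2 ⟨hI (Finset.mem_insert_self a I), haI⟩)
    refine ⟨blk'', ?_⟩
    rwa [Finset.union_insert, Finset.sdiff_insert]

end BForest

/-! ### Rotations of matchings and walks round odd cycles. -/

/-- `m` is a matching that leaves `u` uncovered and no other vertex reached by the search. -/
structure NearMatch (adj : ℕ → ℕ → Prop) (M : ℕ → ℕ) (D A : Finset ℕ) (m : ℕ → ℕ) (u : ℕ) :
    Prop where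
  inv : ∀ v, m (m v) = v
  adj : ∀ v, m v ≠ v → adj v (m v)
  self : m u = u
  fix : ∀ v, v ∈ D ∨ v ∈ A → m v = v → v = u
  out : ∀ v, v ∉ D → v ∉ A → m v = M v
  stab : ∀ v, v ∈ D ∨ v ∈ A → m v ∈ D ∨ m v ∈ A

theorem BForest.near {adj : ℕ → ℕ → Prop} {M : ℕ → ℕ} {Z D A : Finset ℕ} {N : ℕ → ℕ → ℕ}
    {blk c p : ℕ → ℕ} (h : BForest adj M Z D A N blk c p) {z : ℕ} (hz : z ∈ Z) :
    NearMatch adj M D A (N z) z :=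
  ⟨h.inv z hz, h.adj z hz, h.self z hz, h.fix z hz, h.out z hz, h.stab z hz⟩

/-- Adding the edge `u w` to the matching `m` and removing the edge that covers `w`. -/
def rot (m : ℕ → ℕ) (u w : ℕ) : ℕ → ℕ :=
  Function.update (Function.update (Function.update m u w) w u) (m w) (m w)

theorem rot_apply (m : ℕ → ℕ) (u w v : ℕ) :
    rot m u w v = if v = m w then m w else if v = w then u else if v = u then w else m v := by
  simp only [rot, Function.update_apply]

/-- Because of this degenerate case, a walk that has uncovered `y` stands still and needs no test
for its end. -/
theorem rot_same {m : ℕ → ℕ} {u : ℕ} (h : m u = u) : rot m u u = m := by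
  funext v
  rw [rot_apply, h]
  split_ifs with h1
  · rw [h1, h]
  · rfl

section rot

variable {adj : ℕ → ℕ → Prop} {m : ℕ → ℕ} {u w : ℕ}

theorem rot_inv (inv : ∀ v, m (m v) = v) (hu : m u = u) (hwu : w ≠ u) (hw : m w ≠ w) (v : ℕ) :
    rot m u w (rot m u w v) = v := by
  have h1 : ∀ v, m v = w → v = m w := fun v e => by rw [← e, inv]
  have h2 : ∀ v, m v = u → v = u := fun v e => by rw [← inv v, e, hu]
  have h3 : ∀ v, m v = m w → v = w := fun v e => by rw [← inv v, e, inv]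
  have h4 : m w ≠ u := fun e => hwu (h2 w e)
  by_cases e1 : v = m w
  · simp [rot_apply, e1]
  by_cases e2 : v = w
  · subst e2
    simp [rot_apply, e1, h4.symm, hwu.symm]
  by_cases e3 : v = u
  · subst e3
    simp [rot_apply, e1, e2, hw.symm]
  have n1 : m v ≠ m w := fun e => e2 (h3 v e)
  have n2 : m v ≠ w := fun e => e1 (h1 v e)
  have n3 : m v ≠ u := fun e => e3 (h2 v e)
  simp [rot_apply, e1, e2, e3, n1, n2, n3, inv]

theorem rot_adj (hs : ∀ {u v}, adj u v → adj v u) (hm : ∀ v, m v ≠ v → adj v (m v))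
    (huw : adj u w) (v : ℕ) (hv : rot m u w v ≠ v) : adj v (rot m u w v) := by
  rw [rot_apply] at hv ⊢
  split_ifs at hv ⊢ with e1 e2 e3
  · exact absurd e1.symm hv
  · exact e2 ▸ hs huw
  · exact e3 ▸ huw
  · exact hm v hv

/-- The uncovered vertex shifts from `u` to the former partner of `w`. An edge is required only for
`w ≠ u`, so that the idle steps of a walk are included. -/
theorem NearMatch.rot {M : ℕ → ℕ} {D A : Finset ℕ} (h : NearMatch adj M D A m u)
    (hs : ∀ {u v}, adj u v → adj v u) (hu : u ∈ D ∨ u ∈ A) (hw : w ∈ D ∨ w ∈ A)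
    (huw : w ≠ u → adj u w) : NearMatch adj M D A (rot m u w) (m w) := by
  by_cases hwu : w = u
  · subst hwu
    rwa [rot_same h.self, h.self]
  have hmw : m w ≠ w := fun e => hwu (h.fix w hw e)
  refine ⟨rot_inv h.inv h.self hwu hmw, rot_adj hs h.adj (huw hwu), ?_, fun v hv e => ?_,
    fun v hv hv' => ?_, fun v hv => ?_⟩
  · simp [rot_apply]
  · rw [rot_apply] at e
    split_ifs at e with e1 e2 e3
    · exact e1
    · exact absurd (e2.symm.trans e.symm) hwu
    · exact absurd (e.trans e3) hwu
    · exact absurd (h.fix v hv e) e3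
  · have hmT := h.stab w hw
    rw [rot_apply, if_neg, if_neg, if_neg]
    · exact h.out v hv hv'
    · rintro rfl; tauto
    · rintro rfl; tauto
    · rintro rfl; tauto
  · rw [rot_apply]
    split_ifs
    · exact h.stab w hw
    · exact hu
    · exact hw
    · exact h.stab v hv

end rot

/-- The walk round the odd cycle that is formed by the edge `x y` and the symmetric difference of
two matchings that leave `x` and `y` uncovered: the matchings on the way, the vertex that they leave
uncovered, and the partner of this vertex in the second of the given matchings. -/
def walk (Nx Ny : ℕ → ℕ) (x y : ℕ) : ℕ → (ℕ → ℕ) × ℕ × ℕ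
  | 0 => (Nx, x, y)
  | i + 1 =>
    (rot (walk Nx Ny x y i).1 (walk Nx Ny x y i).2.1 (walk Nx Ny x y i).2.2,
      (walk Nx Ny x y i).1 (walk Nx Ny x y i).2.2,
      Ny ((walk Nx Ny x y i).1 (walk Nx Ny x y i).2.2))

section walk

variable {adj : ℕ → ℕ → Prop} {M : ℕ → ℕ} {D A : Finset ℕ} {Nx Ny : ℕ → ℕ} {x y : ℕ}

theorem walk_mem (hx : NearMatch adj M D A Nx x) (hy : NearMatch adj M D A Ny y)
    (hs : ∀ {u v}, adj u v → adj v u) (hxD : x ∈ D) (hyD : y ∈ D) (hxy : adj x y) (i : ℕ) :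
    NearMatch adj M D A (walk Nx Ny x y i).1 (walk Nx Ny x y i).2.1 ∧
    ((walk Nx Ny x y i).2.1 ∈ D ∨ (walk Nx Ny x y i).2.1 ∈ A) ∧
    ((walk Nx Ny x y i).2.2 ∈ D ∨ (walk Nx Ny x y i).2.2 ∈ A) ∧
    ((walk Nx Ny x y i).2.2 ≠ (walk Nx Ny x y i).2.1 →
      adj (walk Nx Ny x y i).2.1 (walk Nx Ny x y i).2.2) := by
  induction i with
  | zero => exact ⟨hx, .inl hxD, .inl hyD, fun _ => hxy⟩
  | succ i ih =>
    obtain ⟨h1, h2, h3, h4⟩ := ih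
    rw [walk]
    have h5 := h1.stab _ h3
    exact ⟨h1.rot hs h2 h3 h4, h5, hy.stab _ h5, fun h => hy.adj _ h⟩

/-- The matchings of a walk are composed of those that it started from and the edge `x y`. -/
theorem walk_edge (hy : ∀ v, Ny (Ny v) = v) (i v : ℕ) :
    (walk Nx Ny x y i).1 v = v ∨ (walk Nx Ny x y i).1 v = Nx v ∨ (walk Nx Ny x y i).1 v = Ny v ∨
      (v = x ∧ (walk Nx Ny x y i).1 v = y) ∨ (v = y ∧ (walk Nx Ny x y i).1 v = x) := by
  induction i generalizing v with
  | zero => exact .inr (.inl rfl)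
  | succ i ih =>
    rw [walk]
    dsimp only
    rw [rot_apply]
    -- Only the first rotation uses the edge `x y`; from then on the uncovered vertex is given its
    -- partner in `Ny`.
    have hw : (i = 0 ∧ (walk Nx Ny x y i).2.1 = x ∧ (walk Nx Ny x y i).2.2 = y) ∨
        (walk Nx Ny x y i).2.2 = Ny (walk Nx Ny x y i).2.1 := by
      cases i with
      | zero => exact .inl ⟨rfl, rfl, rfl⟩
      | succ i => exact .inr rfl
    split_ifs with e1 e2 e3
    · exact .inl e1.symm
    · rcases hw with ⟨-, h1, h2⟩ | h
      · exact .inr (.inr (.inr (.inr ⟨e2.trans h2, h1⟩)))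
      · exact .inr (.inr (.inl (by rw [e2, h, hy])))
    · rcases hw with ⟨-, h1, h2⟩ | h
      · exact .inr (.inr (.inr (.inl ⟨e3.trans h1, h2⟩)))
      · exact .inr (.inr (.inl (by rw [h, e3])))
    · exact ih v

end walk

namespace BForest

variable {adj : ℕ → ℕ → Prop} {M : ℕ → ℕ} {Z D A : Finset ℕ} {N : ℕ → ℕ → ℕ} {blk c p : ℕ → ℕ}

/-- If a walk uncovers outer vertices only, the edge that it started from joins two vertices of the
same blossom: otherwise it could go on until the matching agrees with that of `y`. -/
theorem blk_eq_of_walk (h : BForest adj M Z D A N blk c p) (hs : ∀ {u v}, adj u v → adj v u)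
    {x y n : ℕ} (hx : x ∈ Z) (hy : y ∈ Z) (hxy : adj x y) (hn : (D ∪ A).card ≤ n)
    (hw : ∀ i < n, (walk (N x) (N y) x y (i + 1)).2.1 ∈ D) : blk x = blk y := by
  by_contra hne
  have hxD := h.sub hx
  have hyD := h.sub hy
  have hyx : y ≠ x := fun e => hne (by rw [e])
  have hNy := h.inv y hy
  -- If the classes of `x` and `y` differ, the walk is confined to that of `y` and never closes.
  -- Each rotation makes the current matching agree with `N y` in at least one more vertex, which
  -- cannot go on for `n` steps.
  have key : ∀ i < n, (walk (N x) (N y) x y (i + 1)).1 y = x ∧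
      blk (walk (N x) (N y) x y (i + 1)).2.1 = blk y ∧ (walk (N x) (N y) x y (i + 1)).2.1 ≠ y ∧
      i ≤ ((D ∪ A).filter fun v => (walk (N x) (N y) x y (i + 1)).1 v = N y v).card := by
    intro i hi
    induction i with
    | zero =>
      have hu := hw 0 hi
      have hty : N x y ≠ y := fun e => hyx (h.fix x hx y (.inl hyD) e)
      refine ⟨?_, h.same x hx y hyD hu, hty, Nat.zero_le _⟩
      simp [walk, rot_apply, hty.symm]
    | succ i ih =>
      obtain ⟨h1, h2, h3, h4⟩ := ih (by omega)
      have hu := hw i (by omega)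
      have ht := hw (i + 1) hi
      have hE := walk_edge (Nx := N x) (x := x) (y := y) (h.inv y hy) (i + 1)
      obtain ⟨hm, -, -, -⟩ := walk_mem (h.near hx) (h.near hy) hs hxD hyD hxy (i + 1)
      have ew : (walk (N x) (N y) x y (i + 1)).2.2 = N y (walk (N x) (N y) x y (i + 1)).2.1 := rfl
      rw [walk] at ht ⊢
      rw [ew] at ht ⊢
      dsimp only at ht ⊢
      generalize (walk (N x) (N y) x y (i + 1)).1 = m at *
      generalize (walk (N x) (N y) x y (i + 1)).2.1 = u at *
      have hwu : N y u ≠ u := fun e => h3 (h.fix y hy u (.inl hu) e)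
      -- By `inner_ne`, `N y` joins no inner vertex to the class of `y`, so the partner of `u` is
      -- outer.
      have hwD : N y u ∈ D := by
        rcases h.stab y hy u (.inl hu) with h' | h'
        · exact h'
        · exact absurd (by rw [hNy, h2]) (h.inner_ne hy h')
      have hwb : blk (N y u) = blk y := (h.same y hy u hu hwD).trans h2
      have hwy : N y u ≠ y := fun e => h3 (by rw [← hNy u, e, h.self y hy])
      have hwx : N y u ≠ x := fun e => hne (by rw [← hwb, e])
      have hmw : m (N y u) ≠ N y u := fun e => hwu (hm.fix _ (.inl hwD) e)
      have hmu : m (N y u) ≠ u := fun e => hwu (by rw [← hm.inv (N y u), e, hm.self])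
      -- Of the possibilities in `walk_edge` all others are excluded by now.
      have htx : m (N y u) = N x (N y u) := by
        have := hE (N y u)
        rw [hNy] at this
        tauto
      have hty : m (N y u) ≠ y := fun e => hwx (by rw [← hm.inv (N y u), e, h1])
      refine ⟨?_, ?_, hty, ?_⟩
      · rw [rot_apply, if_neg hty.symm, if_neg hwy.symm, if_neg h3.symm, h1]
      · rw [htx] at ht ⊢
        exact (h.same x hx _ hwD ht).trans hwb
      -- The vertex `u` was uncovered and now has its partner in `N y`; no earlier agreement is
      -- lost.
      · refine (Nat.succ_le_succ h4).trans (Finset.card_lt_card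
          ((Finset.ssubset_iff_of_subset fun v hv => ?_).2 ⟨u, ?_, ?_⟩))
        · rw [Finset.mem_filter] at hv ⊢
          refine ⟨hv.1, ?_⟩
          rw [rot_apply]
          split_ifs with e1 e2 e3
          · exfalso
            have e := hv.2
            rw [e1, hm.inv] at e
            apply hmu
            rw [← hNy (m (N y u)), ← e, hNy]
          · rw [e2, hNy]
          · rw [e3]
          · exact hv.2
        · rw [Finset.mem_filter, rot_apply, if_neg hmu.symm, if_neg hwu.symm, if_pos rfl]
          exact ⟨Finset.mem_union_left _ hu, rfl⟩
        · rw [Finset.mem_filter, hm.self]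
          exact fun e => hwu e.2.symm
  have hcard : 0 < (D ∪ A).card := Finset.card_pos.2 ⟨x, Finset.mem_union_left _ hxD⟩
  obtain ⟨h1, -, h3, h4⟩ := key (n - 1) (by omega)
  have hu := hw (n - 1) (by omega)
  obtain ⟨hm, -, -, -⟩ := walk_mem (h.near hx) (h.near hy) hs hxD hyD hxy (n - 1 + 1)
  generalize (walk (N x) (N y) x y (n - 1 + 1)).1 = m at *
  generalize (walk (N x) (N y) x y (n - 1 + 1)).2.1 = u at *
  -- Agreement fails at `y` and at `u`, so it is limited to `(D ∪ A).card - 2` vertices.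
  have hlt : ((D ∪ A).filter fun v => m v = N y v).card < ((D ∪ A).erase y).card := by
    refine Finset.card_lt_card ((Finset.ssubset_iff_of_subset fun v hv => ?_).2 ⟨u, ?_, ?_⟩)
    · rw [Finset.mem_filter] at hv
      refine Finset.mem_erase.2 ⟨?_, hv.1⟩
      rintro rfl
      exact hyx (by rw [← h.self v hy, ← hv.2, h1])
    · exact Finset.mem_erase.2 ⟨h3, Finset.mem_union_left _ hu⟩
    · rw [Finset.mem_filter, hm.self]
      exact fun e => h3 (h.fix y hy u (.inl hu) e.2.symm)
  rw [Finset.card_erase_of_mem (Finset.mem_union_left _ hyD)] at hlt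
  omega

/-- The vertices that a walk uncovers become outer vertices. -/
theorem blossom (h : BForest adj M D D A N blk c p) (hs : ∀ {u v}, adj u v → adj v u)
    {x y n : ℕ} (hx : x ∈ D) (hy : y ∈ D) (hxy : adj x y) (hn : (D ∪ A).card ≤ n)
    {D' A' : Finset ℕ} {N' : ℕ → ℕ → ℕ} (hA' : ∀ v, v ∈ A' ↔ v ∈ A ∧ v ∉ D')
    (hD' : ∀ v, v ∈ D' ↔ v ∈ D ∨ ∃ i < n, v = (walk (N x) (N y) x y (i + 1)).2.1)
    (hold : ∀ z ∈ D, N' z = N z)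
    (hnew : ∀ z ∈ D', z ∉ D → ∃ i < n, z = (walk (N x) (N y) x y (i + 1)).2.1 ∧
      N' z = (walk (N x) (N y) x y (i + 1)).1) :
    ∃ blk', BForest adj M D' D' A' N' blk' c p := by
  have hwm := walk_mem (h.near hx) (h.near hy) hs hx hy hxy
  have hDD : D ⊆ D' := fun v hv => (hD' v).2 (.inl hv)
  have hT : ∀ v, v ∈ D' ∨ v ∈ A' ↔ v ∈ D ∨ v ∈ A := by
    intro v
    constructor
    · rintro (hv | hv)
      · rcases (hD' v).1 hv with hv | ⟨i, _, rfl⟩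
        exacts [.inl hv, (hwm (i + 1)).2.1]
      · exact .inr ((hA' v).1 hv).1
    · rintro (hv | hv)
      · exact .inl (hDD hv)
      · by_cases hv' : v ∈ D'
        · exact .inl hv'
        · exact .inr ((hA' v).2 ⟨hv, hv'⟩)
  -- With the uncovered inner vertices already merged, the walk uncovers outer vertices only. This
  -- is the situation of `blk_eq_of_walk`, so the edge `x y` lies within a class.
  obtain ⟨blk', h'⟩ := h.merge_all (A.filter fun v => v ∈ D') (Finset.filter_subset _ _)
  have e1 : D ∪ (A.filter fun v => v ∈ D') = D' := by
    ext v
    have := hT v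
    have := @hDD v
    simp only [Finset.mem_union, Finset.mem_filter]
    tauto
  have e2 : A \ (A.filter fun v => v ∈ D') = A' := by
    ext v
    simp only [Finset.mem_sdiff, Finset.mem_filter, hA']
    tauto
  rw [e1, e2] at h'
  have e3 : D' ∪ A' = D ∪ A := by
    ext v
    simpa using hT v
  have hxyb : blk' x = blk' y := h'.blk_eq_of_walk hs hx hy hxy (n := n) (by rw [e3]; exact hn)
    fun i hi => (hD' _).2 (.inr ⟨i, hi, rfl⟩)
  have near : ∀ z ∈ D', NearMatch adj M D' A' (N' z) z := by
    intro z hz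
    by_cases hzD : z ∈ D
    · rw [hold z hzD]
      exact h'.near hzD
    · obtain ⟨i, _, e, e'⟩ := hnew z hz hzD
      have := (walk_mem (h'.near hx) (h'.near hy) hs (hDD hx) (hDD hy) hxy (i + 1)).1
      rwa [← e, ← e'] at this
  -- The conditions `tree` and `same` concern single edges, so they pass from the old matchings to
  -- those composed of their edges and `x y`.
  have edge : ∀ z ∈ D', ∀ v, N' z v = v ∨ (∃ z' ∈ D, N' z v = N z' v) ∨
      (v = x ∧ N' z v = y) ∨ (v = y ∧ N' z v = x) := by
    intro z hz v
    by_cases hzD : z ∈ D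
    · exact .inr (.inl ⟨z, hzD, by rw [hold z hzD]⟩)
    · obtain ⟨i, _, e, e'⟩ := hnew z hz hzD
      rw [e']
      rcases walk_edge (Nx := N x) (x := x) (y := y) (h.inv y hy) (i + 1) v with h1 | h1 | h1 | h1
      · exact .inl h1
      · exact .inr (.inl ⟨x, hx, h1⟩)
      · exact .inr (.inl ⟨y, hy, h1⟩)
      · exact .inr (.inr h1)
  refine ⟨blk', ⟨h'.disj, subset_rfl, fun z hz => (near z hz).inv, fun z hz => (near z hz).adj,
    fun z hz => (near z hz).self, fun z hz => (near z hz).fix, fun z hz => (near z hz).out,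
    fun z hz => (near z hz).stab, fun z hz a ha => ?_, fun a ha => hDD (h'.cmem a ha),
    fun a ha => hDD (h'.pmem a ha), fun z hz v hv hv' => ?_, h'.odd, h'.card⟩⟩
  · rcases edge z hz a with h1 | ⟨z', hz', h1⟩ | ⟨rfl, -⟩ | ⟨rfl, -⟩
    · exact absurd ha (h'.disj a ((near z hz).fix a (.inr ha) h1 ▸ hz))
    · rw [h1]
      exact h'.tree z' hz' a ha
    · exact absurd ha (h'.disj a (hDD hx))
    · exact absurd ha (h'.disj a (hDD hy))
  · rcases edge z hz v with h1 | ⟨z', hz', h1⟩ | ⟨rfl, h1⟩ | ⟨rfl, h1⟩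
    · rw [h1]
    · rw [h1] at hv' ⊢
      exact h'.same z' hz' v hv hv'
    · rw [h1, hxyb]
    · rw [h1, hxyb]

/-- An unreached neighbour of an outer vertex becomes an inner vertex, and its partner an outer
vertex. -/
theorem grow (h : BForest adj M D D A N blk c p) (hs : ∀ {u v}, adj u v → adj v u)
    {x y : ℕ} (hx : x ∈ D) (hxy : adj x y) (hyD : y ∉ D) (hyA : y ∉ A) (hy : N x y ≠ y)
    {N' : ℕ → ℕ → ℕ} (hold : ∀ z ∈ D, N' z = N z) (hnew : N' (N x y) = rot (N x) x y) :
    ∃ blk' c' p', BForest adj M (insert (N x y) D) (insert (N x y) D) (insert y A) N' blk' c' p' := by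
  have hMy : ∀ z ∈ D, N z y = M y := fun z hz => h.out z hz y hyD hyA
  have ht : N x y ∉ D ∧ N x y ∉ A := by
    by_contra h'
    have := h.stab x hx (N x y) (by tauto)
    rw [h.inv x hx] at this
    tauto
  have hMt : ∀ z ∈ D, N z (N x y) = y := fun z hz => by
    rw [hMy x hx, ← hMy z hz, h.inv z hz]
  generalize hte : N x y = t at *
  have hxt : x ≠ t := fun e => ht.1 (e ▸ hx)
  have hxy' : x ≠ y := fun e => hyD (e ▸ hx)
  have near : ∀ z ∈ D, NearMatch adj M (insert t D) (insert y A) (N z) z := by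
    intro z hz
    have hn := h.near hz
    refine ⟨hn.inv, hn.adj, hn.self, fun v hv e => ?_, fun v hv hv' => ?_, fun v hv => ?_⟩
    · simp only [Finset.mem_insert] at hv
      by_cases e1 : v = y
      · rw [e1, hMy z hz, ← hMy x hx, hte] at e
        exact absurd e hy
      by_cases e2 : v = t
      · rw [e2, hMt z hz] at e
        exact absurd e.symm hy
      exact hn.fix v (by tauto) e
    · simp only [Finset.mem_insert, not_or] at hv hv'
      exact hn.out v hv.2 hv'.2
    · simp only [Finset.mem_insert] at hv ⊢
      by_cases e1 : v = y
      · rw [e1, hMy z hz, ← hMy x hx, hte]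
        simp
      by_cases e2 : v = t
      · rw [e2, hMt z hz]
        simp
      have := hn.stab v (by tauto)
      tauto
  have neart : NearMatch adj M (insert t D) (insert y A) (N' t) t := by
    rw [hnew, ← hte]
    exact hte ▸ (near x hx).rot hs (by simp [hx]) (by simp) fun _ => hxy
  have near' : ∀ z ∈ insert t D, NearMatch adj M (insert t D) (insert y A) (N' z) z := by
    intro z hz
    rcases Finset.mem_insert.1 hz with rfl | hz
    · exact neart
    · rw [hold z hz]
      exact near z hz
  have hN't : ∀ v, v ≠ t → v ≠ y → v ≠ x → N' t v = N x v := by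
    intro v h1 h2 h3
    rw [hnew, rot_apply, hte, if_neg h1, if_neg h2, if_neg h3]
  have htD : ∀ v ∈ D, v ≠ t := fun v hv e => ht.1 (e ▸ hv)
  have hyDD : ∀ v ∈ D, v ≠ y := fun v hv e => hyD (e ▸ hv)
  have htA : ∀ v ∈ A, v ≠ t := fun v hv e => ht.2 (e ▸ hv)
  have hyAA : ∀ v ∈ A, v ≠ y := fun v hv e => hyA (e ▸ hv)
  -- The new outer vertex forms a class by itself, with an unused name.
  obtain ⟨f, hf⟩ := Infinite.exists_notMem_finset (D.image blk)
  have hfb : ∀ v ∈ D, blk v ≠ f := fun v hv e => hf (e ▸ Finset.mem_image_of_mem blk hv)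
  have hupd : ∀ v ∈ D, Function.update blk t f v = blk v := fun v hv =>
    Function.update_of_ne (htD v hv) _ _
  have himage : (insert t D).image (Function.update blk t f) = insert f (D.image blk) := by
    rw [Finset.image_insert, Function.update_self]
    congr 1
    exact Finset.image_congr hupd
  -- All the old matchings join `y` to `t`, and the new one joins `y` to `x`; this gives the two
  -- values at `y` in the condition `tree`.
  refine ⟨Function.update blk t f, Function.update c y t, Function.update p y x,
    ⟨?_, subset_rfl, fun z hz => (near' z hz).inv, fun z hz => (near' z hz).adj,
    fun z hz => (near' z hz).self, fun z hz => (near' z hz).fix, fun z hz => (near' z hz).out,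
    fun z hz => (near' z hz).stab, fun z hz a ha => ?_, fun a ha => ?_, fun a ha => ?_,
    fun z hz v hv hv' => ?_, fun b hb => ?_, ?_⟩⟩
  · intro v hv hv'
    simp only [Finset.mem_insert] at hv hv'
    rcases hv with rfl | hv <;> rcases hv' with e | hv'
    exacts [hy e, ht.2 hv', hyDD v hv e, h.disj v hv hv']
  · rcases Finset.mem_insert.1 ha with rfl | ha
    · rw [Function.update_self, Function.update_self]
      rcases Finset.mem_insert.1 hz with rfl | hz
      · right
        rw [hnew, rot_apply, hte, if_neg (Ne.symm hy), if_pos rfl]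
      · left
        rw [hold z hz, hMy z hz, ← hMy x hx, hte]
    · rw [Function.update_of_ne (hyAA a ha), Function.update_of_ne (hyAA a ha)]
      rcases Finset.mem_insert.1 hz with rfl | hz
      · rw [hN't a (htA a ha) (hyAA a ha) fun e => h.disj x hx (e ▸ ha)]
        exact h.tree x hx a ha
      · rw [hold z hz]
        exact h.tree z hz a ha
  · rcases Finset.mem_insert.1 ha with rfl | ha
    · simp
    · rw [Function.update_of_ne (hyAA a ha)]
      exact Finset.mem_insert_of_mem (h.cmem a ha)
  · rcases Finset.mem_insert.1 ha with rfl | ha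
    · simp [hx]
    · rw [Function.update_of_ne (hyAA a ha)]
      exact Finset.mem_insert_of_mem (h.pmem a ha)
  · by_cases hvt : N' z v = v
    · rw [hvt]
    rcases Finset.mem_insert.1 hz with rfl | hz
    · have hv1 : v ≠ z := fun e => hvt (by rw [e, neart.self])
      have hv := (Finset.mem_insert.1 hv).resolve_left hv1
      have hvx : v ≠ x := by
        rintro rfl
        rw [hnew, rot_apply, hte, if_neg hxt, if_neg hxy', if_pos rfl] at hv'
        rcases Finset.mem_insert.1 hv' with e | e
        exacts [hy e.symm, hyD e]
      rw [hN't v hv1 (hyDD v hv) hvx] at hv' ⊢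
      have hv2 : N x v ≠ z := fun e => hyDD v hv (by rw [← h.inv x hx v, e, hMt x hx])
      have hv' := (Finset.mem_insert.1 hv').resolve_left hv2
      rw [hupd _ hv', hupd v hv]
      exact h.same x hx v hv hv'
    · rw [hold z hz] at hv' ⊢
      have hv1 : v ≠ t := by
        intro e
        rw [e, hMt z hz] at hv'
        rcases Finset.mem_insert.1 hv' with e | e
        exacts [hy e.symm, hyD e]
      have hv := (Finset.mem_insert.1 hv).resolve_left hv1
      have hv2 : N z v ≠ t := fun e => hyDD v hv (by rw [← h.inv z hz v, e, hMt z hz])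
      have hv' := (Finset.mem_insert.1 hv').resolve_left hv2
      rw [hupd _ hv', hupd v hv]
      exact h.same z hz v hv hv'
  · rw [himage] at hb
    rcases Finset.mem_insert.1 hb with rfl | hb
    · have : ((insert t D).filter fun v => Function.update blk t b v = b) = {t} := by
        ext v
        simp only [Finset.mem_filter, Finset.mem_insert, Finset.mem_singleton]
        constructor
        · rintro ⟨rfl | hv, e⟩
          · rfl
          · rw [hupd v hv] at e
            exact absurd e (hfb v hv)
        · rintro rfl
          simp
      rw [this]
      simp
    · have hbf : f ≠ b := fun e => hf (e ▸ hb)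
      have : ((insert t D).filter fun v => Function.update blk t f v = b) =
          D.filter fun v => blk v = b := by
        ext v
        simp only [Finset.mem_filter, Finset.mem_insert]
        constructor
        · rintro ⟨rfl | hv, e⟩
          · rw [Function.update_self] at e
            exact absurd e hbf
          · exact ⟨hv, by rwa [hupd v hv] at e⟩
        · rintro ⟨hv, e⟩
          exact ⟨.inr hv, by rwa [hupd v hv]⟩
      rw [this]
      exact h.odd b hb
  · rw [himage, Finset.card_insert_of_notMem hf, Finset.card_insert_of_notMem hyA]
    exact Nat.add_le_add_right h.card 1

end BForest

/-! ### Augmentation, and the certificate of maximality. -/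

section augment

variable {adj : ℕ → ℕ → Prop} {M : ℕ → ℕ} {D A S : Finset ℕ} {m : ℕ → ℕ} {u : ℕ}

theorem NearMatch.isMatch (h : NearMatch adj M D A m u) (hM : IsMatch adj S M)
    (hT : D ∪ A ⊆ S) : IsMatch adj S m :=
  ⟨h.inv, fun v hv => by
    have hv' : v ∉ D ∪ A := fun h' => hv (hT h')
    rw [Finset.mem_union, not_or] at hv'
    rw [h.out v hv'.1 hv'.2, hM.out v hv], h.adj⟩

/-- Among the reached vertices only `u` is missed, and elsewhere `m` is `M`. The right side does not
depend on `m`, so all near matchings have the same size. -/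
theorem NearMatch.card_moved (h : NearMatch adj M D A m u) (hu : u ∈ D ∪ A) (hT : D ∪ A ⊆ S) :
    (moved S m).card + 1 = (D ∪ A).card + (moved (S \ (D ∪ A)) M).card := by
  have e : moved S m = (D ∪ A).erase u ∪ moved (S \ (D ∪ A)) M := by
    ext v
    simp only [mem_moved, Finset.mem_union, Finset.mem_erase, Finset.mem_sdiff]
    by_cases hv : v ∈ D ∨ v ∈ A
    · have h1 : m v = v ↔ v = u := ⟨h.fix v hv, fun e => e ▸ h.self⟩
      have h2 : v ∈ S := hT (Finset.mem_union.2 hv)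
      tauto
    · rw [not_or] at hv
      rw [h.out v hv.1 hv.2]
      tauto
  rw [e, Finset.card_union_of_disjoint, Finset.card_erase_of_mem hu]
  · have := Finset.card_pos.2 ⟨u, hu⟩
    omega
  · rw [Finset.disjoint_left]
    intro v hv hv'
    exact (Finset.mem_sdiff.1 (mem_moved.1 hv').1).2 (Finset.mem_of_mem_erase hv)

/-- An uncovered neighbour of an outer vertex gives a larger matching. -/
theorem NearMatch.augment {m₀ : ℕ → ℕ} {r : ℕ} (h : NearMatch adj M D A m u)
    (h₀ : NearMatch adj M D A m₀ r) (hs : ∀ {u v}, adj u v → adj v u) (hM : IsMatch adj S M)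
    (hu : u ∈ D ∪ A) (hr : r ∈ D ∪ A) (hT : D ∪ A ⊆ S) {y : ℕ} (hy : y ∈ S) (hyu : u ≠ y)
    (huy : adj u y) (hmy : m y = y) :
    IsMatch adj S (Function.update (Function.update m u y) y u) ∧
      (moved S (Function.update (Function.update m u y) y u)).card = (moved S m₀).card + 2 := by
  have h1 := (h.isMatch hM hT).erase h.self
  have h2 := h1.erase hmy
  obtain ⟨h3, h4⟩ := h2.link hs (v := u) (w := y) (by simp) (by simp) hyu huy
  have e : insert u (insert y ((S.erase u).erase y)) = S := by
    rw [Finset.insert_erase (Finset.mem_erase.2 ⟨hyu.symm, hy⟩), Finset.insert_erase (hT hu)]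
  rw [e] at h3 h4
  refine ⟨h3, ?_⟩
  have h5 : moved ((S.erase u).erase y) m = moved S m := by
    rw [h2.moved_eq_of_subset ((Finset.erase_subset _ _).trans (Finset.erase_subset _ _))]
  have h6 := h.card_moved hu hT
  have h7 := h₀.card_moved hr hT
  rw [h4, h5, Finset.card_insert_of_notMem, Finset.card_insert_of_notMem]
  · omega
  · simp [mem_moved, hmy]
  · simp [mem_moved, hyu, h.self]

end augment

/-- A search that cannot be continued and has not found an augmenting path certifies that
there is none. -/
theorem BForest.nu_eq {adj : ℕ → ℕ → Prop} {M : ℕ → ℕ} {D A S : Finset ℕ} {N : ℕ → ℕ → ℕ}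
    {blk c p : ℕ → ℕ} {r : ℕ} (h : BForest adj M D D A N blk c p)
    (hs : ∀ {u v}, adj u v → adj v u) (hM : IsMatch adj S M) (hr : r ∈ D) (hNr : N r = M) (hT : D ∪ A ⊆ insert r S)
    (closed : ∀ x ∈ D, ∀ y ∈ insert r S, adj x y → y ∈ A ∨ y ∈ D ∧ blk x = blk y) :
    nu adj (insert r S) = nu adj S := by
  refine le_antisymm ?_ (nu_mono (Finset.subset_insert r S))
  obtain ⟨m, hm, e⟩ := exists_isMatch_eq_nu adj (insert r S)
  rw [← e]
  have hnr : NearMatch adj M D A M r := hNr ▸ h.near hr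
  have hMr : M r = r := hnr.self
  have hDA : Disjoint D A := Finset.disjoint_left.2 h.disj
  -- the matching that agrees with `M` on the forest and with `m` elsewhere
  set W := insert r S \ (D ∪ A) with hW
  obtain ⟨f, hf⟩ : ∃ f : ℕ → ℕ, ∀ v, f v = if v ∈ D ∨ v ∈ A then M v else
      if v ∈ W ∧ m v ∈ W then m v else v := ⟨_, fun _ => rfl⟩
  have hWT : ∀ v ∈ W, ¬ (v ∈ D ∨ v ∈ A) := fun v hv h' =>
    (Finset.mem_sdiff.1 hv).2 (Finset.mem_union.2 h')
  have hfT : ∀ v, v ∈ D ∨ v ∈ A → f v = M v := fun v hv => by rw [hf, if_pos hv]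
  have hfm : IsMatch adj S f := by
    refine ⟨fun v => ?_, fun v hv => ?_, fun v hv => ?_⟩
    · by_cases hvT : v ∈ D ∨ v ∈ A
      · rw [hfT v hvT, hfT _ (hnr.stab v hvT), hM.inv]
      · by_cases hvW : v ∈ W ∧ m v ∈ W
        · rw [hf v, if_neg hvT, if_pos hvW, hf, if_neg (hWT _ hvW.2), hm.inv,
            if_pos ⟨hvW.2, hvW.1⟩]
        · have : f v = v := by rw [hf v, if_neg hvT, if_neg hvW]
          rw [this, this]
    · by_cases hvT : v ∈ D ∨ v ∈ A
      · rw [hfT v hvT, hM.out v hv]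
      · have hvr : v ≠ r := fun e => hvT (.inl (e ▸ hr))
        rw [hf, if_neg hvT]
        split_ifs with h'
        · have := (Finset.mem_sdiff.1 h'.1).1
          exact absurd ((Finset.mem_insert.1 this).resolve_left hvr) hv
        · rfl
    · rw [hf] at hv ⊢
      split_ifs at hv ⊢ with h1 h2
      · exact hM.adj v hv
      · exact hm.adj v hv
      · exact absurd rfl hv
  have hfmax := hfm.le_nu
  -- counting
  set WW := W.filter fun v => m v ∈ W ∧ m v ≠ v
  set WA := W.filter fun v => m v ∈ A
  set DA := D.filter fun v => m v ∈ A
  set DF := D.filter fun v => m v = v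
  have cf : (moved S f).card + 1 = (D ∪ A).card + WW.card := by
    have e1 : moved S f = (D ∪ A).erase r ∪ WW := by
      ext v
      rw [← hfm.moved_eq_of_subset (Finset.subset_insert r S)]
      simp only [mem_moved, Finset.mem_union, Finset.mem_erase, WW, Finset.mem_filter]
      by_cases hv : v ∈ D ∨ v ∈ A
      · have h1 : M v = v ↔ v = r := ⟨hnr.fix v hv, fun e => e ▸ hMr⟩
        have h2 : v ∈ insert r S := hT (Finset.mem_union.2 hv)
        have h3 := hWT v
        rw [hfT v hv]
        tauto
      · rw [hf, if_neg hv]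
        have h3 : v ∈ W ↔ v ∈ insert r S := by
          rw [hW, Finset.mem_sdiff, Finset.mem_union]
          tauto
        split_ifs with h'
        · tauto
        · tauto
    rw [e1, Finset.card_union_of_disjoint,
      Finset.card_erase_of_mem (Finset.mem_union_left _ hr)]
    · have := Finset.card_pos.2 ⟨r, Finset.mem_union_left A hr⟩
      omega
    · rw [Finset.disjoint_left]
      intro v hv hv'
      exact hWT v (Finset.mem_filter.1 hv').1 (Finset.mem_union.1 (Finset.mem_of_mem_erase hv))
  -- A vertex of `W` has no outer neighbours because the search is closed, so `m` joins it to `W` or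
  -- to `A`.
  have cm : (moved (insert r S) m).card ≤ (D \ DF).card + A.card + WW.card + WA.card := by
    have : moved (insert r S) m ⊆ ((D \ DF) ∪ A) ∪ WW ∪ WA := by
      intro v hv
      rw [mem_moved] at hv
      simp only [Finset.mem_union, Finset.mem_sdiff, DF, WW, WA, Finset.mem_filter]
      by_cases hvD : v ∈ D
      · tauto
      by_cases hvA : v ∈ A
      · tauto
      have hvW : v ∈ W := by
        rw [hW, Finset.mem_sdiff, Finset.mem_union]
        tauto
      have hmv := hm.mem hv.1
      by_cases hmA : m v ∈ A
      · tauto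
      have hmD : m v ∉ D := fun h' => by
        have := closed _ h' v hv.1 (hs (hm.adj v hv.2))
        tauto
      have : m v ∈ W := by
        rw [hW, Finset.mem_sdiff, Finset.mem_union]
        tauto
      tauto
    refine (Finset.card_le_card this).trans ((Finset.card_union_le _ _).trans ?_)
    have h1 := Finset.card_union_le ((D \ DF) ∪ A) WW
    have h2 := Finset.card_union_le (D \ DF) A
    omega
  -- An odd class contains a vertex that `m` misses or joins to `A`, since no other edges leave it.
  have cb : (D.image blk).card ≤ DF.card + DA.card := by
    have : D.image blk ⊆ (DF ∪ DA).image blk := by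
      intro b hb
      by_contra hno
      have hno' : ∀ v ∈ D, blk v = b → m v ≠ v ∧ m v ∉ A := by
        intro v hv hvb
        constructor <;> intro h' <;>
        refine hno (Finset.mem_image.2 ⟨v, ?_, hvb⟩) <;>
        simp only [Finset.mem_union, DF, DA, Finset.mem_filter] <;> tauto
      refine Nat.not_even_iff_odd.2 (h.odd b hb) (even_card_of_involution (f := m)
        (fun v hv => ?_) (fun v _ => hm.inv v) fun v hv => ?_)
      · rw [Finset.mem_filter] at hv ⊢
        obtain ⟨h1, h2⟩ := hno' v hv.1 hv.2
        have hvS := hT (Finset.mem_union_left A hv.1)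
        rcases closed v hv.1 (m v) (hm.mem hvS) (hm.adj v h1) with h3 | h3
        · exact absurd h3 h2
        · exact ⟨h3.1, h3.2.symm.trans hv.2⟩
      · rw [Finset.mem_filter] at hv
        exact (hno' v hv.1 hv.2).1
    exact (Finset.card_le_card this).trans
      (Finset.card_image_le.trans (Finset.card_union_le _ _))
  have cA : DA.card + WA.card ≤ A.card := by
    rw [← Finset.card_union_of_disjoint]
    · refine Finset.card_le_card_of_injOn m (fun v hv => ?_) fun v _ w _ hvw => ?_
      · rcases Finset.mem_union.1 hv with hv | hv
        exacts [(Finset.mem_filter.1 hv).2, (Finset.mem_filter.1 hv).2]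
      · rw [← hm.inv v, hvw, hm.inv]
    · rw [Finset.disjoint_left]
      intro v hv hv'
      exact hWT v (Finset.mem_filter.1 hv').1 (.inl (Finset.mem_filter.1 hv).1)
  have cD : (D \ DF).card + DF.card = D.card :=
    Finset.card_sdiff_add_card_eq_card (Finset.filter_subset _ _)
  have cT : (D ∪ A).card = D.card + A.card := Finset.card_union_of_disjoint hDA
  -- Together the counts bound the size of `m` by `(D ∪ A).card + WW.card + A.card - (D.image
  -- blk).card`. The classes outnumber `A`, so this is at most the size of `f`.
  have := h.card
  omega

/-! ### A small imperative language and its compilation to random access machines -/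

namespace Imp

/-- A store has 63 arrays of natural numbers. -/
abbrev Store := Fin 63 → ℕ → ℕ

/-- Assignment to an entry of an array. -/
def Store.set (σ : Store) (k : Fin 63) (i v : ℕ) : Store :=
  Function.update σ k (Function.update (σ k) i v)

theorem Store.set_apply (σ : Store) (k : Fin 63) (i v : ℕ) (k' : Fin 63) (i' : ℕ) :
    σ.set k i v k' i' = if k' = k ∧ i' = i then v else σ k' i' := by
  unfold Store.set
  by_cases h : k' = k
  · subst h
    by_cases h' : i' = i
    · simp [h']
    · simp [h']
  · simp [h]

theorem Store.set_of_ne (σ : Store) {k k' : Fin 63} (i v : ℕ) (h : k' ≠ k) :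
    σ.set k i v k' = σ k' :=
  Function.update_of_ne h _ _

inductive Expr
  | lit (c : ℕ)
  | get (k : Fin 63) (e : Expr)
  | add (e₁ e₂ : Expr)
  | sub (e₁ e₂ : Expr)
  | inp (e : Expr)

inductive Stmt
  | skip
  | set (k : Fin 63) (e₁ e₂ : Expr)
  | seq (s₁ s₂ : Stmt)
  | ite (e : Expr) (s₁ s₂ : Stmt)
  | loop (v : Fin 63) (e : Expr) (s : Stmt)

/-- Iteration with access to the number of the round. -/
def forLoop {α : Type} (f : ℕ → α → α) : ℕ → α → α
  | 0, a => a
  | n + 1, a => f n (forLoop f n a)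

theorem forLoop_induction {α : Type} {f : ℕ → α → α} {n : ℕ} {a : α} (I : ℕ → α → Prop)
    (h0 : I 0 a) (hs : ∀ j < n, ∀ b, I j b → I (j + 1) (f j b)) : I n (forLoop f n a) := by
  induction n with
  | zero => exact h0
  | succ n ih => exact hs n (by omega) _ (ih fun j hj => hs j (by omega))

def Expr.eval (x : List ℕ) (σ : Store) : Expr → ℕ
  | lit c => c
  | get k e => σ k (e.eval x σ)
  | add e₁ e₂ => e₁.eval x σ + e₂.eval x σ
  | sub e₁ e₂ => e₁.eval x σ - e₂.eval x σ
  | inp e => x.getD (e.eval x σ) 0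

/-- The effect of a statement; `ite e s₁ s₂` executes `s₁` if `e` is not zero, and `loop v e s`
executes `s` for `v = 0, 1, …, e - 1`. -/
def Stmt.eval (x : List ℕ) : Stmt → Store → Store
  | skip, σ => σ
  | set k e₁ e₂, σ => σ.set k (e₁.eval x σ) (e₂.eval x σ)
  | seq s₁ s₂, σ => s₂.eval x (s₁.eval x σ)
  | ite e s₁ s₂, σ => if e.eval x σ = 0 then s₂.eval x σ else s₁.eval x σ
  | loop v e s, σ => forLoop (fun j τ => s.eval x (τ.set v 0 j)) (e.eval x σ) σ

def Stmt.writes : Stmt → List (Fin 63)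
  | skip => []
  | set k _ _ => [k]
  | seq s₁ s₂ => s₁.writes ++ s₂.writes
  | ite _ s₁ s₂ => s₁.writes ++ s₂.writes
  | loop v _ s => v :: s.writes

/-- This frame rule reduces the question of what a concrete piece of code leaves alone to `decide`.
-/
theorem Stmt.eval_of_notMem_writes (x : List ℕ) {k : Fin 63} :
    ∀ {s : Stmt}, k ∉ s.writes → ∀ σ, s.eval x σ k = σ k
  | skip, _, _ => rfl
  | set _ _ _, h, σ => σ.set_of_ne _ _ (by simpa [writes] using h)
  | seq s₁ s₂, h, σ => by
    simp only [writes, List.mem_append, not_or] at h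
    rw [eval, eval_of_notMem_writes x h.2, eval_of_notMem_writes x h.1]
  | ite e s₁ s₂, h, σ => by
    simp only [writes, List.mem_append, not_or] at h
    rw [eval]
    split_ifs
    exacts [eval_of_notMem_writes x h.2 σ, eval_of_notMem_writes x h.1 σ]
  | loop v e s, h, σ => by
    simp only [writes, List.mem_cons, not_or] at h
    rw [eval]
    refine forLoop_induction (fun _ (τ : Store) => τ k = σ k) rfl fun j _ τ hτ => ?_
    rw [eval_of_notMem_writes x h.2, Store.set_of_ne _ _ _ h.1, hτ]

/-! #### Compilation -/

open RAM (Instr Program Config)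

/-- The registers for intermediate results. -/
def tmp (t : ℕ) : ℕ := 63 + 64 * t

/-- The contents of the registers represent a store. -/
def Rep (σ : Store) (R : ℕ → ℕ) : Prop :=
  ∀ (k : Fin 63) (i : ℕ), R (k + 64 * i) = σ k i

/-- Entry `i` of array `k` is in register `k + 64 * i`. With 63 arrays the residue class of 63
modulo 64 is free for intermediate results. -/
theorem ne_tmp (k : Fin 63) (i t : ℕ) : (k : ℕ) + 64 * i ≠ tmp t := by
  unfold tmp
  omega

theorem tmp_inj {s t : ℕ} : tmp s = tmp t ↔ s = t := by
  unfold tmp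
  omega

theorem Rep.of_eq {σ : Store} {R R' : ℕ → ℕ} (h : Rep σ R)
    (h' : ∀ a, (∀ s, a ≠ tmp s) → R' a = R a) : Rep σ R' :=
  fun k i => (h' _ fun s => ne_tmp k i s).trans (h k i)

theorem Rep.set {σ : Store} {R : ℕ → ℕ} (h : Rep σ R) (k : Fin 63) (i v : ℕ) :
    Rep (σ.set k i v) (Function.update R (k + 64 * i) v) := by
  intro k' i'
  rw [Store.set_apply, Function.update_apply]
  have : (k' : ℕ) + 64 * i' = k + 64 * i ↔ k' = k ∧ i' = i := by
    rw [Fin.ext_iff]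
    omega
  simp only [this, h k' i']

/-- The instructions that turn an index in an array into an address. -/
def addressCode (k : Fin 63) (t : ℕ) : List Instr :=
  -- Six doublings multiply the index by 64.
  [.add (tmp t) (tmp t) (tmp t), .add (tmp t) (tmp t) (tmp t), .add (tmp t) (tmp t) (tmp t),
    .add (tmp t) (tmp t) (tmp t), .add (tmp t) (tmp t) (tmp t), .add (tmp t) (tmp t) (tmp t),
    .const (tmp (t + 1)) k,
    .add (tmp t) (tmp (t + 1)) (tmp t)]

/-- The result is left in `tmp t`, and nothing below `t` among the intermediate results is touched;
hence the second operand starts at `t + 1`. -/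
def Expr.code : Expr → ℕ → List Instr
  | lit c, t => [.const (tmp t) c]
  | get k e, t => e.code t ++ (addressCode k t ++ [.load (tmp t) (tmp t)])
  | add e₁ e₂, t => e₁.code t ++ (e₂.code (t + 1) ++ [.add (tmp t) (tmp t) (tmp (t + 1))])
  | sub e₁ e₂, t => e₁.code t ++ (e₂.code (t + 1) ++ [.sub (tmp t) (tmp t) (tmp (t + 1))])
  | inp e, t => e.code t ++ [.read (tmp t) (tmp t)]

def Expr.size : Expr → ℕ
  | lit _ => 1
  | get _ e => e.size + 9
  | add e₁ e₂ => e₁.size + e₂.size + 1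
  | sub e₁ e₂ => e₁.size + e₂.size + 1
  | inp e => e.size + 1

theorem Expr.length_code (e : Expr) (t : ℕ) : (e.code t).length = e.size := by
  induction e generalizing t <;> simp_all [code, size, addressCode] <;> omega

def Stmt.size : Stmt → ℕ
  | skip => 0
  | set _ e₁ e₂ => e₁.size + 8 + e₂.size + 1
  | seq s₁ s₂ => s₁.size + s₂.size
  | ite e s₁ s₂ => e.size + 1 + s₁.size + 1 + s₂.size
  | loop _ e s => e.size + 1 + 3 + s.size + 3

/-- The code of a statement that is placed at `b` and uses intermediate results from `t` on. -/
def Stmt.code : Stmt → ℕ → ℕ → List Instr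
  | skip, _, _ => []
  | set k e₁ e₂, t, _ =>
    e₁.code t ++ (addressCode k t ++ (e₂.code (t + 1) ++ [.store (tmp t) (tmp (t + 1))]))
  | seq s₁ s₂, t, b => s₁.code t b ++ s₂.code t (b + s₁.size)
  | ite e s₁ s₂, t, b =>
    e.code t ++ ([.jumpZero (tmp t) (b + e.size + 1 + s₁.size + 1)] ++
      (s₁.code t (b + e.size + 1) ++ ([.jump (b + e.size + 1 + s₁.size + 1 + s₂.size)] ++
        s₂.code t (b + e.size + 1 + s₁.size + 1))))
  -- `tmp t` holds the number of rounds, which is evaluated once, and `tmp (t + 1)` the counter.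
  -- `tmp (t + 2)` is needed only between the executions of the body, which may therefore use it.
  | loop v e s, t, b =>
    e.code t ++ ([.const (tmp (t + 1)) 0] ++
      ([.sub (tmp (t + 2)) (tmp t) (tmp (t + 1)),
        .jumpZero (tmp (t + 2)) (b + e.size + 1 + 3 + s.size + 3),
        .copy v (tmp (t + 1))] ++ (s.code (t + 2) (b + e.size + 1 + 3) ++
      [.const (tmp (t + 2)) 1, .add (tmp (t + 1)) (tmp (t + 1)) (tmp (t + 2)),
        .jump (b + e.size + 1)])))

theorem Stmt.length_code (s : Stmt) (t b : ℕ) : (s.code t b).length = s.size := by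
  induction s generalizing t b <;>
    simp_all [code, size, addressCode, Expr.length_code] <;> omega

/-- The time that the code of a statement takes. -/
def Stmt.cost (x : List ℕ) : Stmt → Store → ℕ
  | skip, _ => 0
  | set k e₁ e₂, _ => (set k e₁ e₂).size
  | seq s₁ s₂, σ => s₁.cost x σ + s₂.cost x (s₁.eval x σ)
  | ite e s₁ s₂, σ => e.size + 1 + if e.eval x σ = 0 then s₂.cost x σ else s₁.cost x σ + 1
  -- Each round has three instructions before the body and three after it; the final test takes two.
  | loop v e s, σ => e.size + 1 + (∑ j ∈ Finset.range (e.eval x σ),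
      (6 + s.cost x ((forLoop (fun j τ => s.eval x (τ.set v 0 j)) j σ).set v 0 j))) + 2

/-- The instruction is not a jump. -/
def IsStraight : Instr → Prop
  | .jump _ => False
  | .jumpZero _ _ => False
  | _ => True

theorem addressCode_straight (k : Fin 63) (t : ℕ) : ∀ i ∈ addressCode k t, IsStraight i := by
  simp [addressCode, IsStraight]

theorem Expr.code_straight (e : Expr) (t : ℕ) : ∀ i ∈ e.code t, IsStraight i := by
  induction e generalizing t with
  | lit c => simp [code, IsStraight]
  | get k e ih =>
    simp only [code, List.forall_mem_append]
    exact ⟨ih t, addressCode_straight k t, by simp [IsStraight]⟩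
  | add e₁ e₂ ih₁ ih₂ =>
    simp only [code, List.forall_mem_append]
    exact ⟨ih₁ t, ih₂ _, by simp [IsStraight]⟩
  | sub e₁ e₂ ih₁ ih₂ =>
    simp only [code, List.forall_mem_append]
    exact ⟨ih₁ t, ih₂ _, by simp [IsStraight]⟩
  | inp e ih =>
    simp only [code, List.forall_mem_append]
    exact ⟨ih t, by simp [IsStraight]⟩

/-- The effect of code without jumps on the registers. -/
def execAll (x : List ℕ) (l : List Instr) (R : ℕ → ℕ) : ℕ → ℕ :=
  l.foldl (fun R i => (RAM.exec x ⟨0, R⟩ i).reg) R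

theorem execAll_append (x : List ℕ) (l₁ l₂ : List Instr) (R : ℕ → ℕ) :
    execAll x (l₁ ++ l₂) R = execAll x l₂ (execAll x l₁ R) :=
  List.foldl_append

theorem execAll_singleton (x : List ℕ) (i : Instr) (R : ℕ → ℕ) :
    execAll x [i] R = (RAM.exec x ⟨0, R⟩ i).reg :=
  rfl

theorem execAll_addressCode (x : List ℕ) (k : Fin 63) (t : ℕ) (R : ℕ → ℕ) :
    execAll x (addressCode k t) R (tmp t) = k + 64 * R (tmp t) ∧
      ∀ a, (∀ s ≥ t, a ≠ tmp s) → execAll x (addressCode k t) R a = R a := by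
  have h : tmp (t + 1) ≠ tmp t := by simp [tmp_inj]
  constructor
  · simp [execAll, addressCode, RAM.exec, h.symm]
    omega
  · intro a ha
    have h1 := ha t le_rfl
    have h2 := ha (t + 1) (by omega)
    simp [execAll, addressCode, RAM.exec, h1, h2, Function.update_apply]

theorem Expr.execAll_code (x : List ℕ) {σ : Store} (e : Expr) (t : ℕ) {R : ℕ → ℕ}
    (hR : Rep σ R) : execAll x (e.code t) R (tmp t) = e.eval x σ ∧
      ∀ a, (∀ s ≥ t, a ≠ tmp s) → execAll x (e.code t) R a = R a := by
  induction e generalizing t R with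
  | lit c =>
    refine ⟨by simp [code, execAll, RAM.exec, eval], fun a ha => ?_⟩
    simp [code, execAll, RAM.exec, ha t le_rfl]
  | get k e ih =>
    obtain ⟨h1, h2⟩ := ih t hR
    obtain ⟨h3, h4⟩ := execAll_addressCode x k t (execAll x (e.code t) R)
    rw [code, execAll_append, execAll_append, execAll_singleton]
    generalize execAll x (addressCode k t) (execAll x (e.code t) R) = R'' at *
    generalize execAll x (e.code t) R = R' at *
    constructor
    · have := hR k (e.eval x σ)
      rw [← h2 _ fun s _ => ne_tmp k _ s, ← h4 _ fun s _ => ne_tmp k _ s] at this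
      simp [RAM.exec, h3, h1, this, eval]
    · intro a ha
      simp [RAM.exec, ha t le_rfl, h2 a ha, h4 a ha]
  | add e₁ e₂ ih₁ ih₂ =>
    obtain ⟨h1, h2⟩ := ih₁ t hR
    obtain ⟨h3, h4⟩ := ih₂ (t + 1) (hR.of_eq fun a ha => h2 a fun s _ => ha s)
    rw [code, execAll_append, execAll_append, execAll_singleton]
    generalize execAll x (e₂.code (t + 1)) (execAll x (e₁.code t) R) = R'' at *
    generalize execAll x (e₁.code t) R = R' at *
    constructor
    · have := h4 (tmp t) fun s hs => by rw [Ne, tmp_inj]; omega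
      simp [RAM.exec, h3, this, h1, eval]
    · intro a ha
      simp [RAM.exec, ha t le_rfl, h4 a fun s hs => ha s (by omega), h2 a ha]
  | sub e₁ e₂ ih₁ ih₂ =>
    obtain ⟨h1, h2⟩ := ih₁ t hR
    obtain ⟨h3, h4⟩ := ih₂ (t + 1) (hR.of_eq fun a ha => h2 a fun s _ => ha s)
    rw [code, execAll_append, execAll_append, execAll_singleton]
    generalize execAll x (e₂.code (t + 1)) (execAll x (e₁.code t) R) = R'' at *
    generalize execAll x (e₁.code t) R = R' at *
    constructor
    · have := h4 (tmp t) fun s hs => by rw [Ne, tmp_inj]; omega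
      simp [RAM.exec, h3, this, h1, eval]
    · intro a ha
      simp [RAM.exec, ha t le_rfl, h4 a fun s hs => ha s (by omega), h2 a ha]
  | inp e ih =>
    obtain ⟨h1, h2⟩ := ih t hR
    rw [code, execAll_append, execAll_singleton]
    generalize execAll x (e.code t) R = R' at *
    constructor
    · simp [RAM.exec, h1, eval]
    · intro a ha
      simp [RAM.exec, ha t le_rfl, h2 a ha]

/-- The code `l` stands at position `b` of the program. -/
def CodeAt (prog : Program) (b : ℕ) (l : List Instr) : Prop :=
  ∀ i < l.length, prog[b + i]? = l[i]?

theorem CodeAt.left {prog : Program} {b : ℕ} {l₁ l₂ : List Instr} (h : CodeAt prog b (l₁ ++ l₂)) :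
    CodeAt prog b l₁ := fun i hi => by
  rw [h i (by rw [List.length_append]; omega), List.getElem?_append_left hi]

theorem CodeAt.right {prog : Program} {b : ℕ} {l₁ l₂ : List Instr}
    (h : CodeAt prog b (l₁ ++ l₂)) {n : ℕ} (hn : l₁.length = n) : CodeAt prog (b + n) l₂ :=
  fun i hi => by
    have := h (n + i) (by rw [List.length_append]; omega)
    rw [Nat.add_assoc, this, List.getElem?_append_right (by omega), hn, Nat.add_sub_cancel_left]

section run

variable {prog : Program} {x : List ℕ}

theorem step_of_codeAt {b : ℕ} {i : Instr} {l : List Instr} (h : CodeAt prog b (i :: l))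
    (R : ℕ → ℕ) : RAM.step prog x ⟨b, R⟩ = RAM.exec x ⟨b, R⟩ i := by
  have := h 0 (by simp)
  simp only [Nat.add_zero, List.getElem?_cons_zero] at this
  simp [RAM.step, this]

theorem run_straight {b : ℕ} {l : List Instr} (h : CodeAt prog b l) (hl : ∀ i ∈ l, IsStraight i)
    (R : ℕ → ℕ) : (RAM.step prog x)^[l.length] ⟨b, R⟩ = ⟨b + l.length, execAll x l R⟩ := by
  induction l generalizing b R with
  | nil => rfl
  | cons i l ih =>
    have h1 := step_of_codeAt (x := x) h R
    have h2 : RAM.exec x ⟨b, R⟩ i = ⟨b + 1, (RAM.exec x ⟨0, R⟩ i).reg⟩ := by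
      have := hl i (by simp)
      cases i <;> first | rfl | exact absurd this (by simp [IsStraight])
    have h3 := ih (b := b + 1) (CodeAt.right (l₁ := [i]) h rfl)
      (fun j hj => hl j (by simp [hj])) (RAM.exec x ⟨0, R⟩ i).reg
    rw [List.length_cons, Function.iterate_succ_apply, h1, h2, h3]
    simp only [execAll, List.foldl_cons, Config.mk.injEq, and_true]
    omega

theorem iterate_trans {f : Config → Config} {a b c : Config} {s t : ℕ} (h₁ : f^[s] a = b)
    (h₂ : f^[t] b = c) : f^[s + t] a = c := by
  rw [Nat.add_comm, Function.iterate_add_apply, h₁, h₂]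

theorem Expr.run_code {σ : Store} (e : Expr) {t b : ℕ} (h : CodeAt prog b (e.code t)) {R : ℕ → ℕ}
    (hR : Rep σ R) : ∃ R', (RAM.step prog x)^[e.size] ⟨b, R⟩ = ⟨b + e.size, R'⟩ ∧
      R' (tmp t) = e.eval x σ ∧ ∀ a, (∀ s ≥ t, a ≠ tmp s) → R' a = R a := by
  have := run_straight (x := x) h (e.code_straight t) R
  rw [e.length_code] at this
  exact ⟨_, this, e.execAll_code x t hR⟩

/-- The code of a statement is correct. -/
theorem Stmt.run_code (s : Stmt) {t b : ℕ} (h : CodeAt prog b (s.code t b)) {σ : Store}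
    {R : ℕ → ℕ} (hR : Rep σ R) :
    ∃ R', (RAM.step prog x)^[s.cost x σ] ⟨b, R⟩ = ⟨b + s.size, R'⟩ ∧
      Rep (s.eval x σ) R' ∧ ∀ u < t, R' (tmp u) = R (tmp u) := by
  induction s generalizing t b σ R with
  | skip => exact ⟨R, rfl, hR, fun _ _ => rfl⟩
  | set k e₁ e₂ =>
    rw [code] at h
    obtain ⟨R₁, r1, v1, f1⟩ := e₁.run_code (x := x) h.left hR
    have hR1 := hR.of_eq fun a ha => f1 a fun s _ => ha s
    have h2 := h.right (e₁.length_code t)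
    have r2 := run_straight (x := x) h2.left (addressCode_straight k t) R₁
    obtain ⟨v2, f2⟩ := execAll_addressCode x k t R₁
    have hR2 := hR1.of_eq fun a ha => f2 a fun s _ => ha s
    generalize execAll x (addressCode k t) R₁ = R₂ at *
    have h3 := h2.right (n := 8) rfl
    obtain ⟨R₃, r3, v3, f3⟩ := e₂.run_code (x := x) h3.left hR2
    have hR3 := hR2.of_eq fun a ha => f3 a fun s _ => ha s
    have h4 := h3.right (e₂.length_code (t + 1))
    have r4 := step_of_codeAt (x := x) h4 R₃
    have e4 : R₃ (tmp t) = k + 64 * e₁.eval x σ := by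
      rw [f3 _ fun s hs => by rw [Ne, tmp_inj]; omega, v2, v1]
    refine ⟨Function.update R₃ (k + 64 * e₁.eval x σ) (e₂.eval x σ), ?_, ?_, ?_⟩
    · have := iterate_trans (iterate_trans (iterate_trans r1 r2) r3) (t := 1) r4
      simp only [RAM.exec, e4, v3] at this
      simpa only [cost, size, Nat.add_assoc] using! this
    · exact hR3.set k _ _
    · intro u hu
      rw [Function.update_of_ne (ne_tmp k _ u).symm,
        f3 _ fun s hs => by rw [Ne, tmp_inj]; omega, f2 _ fun s hs => by rw [Ne, tmp_inj]; omega,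
        f1 _ fun s hs => by rw [Ne, tmp_inj]; omega]
  | seq s₁ s₂ ih₁ ih₂ =>
    rw [code] at h
    obtain ⟨R₁, r1, v1, f1⟩ := ih₁ h.left hR
    obtain ⟨R₂, r2, v2, f2⟩ := ih₂ (h.right (s₁.length_code t b)) v1
    refine ⟨R₂, ?_, v2, fun u hu => (f2 u hu).trans (f1 u hu)⟩
    rw [cost, size, ← Nat.add_assoc]
    exact iterate_trans r1 r2
  | ite e s₁ s₂ ih₁ ih₂ =>
    rw [code] at h
    obtain ⟨R₁, r1, v1, f1⟩ := e.run_code (x := x) h.left hR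
    have hR1 := hR.of_eq fun a ha => f1 a fun s _ => ha s
    have h2 := h.right (e.length_code t)
    have r2 := step_of_codeAt (x := x) h2 R₁
    have h3 := h2.right (n := 1) rfl
    have h4 := h3.right (s₁.length_code _ _)
    have h5 := h4.right (n := 1) rfl
    have f1' : ∀ u < t, R₁ (tmp u) = R (tmp u) := fun u hu =>
      f1 _ fun s hs => by rw [Ne, tmp_inj]; omega
    by_cases h0 : e.eval x σ = 0
    · simp only [RAM.exec, v1, h0, if_true] at r2
      obtain ⟨R₂, r3, v3, f3⟩ := ih₂ h5 hR1
      refine ⟨R₂, ?_, ?_, fun u hu => (f3 u hu).trans (f1' u hu)⟩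
      · have := iterate_trans (iterate_trans r1 (t := 1) r2) r3
        simp only [cost, h0, if_true, size]
        rw [this]
        simp only [Config.mk.injEq, and_true]
        omega
      · simpa [eval, h0] using v3
    · simp only [RAM.exec, v1, h0, if_false] at r2
      obtain ⟨R₂, r3, v3, f3⟩ := ih₁ h3.left hR1
      have r4 := step_of_codeAt (x := x) h4 R₂
      simp only [RAM.exec] at r4
      refine ⟨R₂, ?_, ?_, fun u hu => (f3 u hu).trans (f1' u hu)⟩
      · have := iterate_trans (iterate_trans (iterate_trans r1 (t := 1) r2) r3) (t := 1) r4
        simp only [cost, h0, if_false, size, ← Nat.add_assoc]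
        rw [this]
      · simpa [eval, h0] using v3
  | loop v e s ih =>
    rw [code] at h
    obtain ⟨R₁, r1, v1, f1⟩ := e.run_code (x := x) h.left hR
    have hR1 := hR.of_eq fun a ha => f1 a fun s _ => ha s
    have h2 := h.right (e.length_code t)
    have r2 := step_of_codeAt (x := x) h2 R₁
    have h3 := h2.right (n := 1) rfl
    have h4 := h3.right (n := 3) rfl
    have h5 := h4.right (s.length_code _ _)
    simp only [RAM.exec] at r2
    have n01 : tmp t ≠ tmp (t + 1) := by rw [Ne, tmp_inj]; omega
    have n02 : tmp t ≠ tmp (t + 2) := by rw [Ne, tmp_inj]; omega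
    have n12 : tmp (t + 1) ≠ tmp (t + 2) := by rw [Ne, tmp_inj]; omega
    have hv : ∀ u, tmp u ≠ (v : ℕ) := fun u => by have := ne_tmp v 0 u; simpa using this.symm
    have test : ∀ R' : ℕ → ℕ, (RAM.step prog x)^[2] ⟨b + e.size + 1, R'⟩ =
        ⟨if R' (tmp t) - R' (tmp (t + 1)) = 0 then b + e.size + 1 + 3 + s.size + 3
          else b + e.size + 1 + 1 + 1,
          Function.update R' (tmp (t + 2)) (R' (tmp t) - R' (tmp (t + 1)))⟩ := by
      intro R'
      have a1 := step_of_codeAt (x := x) h3 R'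
      have a2 := step_of_codeAt (x := x) (CodeAt.right (l₁ := [_]) h3 rfl)
        (Function.update R' (tmp (t + 2)) (R' (tmp t) - R' (tmp (t + 1))))
      simp only [RAM.exec] at a1 a2
      rw [Function.update_self] at a2
      exact iterate_trans (s := 1) (t := 1) a1 a2
    set F : ℕ → Store → Store := fun j τ => s.eval x (τ.set v 0 j) with hF
    -- The state on arrival at the head of the loop after `j` rounds.
    have key : ∀ j ≤ e.eval x σ, ∃ R', (RAM.step prog x)^[e.size + 1 +
          ∑ j ∈ Finset.range j, (6 + s.cost x ((forLoop F j σ).set v 0 j))] ⟨b, R⟩ =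
          ⟨b + e.size + 1, R'⟩ ∧ Rep (forLoop F j σ) R' ∧ R' (tmp t) = e.eval x σ ∧
          R' (tmp (t + 1)) = j ∧ ∀ u < t, R' (tmp u) = R (tmp u) := by
      intro j hj
      induction j with
      | zero =>
        refine ⟨_, iterate_trans r1 (t := 1) r2, hR1.of_eq fun a ha => ?_, ?_, ?_, fun u hu => ?_⟩
        · exact Function.update_of_ne (ha _) _ _
        · rw [Function.update_of_ne n01, v1]
        · simp
        · rw [Function.update_of_ne (by rw [Ne, tmp_inj]; omega),
            f1 _ fun s hs => by rw [Ne, tmp_inj]; omega]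
      | succ j ihj =>
        obtain ⟨R', q1, q2, q3, q4, q5⟩ := ihj (by omega)
        have a1 := test R'
        rw [q3, q4, if_neg (by omega)] at a1
        set R'' := Function.update R' (tmp (t + 2)) (e.eval x σ - j) with hR''
        have a2 := step_of_codeAt (x := x) (CodeAt.right (l₁ := [_, _]) (n := 2) h3 rfl) R''
        have e2 : R'' (tmp (t + 1)) = j := by rw [hR'', Function.update_of_ne n12, q4]
        simp only [RAM.exec, e2] at a2
        have p2 : Rep ((forLoop F j σ).set v 0 j) (Function.update R'' v j) := by
          have := (q2.of_eq (R' := R'') fun a ha => Function.update_of_ne (ha _) _ _).set v 0 j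
          simpa using this
        obtain ⟨R₃, a3, p3, f3⟩ := ih h4.left p2
        have f3' : ∀ u < t + 2, R₃ (tmp u) = R' (tmp u) := fun u hu => by
          rw [f3 u hu, Function.update_of_ne (hv u), hR'',
            Function.update_of_ne (by rw [Ne, tmp_inj]; omega)]
        have a4 := run_straight (x := x) (CodeAt.left (l₁ := [_, _]) (l₂ := [_]) h5)
          (by simp [IsStraight]) R₃
        have e4 : execAll x [.const (tmp (t + 2)) 1,
            .add (tmp (t + 1)) (tmp (t + 1)) (tmp (t + 2))] R₃ =
            Function.update (Function.update R₃ (tmp (t + 2)) 1) (tmp (t + 1)) (j + 1) := by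
          simp [execAll, RAM.exec, n12, f3' (t + 1) (by omega), q4]
        rw [e4] at a4
        set R₄ := Function.update (Function.update R₃ (tmp (t + 2)) 1) (tmp (t + 1)) (j + 1) with hR4
        have a5 := step_of_codeAt (x := x) (CodeAt.right (l₁ := [_, _]) (n := 2) h5 rfl) R₄
        simp only [RAM.exec] at a5
        refine ⟨R₄, ?_, ?_, ?_, ?_, ?_⟩
        · have := iterate_trans (iterate_trans (iterate_trans (iterate_trans (iterate_trans q1 a1)
            (t := 1) a2) a3) a4) (t := 1) a5
          rw [Finset.sum_range_succ, ← this]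
          congr 1
          simp only [List.length_cons, List.length_nil]
          omega
        · exact p3.of_eq fun a ha => by
            rw [hR4, Function.update_of_ne (ha _), Function.update_of_ne (ha _)]
        · rw [hR4, Function.update_of_ne n01, Function.update_of_ne n02, f3' t (by omega), q3]
        · rw [hR4, Function.update_self]
        · intro u hu
          rw [hR4, Function.update_of_ne (by rw [Ne, tmp_inj]; omega),
            Function.update_of_ne (by rw [Ne, tmp_inj]; omega), f3' u (by omega), q5 u hu]
    obtain ⟨R', q1, q2, q3, q4, q5⟩ := key _ le_rfl
    have a1 := test R'
    rw [q3, q4, if_pos (by omega)] at a1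
    refine ⟨Function.update R' (tmp (t + 2)) (e.eval x σ - e.eval x σ), ?_,
      q2.of_eq fun a ha => Function.update_of_ne (ha (t + 2)) _ _, fun u hu => ?_⟩
    · rw [cost]
      have := iterate_trans q1 a1
      rw [this]
      simp only [size, Config.mk.injEq]
      exact ⟨by omega, trivial⟩
    · rw [Function.update_of_ne (by rw [Ne, tmp_inj]; omega), q5 u hu]

end run

/-- All loops are over `0, …, n - 1`, where `n` is a variable that is not changed. -/
def Stmt.capped (n : Fin 63) : Stmt → Bool
  | skip => true
  | set k _ _ => k ≠ n
  | seq s₁ s₂ => s₁.capped n && s₂.capped n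
  | ite _ s₁ s₂ => s₁.capped n && s₂.capped n
  | loop v (.get k (.lit 0)) s => v ≠ n && k = n && s.capped n
  | loop _ _ _ => false

/-- A bound for the running time of a statement with capped loops. -/
noncomputable def Stmt.bound : Stmt → Polynomial ℕ
  | skip => 0
  | set k e₁ e₂ => Polynomial.C (set k e₁ e₂).size
  | seq s₁ s₂ => s₁.bound + s₂.bound
  | ite e s₁ s₂ => Polynomial.C (e.size + 2) + s₁.bound + s₂.bound
  | loop _ e s => Polynomial.C (e.size + 3) + Polynomial.X * (Polynomial.C 6 + s.bound)

theorem Stmt.eval_of_capped (x : List ℕ) {n : Fin 63} {s : Stmt} (h : s.capped n) (σ : Store) :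
    s.eval x σ n = σ n := by
  refine eval_of_notMem_writes x ?_ σ
  induction s with
  | skip => simp [writes]
  | set k e₁ e₂ =>
    simp only [capped, decide_eq_true_eq] at h
    simpa [writes] using h.symm
  | seq s₁ s₂ ih₁ ih₂ =>
    simp only [capped, Bool.and_eq_true] at h
    simp [writes, ih₁ h.1, ih₂ h.2]
  | ite e s₁ s₂ ih₁ ih₂ =>
    simp only [capped, Bool.and_eq_true] at h
    simp [writes, ih₁ h.1, ih₂ h.2]
  | loop v e s ih =>
    unfold capped at h
    split at h <;> simp_all [writes]
    exact fun e => h.1.1 e.symm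

/-- The loop bound never changes, so every loop has `σ n 0` rounds, and nesting loops multiplies
bounds that are polynomial in this number. -/
theorem Stmt.cost_le (x : List ℕ) {n : Fin 63} {s : Stmt} (h : s.capped n) (σ : Store) :
    s.cost x σ ≤ s.bound.eval (σ n 0) := by
  induction s generalizing σ with
  | skip => simp [cost]
  | set k e₁ e₂ => simp [cost, bound]
  | seq s₁ s₂ ih₁ ih₂ =>
    simp only [capped, Bool.and_eq_true] at h
    have h1 := ih₁ h.1 σ
    have h2 := ih₂ h.2 (s₁.eval x σ)
    rw [eval_of_capped x h.1] at h2
    simp only [cost, bound, Polynomial.eval_add]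
    omega
  | ite e s₁ s₂ ih₁ ih₂ =>
    simp only [capped, Bool.and_eq_true] at h
    have h1 := ih₁ h.1 σ
    have h2 := ih₂ h.2 σ
    simp only [cost, bound, Polynomial.eval_add, Polynomial.eval_C]
    split_ifs <;> omega
  | loop v e s ih =>
    have h' : v ≠ n ∧ e = .get n (.lit 0) ∧ s.capped n := by
      unfold capped at h
      split at h <;> simp_all
    obtain ⟨hv, rfl, hs⟩ := h'
    have e1 : Expr.eval x σ (.get n (.lit 0)) = σ n 0 := rfl
    simp only [cost, bound, Polynomial.eval_add, Polynomial.eval_C, Polynomial.eval_mul,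
      Polynomial.eval_X]
    have hσ : ∀ j, forLoop (fun j τ => s.eval x (τ.set v 0 j)) j σ n = σ n := fun j =>
      forLoop_induction (fun _ (τ : Store) => τ n = σ n) rfl fun i _ τ hτ => by
        rw [eval_of_capped x hs, Store.set_of_ne _ _ _ hv.symm, hτ]
    have := Finset.sum_le_card_nsmul (Finset.range (Expr.eval x σ (.get n (.lit 0))))
      (fun j => 6 + s.cost x ((forLoop (fun j τ => s.eval x (τ.set v 0 j)) j σ).set v 0 j))
      (6 + s.bound.eval (σ n 0)) fun j _ => by
        have := ih hs ((forLoop (fun j τ => s.eval x (τ.set v 0 j)) j σ).set v 0 j)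
        rw [Store.set_of_ne _ _ _ hv.symm, hσ] at this
        omega
    rw [Finset.card_range, smul_eq_mul, e1] at this
    rw [e1]
    omega

end Imp

/-! ### The program -/

namespace Imp

-- A variable is the entry 0 of its array. `aLab` is 0 for unreached, 1 for inner and 2 for outer
-- vertices. Row `z` of `aMat` is the matching that misses `z`, `aCur` is a working copy, and
-- `aMate` is the best matching so far. `aAct` marks the vertices added to the graph of the matching
-- problem, `aRem` those deleted in the play. `aH` holds the values of the options, `aFlag` marks
-- the values that occur.
notation "aOut" => (0 : Fin 63)
notation "aOutComp" => (1 : Fin 63)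
notation "aOutVert" => (2 : Fin 63)
notation "aNum" => (3 : Fin 63)
notation "aOff" => (4 : Fin 63)
notation "aStart" => (5 : Fin 63)
notation "aRow" => (6 : Fin 63)
notation "aAct" => (7 : Fin 63)
notation "aMate" => (8 : Fin 63)
notation "aLab" => (9 : Fin 63)
notation "aMat" => (10 : Fin 63)
notation "aCur" => (11 : Fin 63)
notation "aFound" => (12 : Fin 63)
notation "aRd" => (13 : Fin 63)
notation "aX" => (14 : Fin 63)
notation "aY" => (15 : Fin 63)
notation "aU" => (16 : Fin 63)
notation "aW" => (17 : Fin 63)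
notation "aT" => (18 : Fin 63)
notation "aI" => (19 : Fin 63)
notation "aJ" => (20 : Fin 63)
notation "aRoot" => (21 : Fin 63)
notation "aV" => (22 : Fin 63)
notation "aRem" => (23 : Fin 63)
notation "aTst" => (24 : Fin 63)
notation "aTok" => (25 : Fin 63)
notation "aNxt" => (26 : Fin 63)
notation "aC" => (27 : Fin 63)
notation "aQ" => (28 : Fin 63)
notation "aVal" => (29 : Fin 63)
notation "aOpt" => (30 : Fin 63)
notation "aH" => (31 : Fin 63)
notation "aFlag" => (32 : Fin 63)
notation "aSq" => (33 : Fin 63)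
notation "aGrd" => (34 : Fin 63)
notation "aNim" => (35 : Fin 63)
notation "aComp" => (36 : Fin 63)
notation "aWant" => (37 : Fin 63)

infixr:60 " ;; " => Stmt.seq

/-- The value of a variable, which is the entry with the index `0` of an array. -/
abbrev Expr.var (k : Fin 63) : Expr := .get k (.lit 0)

/-- Assignment to a variable. -/
abbrev Stmt.assign (k : Fin 63) (e : Expr) : Stmt := .set k (.lit 0) e

/-- Zero if and only if the two expressions have the same value. -/
abbrev Expr.dist (e₁ e₂ : Expr) : Expr := .add (.sub e₁ e₂) (.sub e₂ e₁)

/-- A loop over the vertices of the current graph. -/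
abbrev Stmt.each (v : Fin 63) (s : Stmt) : Stmt := .loop v (.var aNum) s

/-- The entry of the adjacency matrix of the current graph. -/
def adjEntry (u v : Fin 63) : Expr :=
  .inp (.add (.add (.add (.var aOff) (.lit 2)) (.get aRow (.var u))) (.var v))

/-- The address of an entry of the table of matchings. -/
def matIndex (z v : Fin 63) : Expr := .add (.get aRow (.var z)) (.var v)

def loadRow (z : Fin 63) : Stmt :=
  .each aI (.set aCur (.var aI) (.get aMat (matIndex z aI)))

def saveRow (z : Fin 63) : Stmt :=
  .each aI (.set aMat (matIndex z aI) (.get aCur (.var aI)))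

/-- One rotation of the current matching. -/
def rotCode : Stmt :=
  .assign aT (.get aCur (.var aW)) ;; .set aCur (.var aU) (.var aW) ;;
  .set aCur (.var aW) (.var aU) ;; .set aCur (.var aT) (.var aT)

/-- `rotCode` leaves in `aT` the former partner of `aW`, which is the new outer vertex. -/
def growCode : Stmt :=
  .assign aU (.var aX) ;; .assign aW (.var aY) ;; loadRow aX ;; rotCode ;;
  .set aLab (.var aY) (.lit 1) ;; .set aLab (.var aT) (.lit 2) ;; saveRow aT

/-- A vertex that is outer already keeps its matching; in particular the row of `aY`, which guides
the walk, stays the same. -/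
def walkStep : Stmt :=
  rotCode ;; .assign aU (.var aT) ;;
  .ite (.dist (.get aLab (.var aU)) (.lit 2))
    (.set aLab (.var aU) (.lit 2) ;; saveRow aU) .skip ;;
  .assign aW (.get aMat (matIndex aY aU))

/-- The number of rounds is fixed, because a walk that has come to `aY` stands still. -/
def blossomCode : Stmt :=
  .assign aU (.var aX) ;; .assign aW (.var aY) ;; loadRow aX ;; .each aJ walkStep

/-- Only the first augmentation takes effect. The search then runs on without touching `aMate`, so
no loop has to be left early. -/
def augmentCode : Stmt :=
  .ite (.var aFound) .skip
    (loadRow aX ;; .set aCur (.var aX) (.var aY) ;; .set aCur (.var aY) (.var aX) ;;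
      .each aI (.set aMate (.var aI) (.get aCur (.var aI))) ;; .assign aFound (.lit 1))

/-- The inspection of the edge from the outer vertex `X` to the vertex `Y`. -/
def visitCode : Stmt :=
  -- The last branch is taken if the matching that misses `aX` misses `aY` too.
  .ite (.dist (.get aMat (matIndex aX aY)) (.var aY))
    (.ite (.get aLab (.var aY))
      (.ite (.dist (.get aLab (.var aY)) (.lit 2)) .skip blossomCode) growCode)
    augmentCode

def edgeCode : Stmt :=
  .ite (.dist (.get aLab (.var aX)) (.lit 2)) .skip
    (.ite (.get aAct (.var aY)) (.ite (adjEntry aX aY) visitCode .skip) .skip)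

def roundCode : Stmt := .each aX (.each aY edgeCode)

/-- The search for an augmenting path from `Root`. -/
def searchCode : Stmt :=
  .assign aFound (.lit 0) ;; .each aI (.set aLab (.var aI) (.lit 0)) ;;
  .set aLab (.var aRoot) (.lit 2) ;;
  -- A round that changes the forest adds an outer vertex, so as many rounds as there are vertices
  -- suffice.
  .each aI (.set aMat (matIndex aRoot aI) (.get aMate (.var aI))) ;; .each aRd roundCode

/-- `aTst` is kept back as the last vertex, so that the success of its own search answers the test.
-/
def addVertex : Stmt :=
  .ite (.get aRem (.var aV)) .skip
    (.ite (.dist (.var aV) (.var aTst))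
      (.set aAct (.var aV) (.lit 1) ;; .assign aRoot (.var aV) ;; searchCode) .skip)

/-- The test whether the position with the token on `Tst` and without the vertices in `Rem` is
winning. -/
def testCode : Stmt :=
  .each aI (.set aAct (.var aI) (.lit 0) ;; .set aMate (.var aI) (.var aI)) ;;
  .each aV addVertex ;;
  .set aAct (.var aTst) (.lit 1) ;; .assign aRoot (.var aTst) ;; searchCode

def probeCode : Stmt :=
  .ite (adjEntry aTok aQ)
    (.ite (.get aRem (.var aQ)) .skip
      (.assign aTst (.var aQ) ;; testCode ;;
        .ite (.var aFound) (.assign aNxt (.var aQ)) .skip)) .skip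

/-- The token goes to an option of nonzero value, which exchanges the values 1 and 2. The number
`aNum`, which is not a vertex, stands for the absence of such an option; further rounds are then
idle. -/
def chainStep : Stmt :=
  .set aRem (.var aTok) (.lit 1) ;; .assign aNxt (.var aNum) ;; .each aQ probeCode ;;
  .ite (.dist (.var aNxt) (.var aNum))
    (.assign aVal (.sub (.lit 3) (.var aVal)) ;; .assign aTok (.var aNxt)) .skip

/-- The Grundy value of the position after the token has been moved to `Opt`. -/
def optionCode : Stmt :=
  .each aI (.set aRem (.var aI) (.lit 0)) ;; .set aRem (.var aStart) (.lit 1) ;;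
  .assign aTst (.var aOpt) ;; testCode ;;
  .ite (.var aFound)
    -- The play ends at value 1, so this is the answer if no move of the chain follows.
    (.assign aVal (.lit 1) ;; .assign aTok (.var aOpt) ;; .each aC chainStep)
    (.assign aVal (.lit 0))

def optionStep : Stmt :=
  .ite (adjEntry aStart aOpt)
    (optionCode ;; .set aH (.var aOpt) (.var aVal) ;; .set aFlag (.var aVal) (.lit 1)) .skip

/-- Without multiplication, the multiples of the number of vertices are tabulated by repeated
addition; `aSq` ends up as the size of the adjacency matrix. -/
def rowsCode : Stmt :=
  .assign aSq (.lit 0) ;;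
  .each aI (.set aRow (.var aI) (.var aSq) ;; .assign aSq (.add (.var aSq) (.var aNum)))

/-- The Grundy value of the current component. -/
def componentCode : Stmt :=
  .assign aStart (.inp (.add (.var aOff) (.lit 1))) ;; rowsCode ;;
  .set aFlag (.lit 0) (.lit 0) ;; .set aFlag (.lit 1) (.lit 0) ;; .set aFlag (.lit 2) (.lit 0) ;;
  .each aOpt optionStep ;;
  -- This is the mex of the values of the options.
  .ite (.get aFlag (.lit 0))
    (.ite (.get aFlag (.lit 1))
      (.ite (.get aFlag (.lit 2)) (.assign aGrd (.lit 3)) (.assign aGrd (.lit 2)))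
      (.assign aGrd (.lit 1)))
    (.assign aGrd (.lit 0))

/-- The nim sum of `Nim` and `Grd`, which are at most three. -/
def xorCode (d : Fin 63) : Stmt :=
  .ite (.var aNim)
    (.ite (.var aGrd)
      (.ite (.dist (.var aNim) (.var aGrd))
        -- The nim sum of two different numbers among 1, 2, 3 is the third, and all three add up to
        -- 6.
        (.assign d (.sub (.sub (.lit 6) (.var aNim)) (.var aGrd))) (.assign d (.lit 0)))
      (.assign d (.var aNim)))
    (.assign d (.var aGrd))

def nextComponent : Stmt :=
  .assign aOff (.add (.add (.var aOff) (.lit 2)) (.var aSq))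

def firstBody : Stmt := componentCode ;; xorCode aNim ;; nextComponent

def answerStep : Stmt :=
  .ite (adjEntry aStart aOpt)
    (.ite (.dist (.get aH (.var aOpt)) (.var aWant)) .skip
      (.assign aOut (.lit 1) ;; .assign aOutComp (.var aComp) ;; .assign aOutVert (.var aOpt)))
    .skip

/-- The components are evaluated again instead of being stored. `aWant` is the value that an option
must have to make the nim sum zero. -/
def secondBody : Stmt :=
  componentCode ;; xorCode aWant ;; .each aOpt answerStep ;; nextComponent

/-- A pass over all components. -/
def passCode (body : Stmt) : Stmt :=
  .assign aOff (.lit 1) ;;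
  .loop aComp (.inp (.lit 0)) (.assign aNum (.inp (.var aOff)) ;; body)

def mainCode : Stmt := passCode firstBody ;; passCode secondBody

/-- Only the bodies are capped: the loop over the components changes `aNum` and is accounted for
separately. -/
theorem capped_firstBody : firstBody.capped aNum := by decide

theorem capped_secondBody : secondBody.capped aNum := by decide

/-! ### Correctness of the search -/

/-- The store describes the current graph. -/
structure Ctx (x : List ℕ) (adj : ℕ → ℕ → Prop) (n : ℕ) (σ : Store) : Prop where
  num : σ aNum 0 = n
  row : ∀ u < n, σ aRow u = u * n
  entry : ∀ u < n, ∀ v < n, x.getD (σ aOff 0 + 2 + u * n + v) 0 ≠ 0 ↔ adj u v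

/-- The permutation of the vertices that is given by the first entries of an array. -/
def ext (n : ℕ) (f : ℕ → ℕ) (v : ℕ) : ℕ := if v < n then f v else v

/-- The matching that is stored for the vertex `z`. -/
def rowOf (n : ℕ) (σ : Store) (z : ℕ) : ℕ → ℕ := ext n fun v => σ aMat (z * n + v)

section basic

variable {x : List ℕ} {adj : ℕ → ℕ → Prop} {n : ℕ} {σ τ : Store}

theorem Ctx.of_eq (h : Ctx x adj n σ) (h1 : τ aNum = σ aNum) (h2 : τ aRow = σ aRow)
    (h3 : τ aOff = σ aOff) : Ctx x adj n τ :=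
  ⟨h1 ▸ h.num, h2 ▸ h.row, h3 ▸ h.entry⟩

/-- Statements that do not change the description of the graph. -/
theorem Ctx.eval {s : Stmt} (h : Ctx x adj n σ) (h1 : aNum ∉ s.writes := by decide)
    (h2 : aRow ∉ s.writes := by decide) (h3 : aOff ∉ s.writes := by decide) :
    Ctx x adj n (s.eval x σ) :=
  h.of_eq (s.eval_of_notMem_writes x h1 σ) (s.eval_of_notMem_writes x h2 σ)
    (s.eval_of_notMem_writes x h3 σ)

theorem eval_dist (e₁ e₂ : Expr) :
    (Expr.dist e₁ e₂).eval x σ = 0 ↔ e₁.eval x σ = e₂.eval x σ := by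
  simp only [Expr.eval]
  omega

theorem Stmt.eval_seq (s₁ s₂ : Stmt) (σ : Store) :
    (s₁ ;; s₂).eval x σ = s₂.eval x (s₁.eval x σ) :=
  rfl

theorem Stmt.eval_ite_zero {e : Expr} {s₁ s₂ : Stmt} (h : e.eval x σ = 0) :
    (Stmt.ite e s₁ s₂).eval x σ = s₂.eval x σ :=
  if_pos h

theorem Stmt.eval_ite_ne {e : Expr} {s₁ s₂ : Stmt} (h : e.eval x σ ≠ 0) :
    (Stmt.ite e s₁ s₂).eval x σ = s₁.eval x σ :=
  if_neg h

theorem eval_each (v : Fin 63) (s : Stmt) (h : Ctx x adj n σ) :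
    (Stmt.each v s).eval x σ = forLoop (fun j τ => s.eval x (τ.set v 0 j)) n σ := by
  simp only [Stmt.eval, Expr.eval, h.num]

theorem eval_adjEntry (h : Ctx x adj n σ) {u v : Fin 63} (hu : σ u 0 < n) (hv : σ v 0 < n) :
    (adjEntry u v).eval x σ = 0 ↔ ¬ adj (σ u 0) (σ v 0) := by
  have := h.entry _ hu _ hv
  rw [← this, not_not]
  simp only [adjEntry, Expr.eval, h.row _ hu]

theorem ext_lt {f : ℕ → ℕ} {v : ℕ} (hv : v < n) : ext n f v = f v := if_pos hv

theorem ext_congr {f g : ℕ → ℕ} (h : ∀ v < n, f v = g v) : ext n f = ext n g := by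
  funext v
  unfold ext
  split_ifs with hv
  exacts [h v hv, rfl]

theorem ext_rot {m : ℕ → ℕ} {u w : ℕ} (hu : u < n) (hw : w < n) (hm : m w < n) :
    ext n (rot m u w) = rot (ext n m) u w := by
  funext v
  rw [rot_apply, ext_lt hw]
  unfold ext
  split_ifs with h1 h2 h3 h4 h5 h6 h7 <;> simp_all [rot_apply]

theorem index_eq_iff {z v z' v' : ℕ} (hv : v < n) (hv' : v' < n) :
    z * n + v = z' * n + v' ↔ z = z' ∧ v = v' := by
  constructor
  · intro h
    have hn : 0 < n := by omega
    have h1 : (z * n + v) / n = z := by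
      rw [Nat.mul_comm, Nat.mul_add_div hn, Nat.div_eq_of_lt hv, Nat.add_zero]
    have h2 : (z' * n + v') / n = z' := by
      rw [Nat.mul_comm, Nat.mul_add_div hn, Nat.div_eq_of_lt hv', Nat.add_zero]
    have h3 : z = z' := by rw [← h1, h, h2]
    subst h3
    exact ⟨rfl, by omega⟩
  · rintro ⟨rfl, rfl⟩
    rfl

theorem ext_loadRow (h : Ctx x adj n σ) {k : Fin 63} (hk : k ≠ aI) (hk' : k ≠ aCur)
    (hz : σ k 0 < n) : ext n ((loadRow k).eval x σ aCur) = rowOf n σ (σ k 0) := by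
  have : ∀ v < n, (loadRow k).eval x σ aCur v = σ aMat (σ k 0 * n + v) := by
    rw [loadRow, eval_each _ _ h]
    have := forLoop_induction (f := fun j (τ : Store) => (Stmt.set aCur (.var aI)
        (.get aMat (matIndex k aI))).eval x (τ.set aI 0 j)) (n := n) (a := σ)
      (fun j τ => (∀ v < j, τ aCur v = σ aMat (σ k 0 * n + v)) ∧ τ aMat = σ aMat ∧
        τ aRow = σ aRow ∧ τ k = σ k) ⟨by simp, rfl, rfl, rfl⟩ ?_
    · exact this.1
    · rintro j hj τ ⟨h1, h2, h3, h4⟩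
      refine ⟨fun v hv => ?_, ?_, ?_, ?_⟩
      · have e2 := h.row _ hz
        rcases Nat.lt_succ_iff_lt_or_eq.1 hv with hv | rfl
        · have := h1 v hv
          simp [Stmt.eval, Expr.eval, Store.set_apply, this]
          omega
        · simp [Stmt.eval, Expr.eval, Store.set_apply, matIndex, hk, h2, h3, h4, e2]
      · rw [Stmt.eval, Store.set_of_ne _ _ _ (by decide), Store.set_of_ne _ _ _ (by decide), h2]
      · rw [Stmt.eval, Store.set_of_ne _ _ _ (by decide), Store.set_of_ne _ _ _ (by decide), h3]
      · rw [Stmt.eval, Store.set_of_ne _ _ _ hk', Store.set_of_ne _ _ _ hk, h4]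
  exact ext_congr this

/-- Copying an array to a row of the table of matchings. -/
theorem rowOf_copy (h : Ctx x adj n σ) {k a : Fin 63} (hk : k ≠ aI) (hk' : k ≠ aMat)
    (ha : a ≠ aI) (ha' : a ≠ aMat) (hz : σ k 0 < n) {z : ℕ} :
    rowOf n ((Stmt.each aI (.set aMat (matIndex k aI) (.get a (.var aI)))).eval x σ) z =
      if z = σ k 0 then ext n (σ a) else rowOf n σ z := by
  have : ∀ v < n, (Stmt.each aI (.set aMat (matIndex k aI) (.get a (.var aI)))).eval x σ
      aMat (z * n + v) = if z = σ k 0 then σ a v else σ aMat (z * n + v) := by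
    rw [eval_each _ _ h]
    have := forLoop_induction (f := fun j (τ : Store) => (Stmt.set aMat (matIndex k aI)
        (.get a (.var aI))).eval x (τ.set aI 0 j)) (n := n) (a := σ)
      (fun j τ => (∀ v < n, τ aMat (z * n + v) =
          if z = σ k 0 ∧ v < j then σ a v else σ aMat (z * n + v)) ∧
        τ a = σ a ∧ τ aRow = σ aRow ∧ τ k = σ k) ⟨by simp, rfl, rfl, rfl⟩ ?_
    · intro v hv
      rw [this.1 v hv]
      simp [hv]
    · rintro j hj τ ⟨h1, h2, h3, h4⟩
      refine ⟨fun v hv => ?_, ?_, ?_, ?_⟩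
      · have e1 := h1 v hv
        have e2 := h.row _ hz
        have e3 := index_eq_iff (z := z) (z' := σ k 0) hv hj
        simp [Stmt.eval, Expr.eval, Store.set_apply, matIndex, hk, ha, h2, h3, h4, e1, e2, e3]
        by_cases hzk : z = σ k 0
        · by_cases hvj : v = j
          · simp [hzk, hvj]
          · have : v < j ↔ v < j + 1 := by omega
            simp [hzk, hvj, this]
        · simp [hzk]
      · rw [Stmt.eval, Store.set_of_ne _ _ _ ha', Store.set_of_ne _ _ _ ha, h2]
      · rw [Stmt.eval, Store.set_of_ne _ _ _ (by decide), Store.set_of_ne _ _ _ (by decide), h3]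
      · rw [Stmt.eval, Store.set_of_ne _ _ _ hk', Store.set_of_ne _ _ _ hk, h4]
  unfold rowOf
  split_ifs with hzk
  · exact ext_congr fun v hv => (this v hv).trans (if_pos hzk)
  · exact ext_congr fun v hv => (this v hv).trans (if_neg hzk)

theorem rowOf_saveRow (h : Ctx x adj n σ) {k : Fin 63} (hk : k ≠ aI) (hk' : k ≠ aMat)
    (hz : σ k 0 < n) {z : ℕ} : rowOf n ((saveRow k).eval x σ) z =
      if z = σ k 0 then ext n (σ aCur) else rowOf n σ z :=
  rowOf_copy h hk hk' (by decide) (by decide) hz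

end basic

end Imp

/-! ### The effect of rotations, walks, growth and augmentation on the store. -/

namespace Imp

section search

variable {x : List ℕ} {adj : ℕ → ℕ → Prop} {n : ℕ} {σ τ : Store}

theorem eval_rotCode (σ : Store) :
    rotCode.eval x σ aCur = rot (σ aCur) (σ aU 0) (σ aW 0) ∧
      rotCode.eval x σ aT 0 = σ aCur (σ aW 0) := by
  constructor
  · funext v
    rw [rot_apply]
    simp [rotCode, Stmt.eval, Expr.eval, Store.set_apply]
  · simp [rotCode, Stmt.eval, Expr.eval, Store.set_apply]

theorem rowOf_congr (h : τ aMat = σ aMat) (z : ℕ) : rowOf n τ z = rowOf n σ z := by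
  rw [rowOf, rowOf, h]

/-- One step of a walk. -/
theorem eval_walkStep (h : Ctx x adj n σ) (hu : σ aU 0 < n) (hw : σ aW 0 < n)
    (ht : ext n (σ aCur) (σ aW 0) < n) (hy : σ aY 0 < n) (hy2 : σ aLab (σ aY 0) = 2) {t : ℕ}
    (ht' : ext n (σ aCur) (σ aW 0) = t) :
    ext n (walkStep.eval x σ aCur) = rot (ext n (σ aCur)) (σ aU 0) (σ aW 0) ∧
    walkStep.eval x σ aU 0 = t ∧
    walkStep.eval x σ aW 0 = rowOf n σ (σ aY 0) t ∧
    (∀ v, walkStep.eval x σ aLab v = if v = t then 2 else σ aLab v) ∧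
    ∀ z, rowOf n (walkStep.eval x σ) z = if z = t ∧ σ aLab t ≠ 2 then
      rot (ext n (σ aCur)) (σ aU 0) (σ aW 0) else rowOf n σ z := by
  obtain ⟨r1, r2⟩ := eval_rotCode (x := x) σ
  have er : ext n (rotCode.eval x σ aCur) = rot (ext n (σ aCur)) (σ aU 0) (σ aW 0) := by
    rw [r1, ext_rot hu hw]
    rwa [ext_lt hw] at ht
  have e2 : rotCode.eval x σ aT 0 = t := by rw [r2, ← ht', ext_lt hw]
  have htn : t < n := ht' ▸ ht
  have c1 : Ctx x adj n (rotCode.eval x σ) := h.eval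
  have f1 : ∀ k, k ∉ rotCode.writes → rotCode.eval x σ k = σ k := fun k hk =>
    Stmt.eval_of_notMem_writes x hk σ
  have g1 := f1 aLab (by decide)
  have g2 := f1 aMat (by decide)
  have g3 := f1 aY (by decide)
  rw [walkStep, Stmt.eval_seq]
  generalize rotCode.eval x σ = σ₁ at *
  have hW : ∀ (σ' : Store), Ctx x adj n σ' → σ' aU 0 = t → σ' aY 0 = σ aY 0 →
      (Stmt.assign aW (.get aMat (matIndex aY aU))).eval x σ' =
        σ'.set aW 0 (rowOf n σ' (σ aY 0) t) := by
    intro σ' c' h1 h2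
    have := c'.row _ hy
    simp [Stmt.eval, Expr.eval, matIndex, h1, h2, this, rowOf, ext_lt htn]
  have e3 : ∀ s : Stmt, (Stmt.assign aU (.var aT) ;; s).eval x σ₁ = s.eval x (σ₁.set aU 0 t) := by
    intro s
    simp [Stmt.eval, Expr.eval, e2]
  rw [e3, Stmt.eval_seq]
  have c2 : Ctx x adj n (σ₁.set aU 0 t) := c1.of_eq (by simp [Store.set_of_ne])
    (by simp [Store.set_of_ne]) (by simp [Store.set_of_ne])
  by_cases hl : σ aLab t = 2
  · have hd : Expr.eval x (σ₁.set aU 0 t) (.dist (.get aLab (.var aU)) (.lit 2)) = 0 := by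
      rw [eval_dist]
      simp [Expr.eval, Store.set_apply, g1, hl]
    rw [Stmt.eval_ite_zero hd]
    have := hW (σ₁.set aU 0 t) c2 (by simp [Store.set_apply]) (by simp [Store.set_apply, g3])
    rw [Stmt.eval, this]
    refine ⟨?_, ?_, ?_, fun v => ?_, fun z => ?_⟩
    · simpa [Store.set_of_ne] using er
    · simp [Store.set_apply]
    · simp only [Store.set_apply, and_self, if_true]
      rw [rowOf_congr]
      simpa [Store.set_of_ne] using g2
    · simp only [Store.set_of_ne, ne_eq, Fin.reduceEq, not_false_eq_true, g1]
      split_ifs with hv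
      · rw [hv, hl]
      · rfl
    · rw [if_neg (by simp [hl]), rowOf_congr]
      simpa [Store.set_of_ne] using g2
  · have hd : Expr.eval x (σ₁.set aU 0 t) (.dist (.get aLab (.var aU)) (.lit 2)) ≠ 0 := by
      rw [Ne, eval_dist]
      simp [Expr.eval, Store.set_apply, g1, hl]
    rw [Stmt.eval_ite_ne hd, Stmt.eval_seq]
    have e4 : (Stmt.set aLab (.var aU) (.lit 2)).eval x (σ₁.set aU 0 t) =
        (σ₁.set aU 0 t).set aLab t 2 := by
      simp [Stmt.eval, Expr.eval, Store.set_apply]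
    rw [e4]
    have c3 : Ctx x adj n ((σ₁.set aU 0 t).set aLab t 2) := c2.of_eq (by simp [Store.set_of_ne])
      (by simp [Store.set_of_ne]) (by simp [Store.set_of_ne])
    have eU : (σ₁.set aU 0 t).set aLab t 2 aU 0 = t := by simp [Store.set_apply]
    have eC : (σ₁.set aU 0 t).set aLab t 2 aCur = σ₁ aCur := by simp [Store.set_of_ne]
    have eM : (σ₁.set aU 0 t).set aLab t 2 aMat = σ aMat := by simpa [Store.set_of_ne] using g2
    have eY : (σ₁.set aU 0 t).set aLab t 2 aY = σ aY := by simpa [Store.set_of_ne] using g3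
    have eL : ∀ v, (σ₁.set aU 0 t).set aLab t 2 aLab v = if v = t then 2 else σ aLab v := by
      intro v
      simp [Store.set_apply, g1]
    generalize (σ₁.set aU 0 t).set aLab t 2 = σ₂ at *
    have hrow := fun z => rowOf_saveRow c3 (k := aU) (by decide) (by decide) (eU.symm ▸ htn) (z := z)
    rw [eU, eC, er] at hrow
    have c4 : Ctx x adj n ((saveRow aU).eval x σ₂) := c3.eval
    have f4 : ∀ k, k ∉ (saveRow aU).writes → (saveRow aU).eval x σ₂ k = σ₂ k := fun k hk =>
      Stmt.eval_of_notMem_writes x hk σ₂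
    have k1 := f4 aU (by decide)
    have k2 := f4 aCur (by decide)
    have k3 := f4 aY (by decide)
    have k4 := f4 aLab (by decide)
    generalize (saveRow aU).eval x σ₂ = σ₃ at *
    have := hW σ₃ c4 (by rw [k1, eU]) (by rw [k3, eY])
    rw [this]
    refine ⟨?_, ?_, ?_, fun v => ?_, fun z => ?_⟩
    · rw [Store.set_of_ne _ _ _ (by decide), k2, eC, er]
    · rw [Store.set_of_ne _ _ _ (by decide), k1, eU]
    · simp only [Store.set_apply, and_self, if_true]
      -- The row of `aY` is not the one just overwritten, since `aY` was outer and `t` was not.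
      have hyt : σ aY 0 ≠ t := fun e => hl (e ▸ hy2)
      rw [hrow, if_neg hyt, rowOf_congr eM]
    · rw [Store.set_of_ne _ _ _ (by decide), k4, eL]
    · rw [rowOf_congr (Store.set_of_ne _ _ _ (by decide)), hrow, rowOf_congr eM]
      simp [hl]

/-- The effect of the first `j` steps of a walk. -/
structure WalkInv (x : List ℕ) (adj : ℕ → ℕ → Prop) (n : ℕ) (σ : Store) (a b j : ℕ) (τ : Store) :
    Prop where
  ctx : Ctx x adj n τ
  y : τ aY 0 = b
  cur : ext n (τ aCur) = (walk (rowOf n σ a) (rowOf n σ b) a b j).1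
  u : τ aU 0 = (walk (rowOf n σ a) (rowOf n σ b) a b j).2.1
  w : τ aW 0 = (walk (rowOf n σ a) (rowOf n σ b) a b j).2.2
  lab : ∀ v, τ aLab v = 2 ↔
    σ aLab v = 2 ∨ ∃ i < j, v = (walk (rowOf n σ a) (rowOf n σ b) a b (i + 1)).2.1
  labne : ∀ v, τ aLab v ≠ 2 → τ aLab v = σ aLab v
  old : ∀ z, σ aLab z = 2 → rowOf n τ z = rowOf n σ z
  new : ∀ z, τ aLab z = 2 → σ aLab z ≠ 2 →
    ∃ i < j, z = (walk (rowOf n σ a) (rowOf n σ b) a b (i + 1)).2.1 ∧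
      rowOf n τ z = (walk (rowOf n σ a) (rowOf n σ b) a b (i + 1)).1

theorem WalkInv.of_eq {a b j : ℕ} {τ' : Store} (h : WalkInv x adj n σ a b j τ)
    (h1 : τ' aNum = τ aNum) (h2 : τ' aRow = τ aRow) (h3 : τ' aOff = τ aOff) (h4 : τ' aY = τ aY)
    (h5 : τ' aCur = τ aCur) (h6 : τ' aU = τ aU) (h7 : τ' aW = τ aW) (h8 : τ' aLab = τ aLab)
    (h9 : τ' aMat = τ aMat) : WalkInv x adj n σ a b j τ' := by
  refine ⟨h.ctx.of_eq h1 h2 h3, h4 ▸ h.y, h5 ▸ h.cur, h6 ▸ h.u, h7 ▸ h.w, h8 ▸ h.lab, h8 ▸ h.labne,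
    fun z hz => ?_, fun z hz hz' => ?_⟩
  · rw [rowOf_congr h9, h.old z hz]
  · rw [rowOf_congr h9]
    exact h.new z (h8 ▸ hz) hz'

theorem WalkInv.step {a b j : ℕ} (h : WalkInv x adj n σ a b j τ)
    (hu : ∀ i, (walk (rowOf n σ a) (rowOf n σ b) a b i).2.1 < n)
    (hw : ∀ i, (walk (rowOf n σ a) (rowOf n σ b) a b i).2.2 < n) (hb : b < n)
    (hb2 : σ aLab b = 2) : WalkInv x adj n σ a b (j + 1) (walkStep.eval x τ) := by
  have hu0 := hu j
  have hu1 := hu (j + 1)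
  have hw0 := hw j
  have hlb : τ aLab (τ aY 0) = 2 := by rw [h.y, h.lab]; exact .inl hb2
  have := eval_walkStep (t := (walk (rowOf n σ a) (rowOf n σ b) a b (j + 1)).2.1) h.ctx
    (by rw [h.u]; exact hu0) (by rw [h.w]; exact hw0) (by rw [h.cur, h.w]; exact hu1)
    (by rw [h.y]; exact hb) hlb (by rw [h.cur, h.w]; rfl)
  rw [h.cur, h.u, h.w, h.y, h.old b hb2] at this
  obtain ⟨e1, e2, e3, e4, e5⟩ := this
  have hsub : ∀ v, τ aLab v ≠ 2 → σ aLab v ≠ 2 := fun v hv hv' => hv ((h.lab v).2 (.inl hv'))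
  refine ⟨h.ctx.eval, ?_, e1, e2, e3, fun v => ?_, fun v hv => ?_, fun z hz => ?_,
    fun z hz hz' => ?_⟩
  · rw [Stmt.eval_of_notMem_writes x (by decide), h.y]
  · rw [e4]
    split_ifs with hv
    · exact ⟨fun _ => .inr ⟨j, by omega, hv⟩, fun _ => rfl⟩
    · rw [h.lab]
      refine or_congr_right ⟨fun ⟨i, hi, e⟩ => ⟨i, by omega, e⟩, fun ⟨i, hi, e⟩ => ⟨i, ?_, e⟩⟩
      rcases Nat.lt_succ_iff_lt_or_eq.1 hi with hi | rfl
      exacts [hi, absurd e hv]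
  · rw [e4] at hv ⊢
    split_ifs at hv ⊢
    · exact absurd rfl hv
    · exact h.labne v hv
  · rw [e5, if_neg, h.old z hz]
    rintro ⟨rfl, h'⟩
    exact hsub _ h' hz
  · rw [e5]
    split_ifs with hzt
    · exact ⟨j, by omega, hzt.1, rfl⟩
    · have hz2 : τ aLab z = 2 := by
        rw [e4] at hz
        split_ifs at hz with hzt'
        · by_contra h'
          exact hzt ⟨hzt', hzt' ▸ h'⟩
        · exact hz
      obtain ⟨i, hi, h'⟩ := h.new z hz2 hz'
      exact ⟨i, by omega, h'⟩

theorem eval_blossomCode (h : Ctx x adj n σ) (ha : σ aX 0 < n) (hb : σ aY 0 < n)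
    (hb2 : σ aLab (σ aY 0) = 2)
    (hu : ∀ i, (walk (rowOf n σ (σ aX 0)) (rowOf n σ (σ aY 0)) (σ aX 0) (σ aY 0) i).2.1 < n)
    (hw : ∀ i, (walk (rowOf n σ (σ aX 0)) (rowOf n σ (σ aY 0)) (σ aX 0) (σ aY 0) i).2.2 < n) :
    WalkInv x adj n σ (σ aX 0) (σ aY 0) n (blossomCode.eval x σ) := by
  rw [blossomCode]
  have e1 : ∀ s : Stmt, (Stmt.assign aU (.var aX) ;; .assign aW (.var aY) ;; s).eval x σ =
      s.eval x ((σ.set aU 0 (σ aX 0)).set aW 0 (σ aY 0)) := by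
    intro s
    simp [Stmt.eval, Expr.eval, Store.set_apply]
  rw [e1, Stmt.eval_seq]
  have d1 : ((σ.set aU 0 (σ aX 0)).set aW 0 (σ aY 0)) aU 0 = σ aX 0 := by simp [Store.set_apply]
  have d2 : ((σ.set aU 0 (σ aX 0)).set aW 0 (σ aY 0)) aW 0 = σ aY 0 := by simp [Store.set_apply]
  have d3 : ∀ k, k ≠ aU → k ≠ aW → ((σ.set aU 0 (σ aX 0)).set aW 0 (σ aY 0)) k = σ k :=
    fun k h1 h2 => by rw [Store.set_of_ne _ _ _ h2, Store.set_of_ne _ _ _ h1]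
  generalize (σ.set aU 0 (σ aX 0)).set aW 0 (σ aY 0) = σ₁ at *
  have c1 : Ctx x adj n σ₁ := h.of_eq (d3 _ (by decide) (by decide)) (d3 _ (by decide) (by decide))
    (d3 _ (by decide) (by decide))
  have hX : σ₁ aX = σ aX := d3 _ (by decide) (by decide)
  have hl := ext_loadRow c1 (k := aX) (by decide) (by decide) (by rw [hX]; exact ha)
  rw [hX, rowOf_congr (d3 _ (by decide) (by decide))] at hl
  have c2 : Ctx x adj n ((loadRow aX).eval x σ₁) := c1.eval
  have f2 : ∀ k, k ∉ (loadRow aX).writes → (loadRow aX).eval x σ₁ k = σ₁ k := fun k hk =>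
    Stmt.eval_of_notMem_writes x hk σ₁
  have k1 := f2 aU (by decide)
  have k2 := f2 aW (by decide)
  have k3 := (f2 aY (by decide)).trans (d3 _ (by decide) (by decide))
  have k4 := (f2 aLab (by decide)).trans (d3 _ (by decide) (by decide))
  have k5 := (f2 aMat (by decide)).trans (d3 _ (by decide) (by decide))
  generalize (loadRow aX).eval x σ₁ = σ₂ at *
  rw [eval_each _ _ c2]
  refine forLoop_induction (fun j τ => WalkInv x adj n σ (σ aX 0) (σ aY 0) j τ) ?_ ?_
  · exact ⟨c2, by rw [k3], hl, by rw [k1, d1]; rfl, by rw [k2, d2]; rfl, by simp [k4],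
      fun v _ => by rw [k4], fun z _ => rowOf_congr k5 z, fun z h1 h2 => absurd (k4 ▸ h1) h2⟩
  · intro j _ τ hτ
    refine (hτ.of_eq (τ' := τ.set aJ 0 j) ?_ ?_ ?_ ?_ ?_ ?_ ?_ ?_ ?_).step hu hw hb hb2 <;>
      exact Store.set_of_ne _ _ _ (by decide)

/-- The effect of letting the search grow. -/
theorem eval_growCode (h : Ctx x adj n σ) (ha : σ aX 0 < n) (hb : σ aY 0 < n) {t : ℕ}
    (ht : rowOf n σ (σ aX 0) (σ aY 0) = t) (htn : t < n) :
    (∀ v, growCode.eval x σ aLab v = if v = t then 2 else if v = σ aY 0 then 1 else σ aLab v) ∧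
    ∀ z, rowOf n (growCode.eval x σ) z =
      if z = t then rot (rowOf n σ (σ aX 0)) (σ aX 0) (σ aY 0) else rowOf n σ z := by
  rw [growCode]
  have e1 : ∀ s : Stmt, (Stmt.assign aU (.var aX) ;; .assign aW (.var aY) ;; s).eval x σ =
      s.eval x ((σ.set aU 0 (σ aX 0)).set aW 0 (σ aY 0)) := by
    intro s
    simp [Stmt.eval, Expr.eval, Store.set_apply]
  rw [e1, Stmt.eval_seq]
  have d1 : ((σ.set aU 0 (σ aX 0)).set aW 0 (σ aY 0)) aU 0 = σ aX 0 := by simp [Store.set_apply]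
  have d2 : ((σ.set aU 0 (σ aX 0)).set aW 0 (σ aY 0)) aW 0 = σ aY 0 := by simp [Store.set_apply]
  have d3 : ∀ k, k ≠ aU → k ≠ aW → ((σ.set aU 0 (σ aX 0)).set aW 0 (σ aY 0)) k = σ k :=
    fun k h1 h2 => by rw [Store.set_of_ne _ _ _ h2, Store.set_of_ne _ _ _ h1]
  generalize (σ.set aU 0 (σ aX 0)).set aW 0 (σ aY 0) = σ₁ at *
  have c1 : Ctx x adj n σ₁ := h.of_eq (d3 _ (by decide) (by decide)) (d3 _ (by decide) (by decide))
    (d3 _ (by decide) (by decide))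
  have hX : σ₁ aX = σ aX := d3 _ (by decide) (by decide)
  have hl := ext_loadRow c1 (k := aX) (by decide) (by decide) (by rw [hX]; exact ha)
  rw [hX, rowOf_congr (d3 _ (by decide) (by decide))] at hl
  have c2 : Ctx x adj n ((loadRow aX).eval x σ₁) := c1.eval
  have f2 : ∀ k, k ∉ (loadRow aX).writes → (loadRow aX).eval x σ₁ k = σ₁ k := fun k hk =>
    Stmt.eval_of_notMem_writes x hk σ₁
  have k1 := f2 aU (by decide)
  have k2 := f2 aW (by decide)
  have k3 := (f2 aY (by decide)).trans (d3 _ (by decide) (by decide))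
  have k4 := (f2 aLab (by decide)).trans (d3 _ (by decide) (by decide))
  have k5 := (f2 aMat (by decide)).trans (d3 _ (by decide) (by decide))
  generalize (loadRow aX).eval x σ₁ = σ₂ at *
  rw [Stmt.eval_seq]
  obtain ⟨r1, r2⟩ := eval_rotCode (x := x) σ₂
  rw [k1, k2, d1, d2] at r1
  rw [k2, d2] at r2
  have r3 : σ₂ aCur (σ aY 0) = t := by rw [← ht, ← hl, ext_lt hb]
  have r4 : ext n (rotCode.eval x σ₂ aCur) = rot (rowOf n σ (σ aX 0)) (σ aX 0) (σ aY 0) := by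
    rw [r1, ext_rot ha hb (r3 ▸ htn), hl]
  rw [r3] at r2
  have c3 : Ctx x adj n (rotCode.eval x σ₂) := c2.eval
  have f3 : ∀ k, k ∉ rotCode.writes → rotCode.eval x σ₂ k = σ₂ k := fun k hk =>
    Stmt.eval_of_notMem_writes x hk σ₂
  have l1 := (f3 aY (by decide)).trans k3
  have l2 := (f3 aLab (by decide)).trans k4
  have l3 := (f3 aMat (by decide)).trans k5
  generalize rotCode.eval x σ₂ = σ₃ at *
  have e2 : ∀ s : Stmt, (Stmt.set aLab (.var aY) (.lit 1) ;; .set aLab (.var aT) (.lit 2) ;;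
      s).eval x σ₃ = s.eval x ((σ₃.set aLab (σ aY 0) 1).set aLab t 2) := by
    intro s
    simp [Stmt.eval, Expr.eval, Store.set_apply, l1, r2]
  rw [e2]
  have eT : (σ₃.set aLab (σ aY 0) 1).set aLab t 2 aT 0 = t := by simp [Store.set_apply, r2]
  have eC : (σ₃.set aLab (σ aY 0) 1).set aLab t 2 aCur = σ₃ aCur := by simp [Store.set_of_ne]
  have eM : (σ₃.set aLab (σ aY 0) 1).set aLab t 2 aMat = σ aMat := by
    simpa [Store.set_of_ne] using l3
  have eL : ∀ v, (σ₃.set aLab (σ aY 0) 1).set aLab t 2 aLab v =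
      if v = t then 2 else if v = σ aY 0 then 1 else σ aLab v := by
    intro v
    simp [Store.set_apply, l2]
  have c4 : Ctx x adj n ((σ₃.set aLab (σ aY 0) 1).set aLab t 2) :=
    c3.of_eq (by simp [Store.set_of_ne]) (by simp [Store.set_of_ne]) (by simp [Store.set_of_ne])
  generalize (σ₃.set aLab (σ aY 0) 1).set aLab t 2 = σ₄ at *
  refine ⟨fun v => ?_, fun z => ?_⟩
  · rw [Stmt.eval_of_notMem_writes x (by decide), eL]
  · rw [rowOf_saveRow c4 (by decide) (by decide) (by rw [eT]; exact htn), eT, eC, r4,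
      rowOf_congr eM]

/-- The effect of an augmentation. -/
theorem eval_augmentCode (h : Ctx x adj n σ) (ha : σ aX 0 < n) (hb : σ aY 0 < n)
    (h0 : σ aFound 0 = 0) :
    augmentCode.eval x σ aFound 0 ≠ 0 ∧ ext n (augmentCode.eval x σ aMate) =
      Function.update (Function.update (rowOf n σ (σ aX 0)) (σ aX 0) (σ aY 0)) (σ aY 0)
        (σ aX 0) := by
  rw [augmentCode, Stmt.eval_ite_zero (e := .var aFound) h0, Stmt.eval_seq]
  have hl := ext_loadRow h (k := aX) (by decide) (by decide) ha
  have c2 : Ctx x adj n ((loadRow aX).eval x σ) := h.eval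
  have f2 : ∀ k, k ∉ (loadRow aX).writes → (loadRow aX).eval x σ k = σ k := fun k hk =>
    Stmt.eval_of_notMem_writes x hk σ
  have k1 := f2 aX (by decide)
  have k2 := f2 aY (by decide)
  generalize (loadRow aX).eval x σ = σ₂ at *
  have e2 : ∀ s : Stmt, (Stmt.set aCur (.var aX) (.var aY) ;; .set aCur (.var aY) (.var aX) ;;
      s).eval x σ₂ = s.eval x ((σ₂.set aCur (σ aX 0) (σ aY 0)).set aCur (σ aY 0) (σ aX 0)) := by
    intro s
    simp [Stmt.eval, Expr.eval, Store.set_apply, k1, k2]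
  rw [e2]
  have eC : ext n ((σ₂.set aCur (σ aX 0) (σ aY 0)).set aCur (σ aY 0) (σ aX 0) aCur) =
      Function.update (Function.update (rowOf n σ (σ aX 0)) (σ aX 0) (σ aY 0)) (σ aY 0)
        (σ aX 0) := by
    rw [← hl]
    funext v
    simp only [Function.update_apply, ext, Store.set_apply, true_and]
    split_ifs <;> simp_all
  have c3 : Ctx x adj n ((σ₂.set aCur (σ aX 0) (σ aY 0)).set aCur (σ aY 0) (σ aX 0)) :=
    c2.of_eq (by simp [Store.set_of_ne]) (by simp [Store.set_of_ne]) (by simp [Store.set_of_ne])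
  generalize (σ₂.set aCur (σ aX 0) (σ aY 0)).set aCur (σ aY 0) (σ aX 0) = σ₃ at *
  rw [Stmt.eval_seq, eval_each _ _ c3]
  have := forLoop_induction (f := fun j (τ : Store) => (Stmt.set aMate (.var aI)
      (.get aCur (.var aI))).eval x (τ.set aI 0 j)) (n := n) (a := σ₃)
    (fun j τ => (∀ v < j, τ aMate v = σ₃ aCur v) ∧ τ aCur = σ₃ aCur) ⟨by simp, rfl⟩ ?_
  · refine ⟨by simp [Stmt.eval, Expr.eval, Store.set_apply], ?_⟩
    rw [← eC, Stmt.eval, Store.set_of_ne _ _ _ (by decide)]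
    exact ext_congr this.1
  · rintro j hj τ ⟨h1, h2⟩
    refine ⟨fun v hv => ?_, ?_⟩
    · rcases Nat.lt_succ_iff_lt_or_eq.1 hv with hv | rfl
      · simp [Stmt.eval, Expr.eval, Store.set_apply, h1 v hv, Nat.ne_of_lt hv]
      · simp [Stmt.eval, Expr.eval, Store.set_apply, h2]
    · rw [Stmt.eval, Store.set_of_ne _ _ _ (by decide), Store.set_of_ne _ _ _ (by decide), h2]

end search

end Imp

/-! ### The invariant of a search and the progress of its rounds. -/

namespace Imp

/-- The outer vertices. -/
def outer (n : ℕ) (σ : Store) : Finset ℕ := (Finset.range n).filter fun v => σ aLab v = 2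

/-- The inner vertices. -/
def inner (n : ℕ) (σ : Store) : Finset ℕ := (Finset.range n).filter fun v => σ aLab v = 1

/-- The invariant of a search in the graph induced on `S`, with the matching `M`, from `r`. -/
structure SearchInv (adj : ℕ → ℕ → Prop) (n : ℕ) (S : Finset ℕ) (M : ℕ → ℕ) (r : ℕ) (σ : Store) :
    Prop where
  forest : ∃ blk c p, BForest adj M (outer n σ) (outer n σ) (inner n σ) (rowOf n σ) blk c p
  root : σ aLab r = 2
  rootRow : rowOf n σ r = M
  le_two : ∀ v < n, σ aLab v ≤ 2
  sub : ∀ v < n, σ aLab v ≠ 0 → v ∈ S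
  act : ∀ v < n, σ aAct v ≠ 0 ↔ v ∈ S
  found : (σ aFound 0 = 0 ∧ ext n (σ aMate) = M) ∨
    (σ aFound 0 ≠ 0 ∧ IsMatch adj S (ext n (σ aMate)) ∧
      (moved S (ext n (σ aMate))).card = (moved S M).card + 2)

/-- The two states of a search have the same outer vertices and matchings. -/
structure SameSearch (n : ℕ) (σ τ : Store) : Prop where
  lab : τ aLab = σ aLab
  -- The rows of vertices that are not outer may hold anything.
  row : ∀ z, σ aLab z = 2 → rowOf n τ z = rowOf n σ z

/-- The edge from the outer vertex `a` to `b` does not contribute to the search any more. -/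
structure Done (n : ℕ) (σ : Store) (a b : ℕ) : Prop where
  lab : σ aLab b ≠ 0
  walk : σ aLab b = 2 → ∀ i < n, σ aLab (walk (rowOf n σ a) (rowOf n σ b) a b (i + 1)).2.1 = 2

/-- The edge from `a` to `b` is to be inspected. -/
def Open (adj : ℕ → ℕ → Prop) (S : Finset ℕ) (σ : Store) (a b : ℕ) : Prop :=
  σ aLab a = 2 ∧ b ∈ S ∧ adj a b

section search

variable {x : List ℕ} {adj : ℕ → ℕ → Prop} {n : ℕ} {S : Finset ℕ} {M : ℕ → ℕ} {r : ℕ} {σ τ : Store}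

theorem mem_outer {v : ℕ} : v ∈ outer n σ ↔ v < n ∧ σ aLab v = 2 := by simp [outer]

theorem mem_inner {v : ℕ} : v ∈ inner n σ ↔ v < n ∧ σ aLab v = 1 := by simp [inner]

theorem SameSearch.refl (n : ℕ) (σ : Store) : SameSearch n σ σ :=
  ⟨rfl, fun _ _ => rfl⟩

theorem SameSearch.trans {υ : Store} (h₁ : SameSearch n σ τ) (h₂ : SameSearch n τ υ) :
    SameSearch n σ υ :=
  ⟨h₂.lab.trans h₁.lab, fun z hz => (h₂.row z (h₁.lab ▸ hz)).trans (h₁.row z hz)⟩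

theorem SameSearch.symm (h : SameSearch n σ τ) : SameSearch n τ σ :=
  ⟨h.lab.symm, fun z hz => (h.row z (h.lab ▸ hz)).symm⟩

theorem SameSearch.of_eq (h1 : τ aLab = σ aLab) (h2 : τ aMat = σ aMat) : SameSearch n σ τ :=
  ⟨h1, fun z _ => rowOf_congr h2 z⟩

theorem SameSearch.outer_eq (h : SameSearch n σ τ) : outer n τ = outer n σ := by
  rw [outer, outer, h.lab]

theorem Open.of_same {a b : ℕ} (h : Open adj S σ a b) (hs : SameSearch n σ τ) :
    Open adj S τ a b := by
  rw [Open, hs.lab]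
  exact h

theorem Done.of_same {a b : ℕ} (h : Done n σ a b) (hs : SameSearch n σ τ) (ha : σ aLab a = 2) :
    Done n τ a b := by
  obtain ⟨h2, h3⟩ := h
  refine ⟨by rwa [hs.lab], fun hb => ?_⟩
  rw [hs.lab] at hb
  rw [hs.lab, hs.row a ha, hs.row b hb]
  exact h3 hb

theorem SearchInv.subset (h : SearchInv adj n S M r σ) : outer n σ ∪ inner n σ ⊆ S := by
  intro v hv
  rw [Finset.mem_union, mem_outer, mem_inner] at hv
  rcases hv with hv | hv <;> exact h.sub v hv.1 (by omega)

theorem SearchInv.of_eq (h : SearchInv adj n S M r σ) (h1 : τ aLab = σ aLab) (h2 : τ aMat = σ aMat)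
    (h3 : τ aAct = σ aAct) (h4 : τ aFound = σ aFound) (h5 : τ aMate = σ aMate) :
    SearchInv adj n S M r τ := by
  have e1 : outer n τ = outer n σ := by rw [outer, outer, h1]
  have e2 : inner n τ = inner n σ := by rw [inner, inner, h1]
  have e3 : rowOf n τ = rowOf n σ := funext fun z => rowOf_congr h2 z
  obtain ⟨f, a, b, c, d, e, g⟩ := h
  constructor <;> simp only [e1, e2, e3, h1, h3, h4, h5] <;> assumption

theorem SearchInv.walk_lt (h : SearchInv adj n S M r σ) (hs : ∀ {u v}, adj u v → adj v u) {a b : ℕ}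
    (ha : a < n) (hb : b < n) (ha2 : σ aLab a = 2) (hb2 : σ aLab b = 2) (hab : adj a b) (i : ℕ) :
    (walk (rowOf n σ a) (rowOf n σ b) a b i).2.1 < n ∧
      (walk (rowOf n σ a) (rowOf n σ b) a b i).2.2 < n := by
  obtain ⟨blk, c, p, hf⟩ := h.forest
  have ha' := mem_outer.2 ⟨ha, ha2⟩
  have hb' := mem_outer.2 ⟨hb, hb2⟩
  obtain ⟨-, h1, h2, -⟩ := walk_mem (hf.near ha') (hf.near hb') hs ha' hb' hab i
  rw [mem_outer, mem_inner] at h1 h2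
  omega

/-- The effect of a part of the search that inspects the edges in `P`. -/
structure Step (x : List ℕ) (adj : ℕ → ℕ → Prop) (n : ℕ) (S : Finset ℕ) (M : ℕ → ℕ) (r : ℕ)
    (P : ℕ → ℕ → Prop) (σ τ : Store) : Prop where
  ctx : Ctx x adj n τ
  inv : SearchInv adj n S M r τ
  mono : τ aFound 0 = 0 → σ aFound 0 = 0
  -- Progress is accompanied by an edge that was not done before; hence there is none once all open
  -- edges are done.
  alt : ((outer n σ).card < (outer n τ).card ∧ ∃ a b, a < n ∧ Open adj S σ a b ∧ ¬ Done n σ a b) ∨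
    SameSearch n σ τ ∧ (τ aFound 0 = 0 → ∀ a b, P a b → Open adj S σ a b → Done n σ a b)

theorem Step.trans {P Q : ℕ → ℕ → Prop} {υ : Store} (h₁ : Step x adj n S M r P σ τ)
    (h₂ : Step x adj n S M r Q τ υ) : Step x adj n S M r (fun a b => P a b ∨ Q a b) σ υ := by
  refine ⟨h₂.ctx, h₂.inv, fun h => h₁.mono (h₂.mono h), ?_⟩
  rcases h₁.alt with ⟨c1, e1⟩ | ⟨s1, d1⟩
  · refine .inl ⟨?_, e1⟩
    rcases h₂.alt with ⟨c2, -⟩ | ⟨s2, -⟩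
    · exact c1.trans c2
    · rwa [s2.outer_eq]
  · rcases h₂.alt with ⟨c2, a, b, ha, ho, hd⟩ | ⟨s2, d2⟩
    · exact .inl ⟨s1.outer_eq ▸ c2, a, b, ha, ho.of_same s1.symm,
        fun h => hd (h.of_same s1 (ho.of_same s1.symm).1)⟩
    · refine .inr ⟨s1.trans s2, fun h a b hP ho => ?_⟩
      rcases hP with hP | hP
      · exact d1 (h₂.mono h) a b hP ho
      · exact (d2 h a b hP (ho.of_same s1)).of_same s1.symm (ho.of_same s1).1

theorem Step.weaken {P Q : ℕ → ℕ → Prop} (h : Step x adj n S M r P σ τ)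
    (hQ : ∀ a b, Open adj S σ a b → Q a b → P a b) : Step x adj n S M r Q σ τ :=
  ⟨h.ctx, h.inv, h.mono, h.alt.imp_right fun ⟨s, d⟩ =>
    ⟨s, fun hf a b hab ho => d hf a b (hQ a b ho hab) ho⟩⟩

theorem Step.of_eq {P : ℕ → ℕ → Prop} (hc : Ctx x adj n σ) (hi : SearchInv adj n S M r σ)
    (h : ∀ k : Fin 63, k ∈ [aNum, aRow, aOff, aLab, aMat, aAct, aFound, aMate] → τ k = σ k)
    (hP : ∀ a b, ¬ P a b) : Step x adj n S M r P σ τ :=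
  ⟨hc.of_eq (h _ (by decide)) (h _ (by decide)) (h _ (by decide)),
    hi.of_eq (h _ (by decide)) (h _ (by decide)) (h _ (by decide)) (h _ (by decide))
      (h _ (by decide)), fun h' => h aFound (by decide) ▸ h',
    .inr ⟨.of_eq (h _ (by decide)) (h _ (by decide)), fun _ a b h' => absurd h' (hP a b)⟩⟩

/-- `K` carries what the body preserves besides the invariant, such as the value of the variable of
an enclosing loop. -/
theorem Step.forLoop {P : ℕ → ℕ → ℕ → Prop} (f : ℕ → Store → Store) (K : Store → Prop)
    (hc : Ctx x adj n σ) (hi : SearchInv adj n S M r σ) (hK : K σ) {m : ℕ}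
    (h : ∀ j < m, ∀ τ, Ctx x adj n τ → SearchInv adj n S M r τ → K τ →
      Step x adj n S M r (P j) τ (f j τ) ∧ K (f j τ)) :
    Step x adj n S M r (fun a b => ∃ j < m, P j a b) σ (forLoop f m σ) := by
  refine (forLoop_induction (fun j τ =>
    Step x adj n S M r (fun a b => ∃ i < j, P i a b) σ τ ∧ K τ) ⟨?_, hK⟩ ?_).1
  · exact .of_eq hc hi (fun _ _ => rfl) (by simp)
  · rintro j hj τ ⟨h1, h2⟩
    obtain ⟨h3, h4⟩ := h j hj τ h1.ctx h1.inv h2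
    refine ⟨(h1.trans h3).weaken ?_, h4⟩
    rintro a b - ⟨i, hi, hP⟩
    rcases Nat.lt_succ_iff_lt_or_eq.1 hi with hi | rfl
    exacts [.inl ⟨i, hi, hP⟩, .inr hP]

variable (hg : IsGraphRel adj n) (hS : S ⊆ Finset.range n) (hM : IsMatch adj S M) (hr : r < n)

include hg hM hr

theorem step_augment (hc : Ctx x adj n σ) (hi : SearchInv adj n S M r σ) (ha : σ aX 0 < n)
    (hb : σ aY 0 < n) (ho : Open adj S σ (σ aX 0) (σ aY 0))
    (hab : rowOf n σ (σ aX 0) (σ aY 0) = σ aY 0) :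
    Step x adj n S M r (fun a b => a = σ aX 0 ∧ b = σ aY 0) σ (augmentCode.eval x σ) := by
  by_cases h0 : σ aFound 0 = 0
  · obtain ⟨h1, h2⟩ := eval_augmentCode hc ha hb h0
    have f : ∀ k, k ∉ augmentCode.writes → augmentCode.eval x σ k = σ k := fun k hk =>
      Stmt.eval_of_notMem_writes x hk σ
    have f1 := f aLab (by decide)
    have f2 := f aMat (by decide)
    have f3 := f aAct (by decide)
    have hc' : Ctx x adj n (augmentCode.eval x σ) := hc.eval
    generalize augmentCode.eval x σ = τ at *
    have e1 : outer n τ = outer n σ := by rw [outer, outer, f1]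
    have e2 : inner n τ = inner n σ := by rw [inner, inner, f1]
    have e3 : rowOf n τ = rowOf n σ := funext fun z => rowOf_congr f2 z
    refine ⟨hc', ⟨?_, by rw [f1, hi.root], by rw [e3, hi.rootRow], by rw [f1]; exact hi.le_two,
      by rw [f1]; exact hi.sub, by rw [f3]; exact hi.act, .inr ⟨h1, ?_⟩⟩, fun h => absurd h h1,
      .inr ⟨.of_eq f1 f2, fun h => absurd h h1⟩⟩
    · rw [e1, e2, e3]
      exact hi.forest
    · obtain ⟨blk, c, p, hf⟩ := hi.forest
      have n1 := hf.near (mem_outer.2 ⟨ha, ho.1⟩)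
      have n2 := hf.near (mem_outer.2 ⟨hr, hi.root⟩)
      rw [h2]
      have := n1.augment n2 hg.symm hM (by simp [mem_outer, ha, ho.1])
        (by simp [mem_outer, hr, hi.root]) hi.subset ho.2.1
        (fun e => hg.irrefl _ (by have := ho.2.2; rwa [e] at this)) ho.2.2 hab
      rwa [hi.rootRow] at this
  · have : augmentCode.eval x σ = σ := Stmt.eval_ite_ne (e := .var aFound) h0
    rw [this]
    exact ⟨hc, hi, id, .inr ⟨.refl _ _, fun h => absurd h h0⟩⟩

theorem step_grow (hc : Ctx x adj n σ) (hi : SearchInv adj n S M r σ) (ha : σ aX 0 < n)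
    (hb : σ aY 0 < n) (ho : Open adj S σ (σ aX 0) (σ aY 0))
    (hab : rowOf n σ (σ aX 0) (σ aY 0) ≠ σ aY 0) (hl : σ aLab (σ aY 0) = 0) :
    Step x adj n S M r (fun a b => a = σ aX 0 ∧ b = σ aY 0) σ (growCode.eval x σ) := by
  obtain ⟨blk, c, p, hf⟩ := hi.forest
  have ha' := mem_outer.2 ⟨ha, ho.1⟩
  have hbD : σ aY 0 ∉ outer n σ := by rw [mem_outer]; omega
  have hbA : σ aY 0 ∉ inner n σ := by rw [mem_inner]; omega
  have hadj := hf.adj _ ha' _ hab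
  have htn := hg.lt (hg.symm hadj)
  have htM := hf.out _ ha' _ hbD hbA
  have hinv := hf.inv _ ha' (σ aY 0)
  obtain ⟨e1, e2⟩ := eval_growCode hc ha hb rfl htn
  have f : ∀ k, k ∉ growCode.writes → growCode.eval x σ k = σ k := fun k hk =>
    Stmt.eval_of_notMem_writes x hk σ
  have f3 := f aAct (by decide)
  have f4 := f aFound (by decide)
  have f5 := f aMate (by decide)
  have hc' : Ctx x adj n (growCode.eval x σ) := hc.eval
  generalize growCode.eval x σ = τ at *
  have hg' := @BForest.grow _ _ _ _ _ _ _ _ hf hg.symm _ _ ha' ho.2.2 hbD hbA hab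
  have hDA : ∀ v, rowOf n σ (σ aX 0) (σ aY 0) = v → v ∉ outer n σ ∧ v ∉ inner n σ := by
    rintro v rfl
    rw [← not_or]
    intro h
    have := hf.stab _ ha' _ h
    rw [hinv] at this
    exact this.elim hbD hbA
  generalize hb0 : σ aY 0 = b at *
  generalize ha0 : σ aX 0 = a at *
  generalize ht : rowOf n σ a b = t at *
  obtain ⟨htD, htA⟩ := hDA t rfl
  have hlt : σ aLab t = 0 := by
    have := hi.le_two t htn
    rw [mem_outer] at htD
    rw [mem_inner] at htA
    omega
  -- Vertices outside `S` are fixed by `M`, whereas `t` is the partner of `b`.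
  have htS : t ∈ S := by
    by_contra h
    have h1 := hM.out t h
    have h2 := hM.inv b
    rw [← htM, h1] at h2
    exact hab h2
  have o1 : outer n τ = insert t (outer n σ) := by
    ext v
    rw [Finset.mem_insert, mem_outer, mem_outer, e1]
    split_ifs with h1 h2
    · simp [h1, htn]
    · subst h2
      simp [hl, h1]
    · simp [h1]
  have o2 : inner n τ = insert b (inner n σ) := by
    ext v
    rw [Finset.mem_insert, mem_inner, mem_inner, e1]
    split_ifs with h1 h2
    · subst h1
      simp [hlt, hab]
    · subst h2
      simp [hb]
    · simp [h2]
  refine ⟨hc', ⟨?_, ?_, ?_, fun v hv => ?_, fun v hv hv' => ?_, by rw [f3]; exact hi.act,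
    by rw [f4, f5]; exact hi.found⟩, fun h => f4 ▸ h,
    .inl ⟨?_, a, b, ha, ho, fun h => h.lab hl⟩⟩
  · obtain ⟨blk', c', p', h⟩ := hg' (N' := rowOf n τ) (fun z hz => by
      rw [e2, if_neg]
      rintro rfl
      exact htD hz) (by rw [e2, if_pos rfl])
    rw [o1, o2]
    exact ⟨blk', c', p', h⟩
  · have h1 : r ≠ b := fun e => by have := hi.root; rw [e] at this; omega
    rw [e1, if_neg h1, hi.root, ite_self]
  · rw [e2, if_neg, hi.rootRow]
    rintro rfl
    exact htD (mem_outer.2 ⟨hr, hi.root⟩)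
  · rw [e1]
    split_ifs
    exacts [le_rfl, by norm_num, hi.le_two v hv]
  · rw [e1] at hv'
    split_ifs at hv' with h1 h2
    exacts [h1 ▸ htS, h2 ▸ ho.2.1, hi.sub v hv hv']
  · rw [o1, Finset.card_insert_of_notMem htD]
    omega

omit hM hr in
include hS in
theorem step_blossom (hc : Ctx x adj n σ) (hi : SearchInv adj n S M r σ) (ha : σ aX 0 < n)
    (hb : σ aY 0 < n) (ho : Open adj S σ (σ aX 0) (σ aY 0))
    (hl : σ aLab (σ aY 0) = 2) :
    Step x adj n S M r (fun a b => a = σ aX 0 ∧ b = σ aY 0) σ (blossomCode.eval x σ) := by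
  obtain ⟨blk, c, p, hf⟩ := hi.forest
  have ha' := mem_outer.2 ⟨ha, ho.1⟩
  have hb' := mem_outer.2 ⟨hb, hl⟩
  have hlt := hi.walk_lt hg.symm ha hb ho.1 hl ho.2.2
  have hmem := walk_mem (hf.near ha') (hf.near hb') hg.symm ha' hb' ho.2.2
  have hw := eval_blossomCode hc ha hb hl (fun i => (hlt i).1) (fun i => (hlt i).2)
  have f : ∀ k, k ∉ blossomCode.writes → blossomCode.eval x σ k = σ k := fun k hk =>
    Stmt.eval_of_notMem_writes x hk σ
  have f3 := f aAct (by decide)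
  have f4 := f aFound (by decide)
  have f5 := f aMate (by decide)
  have hcard : (outer n σ ∪ inner n σ).card ≤ n := by
    simpa using Finset.card_le_card (hi.subset.trans hS)
  generalize blossomCode.eval x σ = τ at *
  generalize σ aY 0 = b at *
  generalize σ aX 0 = a at *
  have hD' : ∀ v, v ∈ outer n τ ↔ v ∈ outer n σ ∨
      ∃ i < n, v = (walk (rowOf n σ a) (rowOf n σ b) a b (i + 1)).2.1 := by
    intro v
    rw [mem_outer, mem_outer, hw.lab]
    constructor
    · rintro ⟨h1, h2⟩
      exact h2.imp_left fun h => ⟨h1, h⟩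
    · rintro (⟨h1, h2⟩ | ⟨i, hi, rfl⟩)
      exacts [⟨h1, .inl h2⟩, ⟨(hlt _).1, .inr ⟨i, hi, rfl⟩⟩]
  have hsub : outer n σ ⊆ outer n τ := fun v hv => (hD' v).2 (.inl hv)
  refine ⟨hw.ctx, ⟨?_, (hw.lab r).2 (.inl hi.root), by rw [hw.old r hi.root, hi.rootRow],
    fun v hv => ?_, fun v hv hv' => ?_, by rw [f3]; exact hi.act, by rw [f4, f5]; exact hi.found⟩,
    fun h => f4 ▸ h, ?_⟩
  · have hA' : ∀ v, v ∈ inner n τ ↔ v ∈ inner n σ ∧ v ∉ outer n τ := by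
      intro v
      rw [mem_inner, mem_inner, mem_outer]
      constructor
      · rintro ⟨h1, h2⟩
        have := hw.labne v (by omega)
        exact ⟨⟨h1, by omega⟩, by omega⟩
      · rintro ⟨⟨h1, h2⟩, h3⟩
        have := hw.labne v fun h => h3 ⟨h1, h⟩
        exact ⟨h1, by omega⟩
    obtain ⟨blk', h⟩ := hf.blossom hg.symm ha' hb' ho.2.2 hcard hA' hD'
      (N' := rowOf n τ) (fun z hz => hw.old z (mem_outer.1 hz).2) (fun z hz hz' => by
        rw [mem_outer] at hz hz'
        exact hw.new z hz.2 fun h => hz' ⟨hz.1, h⟩)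
    exact ⟨blk', c, p, h⟩
  · by_cases h : τ aLab v = 2
    · exact h.le
    · rw [hw.labne v h]
      exact hi.le_two v hv
  · by_cases h : τ aLab v = 2
    · rcases (hw.lab v).1 h with h | ⟨i, -, rfl⟩
      · exact hi.sub v hv (by omega)
      · exact hi.subset (Finset.mem_union.2 (hmem _).2.1)
    · rw [hw.labne v h] at hv'
      exact hi.sub v hv hv'
  -- If the walk uncovers only vertices that are outer already, nothing changes and the edge is
  -- done; otherwise there are more outer vertices than before.
  · by_cases hall : ∀ i < n, σ aLab (walk (rowOf n σ a) (rowOf n σ b) a b (i + 1)).2.1 = 2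
    · refine .inr ⟨⟨funext fun v => ?_, hw.old⟩, ?_⟩
      · by_cases h : τ aLab v = 2
        · rw [h]
          rcases (hw.lab v).1 h with h | ⟨i, hi, rfl⟩
          exacts [h.symm, (hall i hi).symm]
        · exact hw.labne v h
      · rintro - a' b' ⟨rfl, rfl⟩ -
        exact ⟨by omega, fun _ => hall⟩
    · refine .inl ⟨?_, a, b, ha, ho, fun h => hall (h.walk hl)⟩
      push Not at hall
      obtain ⟨i, hi, h⟩ := hall
      refine Finset.card_lt_card ⟨hsub, fun h' => h ?_⟩
      exact (mem_outer.1 (h' ((hD' _).2 (.inr ⟨i, hi, rfl⟩)))).2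

include hS

theorem step_visit (hc : Ctx x adj n σ) (hi : SearchInv adj n S M r σ) (ha : σ aX 0 < n)
    (hb : σ aY 0 < n) (ho : Open adj S σ (σ aX 0) (σ aY 0)) :
    Step x adj n S M r (fun a b => a = σ aX 0 ∧ b = σ aY 0) σ (visitCode.eval x σ) := by
  have hrow : (Expr.get aMat (matIndex aX aY)).eval x σ = rowOf n σ (σ aX 0) (σ aY 0) := by
    simp only [Expr.eval, matIndex, rowOf, ext_lt hb, hc.row _ ha]
  rw [visitCode]
  by_cases hab : rowOf n σ (σ aX 0) (σ aY 0) = σ aY 0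
  · rw [Stmt.eval_ite_zero (e := .dist (.get aMat (matIndex aX aY)) (.var aY))
      ((eval_dist _ _).2 (hrow.trans hab))]
    exact step_augment hg hM hr hc hi ha hb ho hab
  rw [Stmt.eval_ite_ne (e := .dist (.get aMat (matIndex aX aY)) (.var aY))
    fun h => hab (hrow.symm.trans ((eval_dist _ _).1 h))]
  by_cases hl : σ aLab (σ aY 0) = 0
  · rw [Stmt.eval_ite_zero (e := .get aLab (.var aY)) hl]
    exact step_grow hg hM hr hc hi ha hb ho hab hl
  rw [Stmt.eval_ite_ne (e := .get aLab (.var aY)) hl]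
  by_cases hl' : σ aLab (σ aY 0) = 2
  · rw [Stmt.eval_ite_zero (e := .dist (.get aLab (.var aY)) (.lit 2)) ((eval_dist _ _).2 hl')]
    exact step_blossom hg hS hc hi ha hb ho hl'
  · rw [Stmt.eval_ite_ne (e := .dist (.get aLab (.var aY)) (.lit 2))
      fun h => hl' ((eval_dist _ _).1 h)]
    refine ⟨hc, hi, id, .inr ⟨.refl _ _, ?_⟩⟩
    rintro - a b ⟨rfl, rfl⟩ -
    exact ⟨hl, fun h => absurd h hl'⟩

theorem step_edge (hc : Ctx x adj n σ) (hi : SearchInv adj n S M r σ) (ha : σ aX 0 < n)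
    (hb : σ aY 0 < n) :
    Step x adj n S M r (fun a b => a = σ aX 0 ∧ b = σ aY 0) σ (edgeCode.eval x σ) := by
  have hskip : ¬ Open adj S σ (σ aX 0) (σ aY 0) →
      Step x adj n S M r (fun a b => a = σ aX 0 ∧ b = σ aY 0) σ (Stmt.skip.eval x σ) := by
    refine fun h => ⟨hc, hi, id, .inr ⟨.refl _ _, ?_⟩⟩
    rintro - a b ⟨rfl, rfl⟩ ho
    exact absurd ho h
  rw [edgeCode]
  by_cases h1 : σ aLab (σ aX 0) = 2
  · rw [Stmt.eval_ite_zero (e := .dist (.get aLab (.var aX)) (.lit 2)) ((eval_dist _ _).2 h1)]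
    by_cases h2 : σ aAct (σ aY 0) = 0
    · rw [Stmt.eval_ite_zero (e := .get aAct (.var aY)) h2]
      exact hskip fun h => (hi.act _ hb).2 h.2.1 h2
    · rw [Stmt.eval_ite_ne (e := .get aAct (.var aY)) h2]
      by_cases h3 : adj (σ aX 0) (σ aY 0)
      · rw [Stmt.eval_ite_ne fun h => (eval_adjEntry hc ha hb).1 h h3]
        exact step_visit hg hS hM hr hc hi ha hb ⟨h1, (hi.act _ hb).1 h2, h3⟩
      · rw [Stmt.eval_ite_zero ((eval_adjEntry hc ha hb).2 h3)]
        exact hskip fun h => h3 h.2.2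
  · rw [Stmt.eval_ite_ne (e := .dist (.get aLab (.var aX)) (.lit 2))
      fun h => h1 ((eval_dist _ _).1 h)]
    exact hskip fun h => h1 h.1

theorem step_round (hc : Ctx x adj n σ) (hi : SearchInv adj n S M r σ) :
    Step x adj n S M r (fun a _ => a < n) σ (roundCode.eval x σ) := by
  rw [roundCode, eval_each _ _ hc]
  refine (Step.forLoop (P := fun j a b => a = j ∧ b < n) _ (fun _ => True) hc hi trivial
    fun j hj τ hc hi _ => ⟨?_, trivial⟩).weaken
    fun a b ho ha => ⟨a, ha, rfl, Finset.mem_range.1 (hS ho.2.1)⟩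
  have s1 : Step x adj n S M r (fun _ _ => False) τ (τ.set aX 0 j) :=
    .of_eq hc hi (fun k hk => Store.set_of_ne _ _ _ (by rintro rfl; revert hk; decide)) (by simp)
  have e1 : τ.set aX 0 j aX 0 = j := by simp [Store.set_apply]
  generalize τ.set aX 0 j = σ₁ at *
  refine (s1.trans (Q := fun a b => a = j ∧ b < n) ?_).weaken fun _ _ _ h => .inr h
  rw [eval_each _ _ s1.ctx]
  refine (Step.forLoop (P := fun i a b => a = j ∧ b = i) _ (fun τ => τ aX 0 = j) s1.ctx s1.inv e1
    fun i hi τ hc hi' hK => ⟨?_, ?_⟩).weaken fun a b _ h => ⟨b, h.2, h.1, rfl⟩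
  · have s2 : Step x adj n S M r (fun _ _ => False) τ (τ.set aY 0 i) :=
      .of_eq hc hi' (fun k hk => Store.set_of_ne _ _ _ (by rintro rfl; revert hk; decide)) (by simp)
    have e2 : τ.set aY 0 i aY 0 = i := by simp [Store.set_apply]
    have e3 : τ.set aY 0 i aX 0 = j := by simpa [Store.set_apply] using hK
    generalize τ.set aY 0 i = σ₂ at *
    have := step_edge hg hS hM hr s2.ctx s2.inv (by rw [e3]; exact hj) (by rw [e2]; exact hi)
    rw [e2, e3] at this
    exact (s2.trans this).weaken fun _ _ _ h => .inr h
  · rw [Stmt.eval_of_notMem_writes x (by decide), Store.set_of_ne _ _ _ (by decide)]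
    exact hK

/-- The rounds of a search exhaust the graph. -/
theorem eval_rounds (hc : Ctx x adj n σ) (hi : SearchInv adj n S M r σ) :
    SearchInv adj n S M r ((Stmt.each aRd roundCode).eval x σ) ∧
      ((Stmt.each aRd roundCode).eval x σ aFound 0 = 0 → ∀ a b, a < n →
        Open adj S ((Stmt.each aRd roundCode).eval x σ) a b →
        Done n ((Stmt.each aRd roundCode).eval x σ) a b) := by
  rw [eval_each _ _ hc]
  -- After `j` rounds there are more than `j` outer vertices, unless a match has been found or all
  -- open edges are done; for `j = n` the first is impossible.
  have := forLoop_induction (f := fun j τ => roundCode.eval x (τ.set aRd 0 j)) (n := n) (a := σ)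
    (fun j τ => Ctx x adj n τ ∧ SearchInv adj n S M r τ ∧ (j + 1 ≤ (outer n τ).card ∨
      (τ aFound 0 = 0 → ∀ a b, a < n → Open adj S τ a b → Done n τ a b))) ⟨hc, hi, .inl ?_⟩ ?_
  · obtain ⟨-, h1, h2⟩ := this
    refine ⟨h1, h2.resolve_left fun h => ?_⟩
    have := Finset.card_le_card (Finset.subset_union_left.trans (h1.subset.trans hS))
    rw [Finset.card_range] at this
    omega
  · exact Finset.card_pos.2 ⟨r, mem_outer.2 ⟨hr, hi.root⟩⟩
  · rintro j hj τ ⟨hc, hi, h⟩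
    have s1 : Step x adj n S M r (fun _ _ => False) τ (τ.set aRd 0 j) :=
      .of_eq hc hi (fun k hk => Store.set_of_ne _ _ _ (by rintro rfl; revert hk; decide)) (by simp)
    have s2 := s1.trans (step_round hg hS hM hr s1.ctx s1.inv)
    refine ⟨s2.ctx, s2.inv, ?_⟩
    rcases s2.alt with ⟨h1, a, b, ha, ho, hd⟩ | ⟨h1, h2⟩
    · rcases h with h | h
      · exact .inl (by omega)
      · exact .inr fun h' => absurd (h (s2.mono h') a b ha ho) hd
    · exact .inr fun h' a b ha ho => (h2 h' a b (.inr ha) (ho.of_same h1.symm)).of_same h1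
        (ho.of_same h1.symm).1

end search

end Imp

/-! ### Maximum matchings, built one vertex at a time. -/

namespace Imp

variable {x : List ℕ} {adj : ℕ → ℕ → Prop} {n : ℕ} {S : Finset ℕ} {r : ℕ} {σ τ : Store}

/-- The beginning of a search. -/
theorem eval_searchStart (hc : Ctx x adj n σ) (hr : σ aRoot 0 < n) {σ' : Store}
    (hσ' : σ' = (Stmt.assign aFound (.lit 0) ;; .each aI (.set aLab (.var aI) (.lit 0)) ;;
      .set aLab (.var aRoot) (.lit 2) ;;
      .each aI (.set aMat (matIndex aRoot aI) (.get aMate (.var aI)))).eval x σ) :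
    Ctx x adj n σ' ∧ σ' aFound 0 = 0 ∧ (∀ v < n, σ' aLab v = if v = σ aRoot 0 then 2 else 0) ∧
      rowOf n σ' (σ aRoot 0) = ext n (σ aMate) ∧ σ' aAct = σ aAct ∧ σ' aMate = σ aMate := by
  subst hσ'
  refine ⟨hc.eval, ?_, fun v hv => ?_, ?_, Stmt.eval_of_notMem_writes x (by decide) σ,
    Stmt.eval_of_notMem_writes x (by decide) σ⟩
  · rw [Stmt.eval_seq, Stmt.eval_of_notMem_writes x (by decide)]
    simp [Stmt.eval, Expr.eval, Store.set_apply]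
  · rw [Stmt.eval_seq, Stmt.eval_seq, Stmt.eval_seq, Stmt.eval_of_notMem_writes x (by decide)]
    have c1 : Ctx x adj n ((Stmt.assign aFound (.lit 0)).eval x σ) := hc.eval
    have k1 : (Stmt.assign aFound (.lit 0)).eval x σ aRoot = σ aRoot :=
      Stmt.eval_of_notMem_writes x (by decide) σ
    generalize (Stmt.assign aFound (.lit 0)).eval x σ = σ₁ at *
    have := forLoop_induction (f := fun j τ => (Stmt.set aLab (.var aI) (.lit 0)).eval x
      (τ.set aI 0 j)) (n := n) (a := σ₁) (fun j τ => ∀ v < j, τ aLab v = 0) (by simp) ?_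
    · rw [← eval_each (x := x) (adj := adj) aI _ c1] at this
      have k2 : (Stmt.each aI (.set aLab (.var aI) (.lit 0))).eval x σ₁ aRoot = σ₁ aRoot :=
        Stmt.eval_of_notMem_writes x (by decide) σ₁
      generalize (Stmt.each aI (.set aLab (.var aI) (.lit 0))).eval x σ₁ = σ₂ at *
      simp [Stmt.eval, Expr.eval, Store.set_apply, k2, k1, this v hv]
    · rintro j hj τ h v hv
      have := fun hv => h v hv
      simp [Stmt.eval, Expr.eval, Store.set_apply]
      intro hvj
      exact h v (by omega)
  · rw [Stmt.eval_seq, Stmt.eval_seq, Stmt.eval_seq]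
    set s : Stmt := Stmt.assign aFound (.lit 0) ;; .each aI (.set aLab (.var aI) (.lit 0)) ;;
      .set aLab (.var aRoot) (.lit 2) with hs
    have e : (Stmt.set aLab (.var aRoot) (.lit 2)).eval x
        ((Stmt.each aI (.set aLab (.var aI) (.lit 0))).eval x
        ((Stmt.assign aFound (.lit 0)).eval x σ)) = s.eval x σ := rfl
    rw [e]
    have c1 : Ctx x adj n (s.eval x σ) := hc.eval
    have k1 : s.eval x σ aRoot = σ aRoot := Stmt.eval_of_notMem_writes x (by decide) σ
    have k2 : s.eval x σ aMate = σ aMate := Stmt.eval_of_notMem_writes x (by decide) σ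
    rw [rowOf_copy c1 (by decide) (by decide) (by decide) (by decide) (by rw [k1]; exact hr), k1,
      if_pos rfl, k2]

/-- A search either finds a larger matching or shows that there is none. -/
theorem eval_searchCode (hg : IsGraphRel adj n) (hc : Ctx x adj n σ) (hr : σ aRoot 0 = r)
    (hrS : r ∉ S) (hS : insert r S ⊆ Finset.range n)
    (hact : ∀ v < n, σ aAct v ≠ 0 ↔ v ∈ insert r S) (hm : IsMatch adj S (ext n (σ aMate)))
    (hcard : (moved S (ext n (σ aMate))).card = nu adj S) (hτ : τ = searchCode.eval x σ) :
    IsMatch adj (insert r S) (ext n (τ aMate)) ∧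
      (moved (insert r S) (ext n (τ aMate))).card = nu adj (insert r S) ∧
      (τ aFound 0 ≠ 0 ↔ nu adj S < nu adj (insert r S)) := by
  have hrn : r < n := Finset.mem_range.1 (hS (Finset.mem_insert_self r S))
  obtain ⟨c1, k1, k2, k3, k4, k5⟩ := eval_searchStart hc (hr ▸ hrn) rfl
  rw [hr] at k2 k3
  have e : τ = (Stmt.each aRd roundCode).eval x
      ((Stmt.assign aFound (.lit 0) ;; .each aI (.set aLab (.var aI) (.lit 0)) ;;
      .set aLab (.var aRoot) (.lit 2) ;;
      .each aI (.set aMat (matIndex aRoot aI) (.get aMate (.var aI)))).eval x σ) := hτ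
  clear hτ
  generalize (Stmt.assign aFound (.lit 0) ;; .each aI (.set aLab (.var aI) (.lit 0)) ;;
      .set aLab (.var aRoot) (.lit 2) ;;
      .each aI (.set aMat (matIndex aRoot aI) (.get aMate (.var aI)))).eval x σ = σ' at *
  have hm' := hm.mono (Finset.subset_insert r S)
  have hcard' : (moved (insert r S) (ext n (σ aMate))).card = nu adj S := by
    rw [hm.moved_eq_of_subset (Finset.subset_insert r S), hcard]
  have k6 : ext n (σ' aMate) = ext n (σ aMate) := by rw [k5]
  generalize ext n (σ aMate) = M at *
  have hi : SearchInv adj n (insert r S) M r σ' := by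
    have e1 : outer n σ' = {r} := by
      ext v
      rw [mem_outer, Finset.mem_singleton]
      constructor
      · rintro ⟨h1, h2⟩
        rw [k2 v h1] at h2
        by_contra h
        simp [h] at h2
      · rintro rfl
        exact ⟨hrn, by rw [k2 v hrn, if_pos rfl]⟩
    have e2 : inner n σ' = ∅ := by
      refine Finset.eq_empty_of_forall_notMem fun v hv => ?_
      obtain ⟨h1, h2⟩ := mem_inner.1 hv
      rw [k2 v h1] at h2
      split_ifs at h2
      omega
    refine ⟨⟨id, id, id, ?_⟩, by rw [k2 r hrn, if_pos rfl], k3, fun v hv => ?_, fun v hv hv' => ?_,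
      by rw [k4]; exact hact, .inl ⟨k1, ?_⟩⟩
    · rw [e1, e2]
      exact .init hm.inv hm.adj (hm.out r hrS) fun v => by rw [k3]
    · rw [k2 v hv]
      split_ifs <;> omega
    · rw [k2 v hv] at hv'
      by_contra h
      have : v ≠ r := by
        rintro rfl
        exact h (Finset.mem_insert_self v S)
      simp [this] at hv'
    · exact k6
  obtain ⟨h1, h2⟩ := eval_rounds hg hS hm' hrn c1 hi
  rw [← e] at h1 h2
  rcases h1.found with ⟨f0, f1⟩ | ⟨f0, f1, f2⟩
  -- An edge to an outer vertex is done if its walk uncovers outer vertices only, so by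
  -- `blk_eq_of_walk` it lies within a class, and `BForest.nu_eq` applies.
  · have : nu adj (insert r S) = nu adj S := by
      obtain ⟨blk, c, p, hf⟩ := h1.forest
      refine hf.nu_eq hg.symm hm (mem_outer.2 ⟨hrn, h1.root⟩) h1.rootRow h1.subset
        fun a ha b hb hab => ?_
      have hbn := Finset.mem_range.1 (hS hb)
      have hd := h2 f0 a b (mem_outer.1 ha).1 ⟨(mem_outer.1 ha).2, hb, hab⟩
      by_cases hl : τ aLab b = 2
      · refine .inr ⟨mem_outer.2 ⟨hbn, hl⟩, ?_⟩
        refine hf.blk_eq_of_walk hg.symm ha (mem_outer.2 ⟨hbn, hl⟩) hab (n := n) ?_ fun i hi => ?_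
        · simpa using Finset.card_le_card (h1.subset.trans hS)
        · exact mem_outer.2 ⟨(h1.walk_lt hg.symm (mem_outer.1 ha).1 hbn (mem_outer.1 ha).2 hl hab
            (i + 1)).1, hd.walk hl i hi⟩
      · refine .inl (mem_inner.2 ⟨hbn, ?_⟩)
        have := h1.le_two b hbn
        have := hd.lab
        omega
    rw [f1, this]
    exact ⟨hm', hcard', by simp [f0]⟩
  · have h3 := f1.le_nu
    -- One augmentation is enough, since one vertex raises `nu` by at most 2.
    have h4 := @nu_insert_le adj S r
    exact ⟨f1, by omega, by simp only [ne_eq, f0, not_false_eq_true, true_iff]; omega⟩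

/-- The test decides whether the token on `Tst` is covered by all maximum matchings. -/
theorem eval_testCode (hg : IsGraphRel adj n) (hc : Ctx x adj n σ) {w : ℕ} (hw : σ aTst 0 = w)
    (hwn : w < n) (hS : ∀ v, v ∈ S ↔ v < n ∧ v ≠ w ∧ σ aRem v = 0) :
    testCode.eval x σ aFound 0 ≠ 0 ↔ gval adj S w ≠ 0 := by
  rw [gval_ne_zero_iff hg.symm fun h => ((hS w).1 h).2.1 rfl, testCode, Stmt.eval_seq,
    Stmt.eval_seq]
  set s₁ : Stmt := .each aI (.set aAct (.var aI) (.lit 0) ;; .set aMate (.var aI) (.var aI))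
    with hs₁
  have c1 : Ctx x adj n (s₁.eval x σ) := hc.eval
  have k1 : s₁.eval x σ aTst = σ aTst := Stmt.eval_of_notMem_writes x (by decide) σ
  have k2 : s₁.eval x σ aRem = σ aRem := Stmt.eval_of_notMem_writes x (by decide) σ
  have k3 : ∀ v < n, s₁.eval x σ aAct v = 0 ∧ s₁.eval x σ aMate v = v := by
    rw [eval_each _ _ hc]
    refine forLoop_induction (fun j (τ : Store) => ∀ v < j, τ aAct v = 0 ∧ τ aMate v = v) (by simp) ?_
    rintro j hj τ h v hv
    rcases Nat.lt_succ_iff_lt_or_eq.1 hv with hv | rfl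
    · simp [Stmt.eval, Expr.eval, Store.set_apply, h v hv, Nat.ne_of_lt hv]
    · simp [Stmt.eval, Expr.eval, Store.set_apply]
  generalize s₁.eval x σ = σ₁ at *
  rw [eval_each _ _ c1]
  -- After `j` rounds `aMate` is a maximum matching of the part of `S` below `j`.
  have key := forLoop_induction (f := fun j τ => addVertex.eval x (τ.set aV 0 j)) (n := n)
    (a := σ₁) (fun j τ => Ctx x adj n τ ∧ τ aTst = σ aTst ∧ τ aRem = σ aRem ∧
      (∀ v < n, τ aAct v ≠ 0 ↔ v ∈ S.filter (· < j)) ∧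
      IsMatch adj (S.filter (· < j)) (ext n (τ aMate)) ∧
      (moved (S.filter (· < j)) (ext n (τ aMate))).card = nu adj (S.filter (· < j)))
    ⟨c1, k1, k2, ?_⟩ ?_
  · obtain ⟨c2, l1, l2, l3, l4, l5⟩ := key
    generalize forLoop (fun j τ => addVertex.eval x (τ.set aV 0 j)) n σ₁ = σ₂ at *
    have e : S.filter (· < n) = S := Finset.filter_true_of_mem fun v hv => ((hS v).1 hv).1
    rw [e] at l3 l4 l5
    have e1 : ∀ s : Stmt, (Stmt.set aAct (.var aTst) (.lit 1) ;; .assign aRoot (.var aTst) ;;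
        s).eval x σ₂ = s.eval x ((σ₂.set aAct w 1).set aRoot 0 w) := by
      intro s
      simp [Stmt.eval, Expr.eval, Store.set_apply, l1, hw]
    rw [e1]
    -- The token is added last, and its search succeeds exactly if it raises the matching number.
    refine (eval_searchCode hg (c2.of_eq ?_ ?_ ?_) (by simp [Store.set_apply])
      (fun h => ((hS w).1 h).2.1 rfl) ?_ ?_ ?_ ?_ rfl).2.2
    · simp [Store.set_of_ne]
    · simp [Store.set_of_ne]
    · simp [Store.set_of_ne]
    · intro v hv
      rcases Finset.mem_insert.1 hv with rfl | hv
      exacts [Finset.mem_range.2 hwn, Finset.mem_range.2 ((hS v).1 hv).1]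
    · intro v hv
      have := l3 v hv
      simp [Store.set_apply]
      by_cases h : v = w
      · simp [h]
      · simpa [h] using this
    · simpa [Store.set_of_ne] using l4
    · simpa [Store.set_of_ne] using l5
  · have e : S.filter (· < 0) = ∅ := by simp
    have e1 : ext n (σ₁ aMate) = fun v => v := by
      funext v
      unfold ext
      split_ifs with h
      exacts [(k3 v h).2, rfl]
    have h1 := IsMatch.id adj ∅
    rw [e, e1]
    refine ⟨fun v hv => by simp [(k3 v hv).1], h1, ?_⟩
    rw [nu_empty]
    simp [moved]
  · rintro j hj τ ⟨c2, l1, l2, l3, l4, l5⟩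
    have e1 : τ.set aV 0 j aV 0 = j := by simp [Store.set_apply]
    have e2 : ∀ k, k ≠ aV → τ.set aV 0 j k = τ k := fun k hk => Store.set_of_ne _ _ _ hk
    replace l1 := (e2 aTst (by decide)).trans l1
    replace l2 := (e2 aRem (by decide)).trans l2
    rw [← e2 aAct (by decide)] at l3
    rw [← e2 aMate (by decide)] at l4 l5
    have c3 : Ctx x adj n (τ.set aV 0 j) :=
      c2.of_eq (e2 _ (by decide)) (e2 _ (by decide)) (e2 _ (by decide))
    generalize τ.set aV 0 j = σ₂ at *
    have hskip : j ∉ S → S.filter (· < j + 1) = S.filter (· < j) := by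
      intro h
      refine Finset.filter_congr fun v hv => ⟨fun h' => ?_, fun h' => by omega⟩
      rcases Nat.lt_succ_iff_lt_or_eq.1 h' with h' | rfl
      exacts [h', absurd hv h]
    refine ⟨c3.eval, ?_, ?_, ?_⟩
    · rw [Stmt.eval_of_notMem_writes x (by decide), l1]
    · rw [Stmt.eval_of_notMem_writes x (by decide), l2]
    rw [addVertex]
    by_cases h1 : σ aRem j = 0
    swap
    · rw [Stmt.eval_ite_ne (e := .get aRem (.var aV)) (by simpa [Expr.eval, e1, l2] using h1),
        hskip fun h => h1 ((hS j).1 h).2.2]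
      exact ⟨l3, l4, l5⟩
    rw [Stmt.eval_ite_zero (e := .get aRem (.var aV)) (by simpa [Expr.eval, e1, l2] using h1)]
    by_cases h2 : j = w
    · rw [Stmt.eval_ite_zero (e := .dist (.var aV) (.var aTst))
          ((eval_dist _ _).2 (by simp [Expr.eval, e1, l1, hw, h2])),
        hskip fun h => ((hS j).1 h).2.1 h2]
      exact ⟨l3, l4, l5⟩
    rw [Stmt.eval_ite_ne (e := .dist (.var aV) (.var aTst))
      fun h => h2 (by simpa [Expr.eval, e1, l1, hw] using (eval_dist _ _).1 h)]
    have hjS : j ∈ S := (hS j).2 ⟨hj, h2, h1⟩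
    have e3 : S.filter (· < j + 1) = insert j (S.filter (· < j)) := by
      ext v
      simp only [Finset.mem_filter, Finset.mem_insert, Nat.lt_succ_iff_lt_or_eq]
      constructor
      · rintro ⟨h, h' | h'⟩
        exacts [.inr ⟨h, h'⟩, .inl h']
      · rintro (rfl | ⟨h, h'⟩)
        exacts [⟨hjS, .inr rfl⟩, ⟨h, .inl h'⟩]
    have e4 : (Stmt.set aAct (.var aV) (.lit 1) ;; .assign aRoot (.var aV) ;;
        searchCode).eval x σ₂ = searchCode.eval x ((σ₂.set aAct j 1).set aRoot 0 j) := by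
      simp [Stmt.eval, Expr.eval, Store.set_apply, e1]
    have hact : ∀ v < n, (σ₂.set aAct j 1).set aRoot 0 j aAct v ≠ 0 ↔
        v ∈ insert j (S.filter (· < j)) := by
      intro v hv
      have := l3 v hv
      simp [Store.set_apply]
      by_cases h : v = j
      · simp [h]
      · simpa [h] using this
    have hsub : insert j (S.filter (· < j)) ⊆ Finset.range n := by
      intro v hv
      rcases Finset.mem_insert.1 hv with rfl | hv
      exacts [Finset.mem_range.2 hj, Finset.mem_range.2 ((hS v).1 (Finset.mem_filter.1 hv).1).1]
    rw [e4, e3]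
    obtain ⟨r1, r2, -⟩ := eval_searchCode hg (c3.of_eq (by simp [Store.set_of_ne])
      (by simp [Store.set_of_ne]) (by simp [Store.set_of_ne]))
      (σ := (σ₂.set aAct j 1).set aRoot 0 j) (r := j) (S := S.filter (· < j))
      (by simp [Store.set_apply]) (by simp) hsub hact (by simpa [Store.set_of_ne] using l4)
      (by simpa [Store.set_of_ne] using l5) rfl
    refine ⟨?_, r1, r2⟩
    rw [Stmt.eval_of_notMem_writes x (by decide)]
    exact hact

end Imp

/-! ### The play that tells the values one and two apart. -/

namespace Imp

variable {x : List ℕ} {adj : ℕ → ℕ → Prop} {n : ℕ} {S : Finset ℕ} {r : ℕ} {σ τ : Store}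

/-- The search for a winning option. -/
theorem eval_probes (hg : IsGraphRel adj n) (hc : Ctx x adj n σ) {t : ℕ} (ht : σ aTok 0 = t)
    (htn : t < n) (hS : ∀ v, v ∈ S ↔ v < n ∧ σ aRem v = 0)
    (hτ : τ = (Stmt.assign aNxt (.var aNum) ;; .each aQ probeCode).eval x σ) :
    (τ aNxt 0 = n ∧ ∀ w ∈ S, adj t w → gval adj (S.erase w) w = 0) ∨
      ∃ w ∈ S, adj t w ∧ gval adj (S.erase w) w ≠ 0 ∧ τ aNxt 0 = w := by
  rw [Stmt.eval_seq] at hτ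
  have k0 : (Stmt.assign aNxt (.var aNum)).eval x σ aNxt 0 = n := by
    simp [Stmt.eval, Expr.eval, Store.set_apply, hc.num]
  have c1 : Ctx x adj n ((Stmt.assign aNxt (.var aNum)).eval x σ) := hc.eval
  have k1 : (Stmt.assign aNxt (.var aNum)).eval x σ aTok = σ aTok :=
    Stmt.eval_of_notMem_writes x (by decide) σ
  have k2 : (Stmt.assign aNxt (.var aNum)).eval x σ aRem = σ aRem :=
    Stmt.eval_of_notMem_writes x (by decide) σ
  generalize (Stmt.assign aNxt (.var aNum)).eval x σ = σ₁ at *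
  rw [eval_each _ _ c1] at hτ
  subst hτ
  have := forLoop_induction (f := fun j τ => probeCode.eval x (τ.set aQ 0 j)) (n := n)
    (a := σ₁) (fun j τ => Ctx x adj n τ ∧ τ aTok = σ aTok ∧ τ aRem = σ aRem ∧
      ((τ aNxt 0 = n ∧ ∀ w ∈ S, w < j → adj t w → gval adj (S.erase w) w = 0) ∨
      ∃ w ∈ S, adj t w ∧ gval adj (S.erase w) w ≠ 0 ∧ τ aNxt 0 = w))
    ⟨c1, k1, k2, .inl ⟨k0, by simp⟩⟩ ?_
  · exact this.2.2.2.imp_left fun ⟨h1, h2⟩ => ⟨h1, fun w hw => h2 w hw ((hS w).1 hw).1⟩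
  rintro j hj τ ⟨c2, l1, l2, l3⟩
  have e1 : τ.set aQ 0 j aQ 0 = j := by simp [Store.set_apply]
  have e2 : ∀ k, k ≠ aQ → τ.set aQ 0 j k = τ k := fun k hk => Store.set_of_ne _ _ _ hk
  replace l1 := (e2 aTok (by decide)).trans l1
  replace l2 := (e2 aRem (by decide)).trans l2
  rw [← e2 aNxt (by decide)] at l3
  have c3 : Ctx x adj n (τ.set aQ 0 j) :=
    c2.of_eq (e2 _ (by decide)) (e2 _ (by decide)) (e2 _ (by decide))
  generalize τ.set aQ 0 j = σ₂ at *
  refine ⟨c3.eval, ?_, ?_, ?_⟩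
  · rw [Stmt.eval_of_notMem_writes x (by decide), l1]
  · rw [Stmt.eval_of_notMem_writes x (by decide), l2]
  have ht2 : σ₂ aTok 0 = t := by rw [l1, ht]
  have hstep : (j ∈ S → adj t j → gval adj (S.erase j) j = 0) →
      ((σ₂ aNxt 0 = n ∧ ∀ w ∈ S, w < j + 1 → adj t w → gval adj (S.erase w) w = 0) ∨
      ∃ w ∈ S, adj t w ∧ gval adj (S.erase w) w ≠ 0 ∧ σ₂ aNxt 0 = w) := by
    intro h
    refine l3.imp_left fun ⟨h1, h2⟩ => ⟨h1, fun w hw hwj => ?_⟩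
    rcases Nat.lt_succ_iff_lt_or_eq.1 hwj with hwj | rfl
    exacts [h2 w hw hwj, h hw]
  rw [probeCode]
  by_cases h1 : adj t j
  swap
  · rw [Stmt.eval_ite_zero (e := adjEntry aTok aQ) ((eval_adjEntry c3 (by rw [ht2]; exact htn)
      (by rw [e1]; exact hj)).2 (by rwa [ht2, e1]))]
    exact hstep fun _ h => absurd h h1
  rw [Stmt.eval_ite_ne (e := adjEntry aTok aQ) fun h => (eval_adjEntry c3 (by rw [ht2]; exact htn)
      (by rw [e1]; exact hj)).1 h (by rwa [ht2, e1])]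
  by_cases h2 : σ aRem j = 0
  swap
  · rw [Stmt.eval_ite_ne (e := .get aRem (.var aQ)) (by simpa [Expr.eval, e1, l2] using h2)]
    exact hstep fun h _ => absurd ((hS j).1 h).2 h2
  rw [Stmt.eval_ite_zero (e := .get aRem (.var aQ)) (by simpa [Expr.eval, e1, l2] using h2)]
  have e3 : (Stmt.assign aTst (.var aQ)).eval x σ₂ = σ₂.set aTst 0 j := by
    simp [Stmt.eval, Expr.eval, e1]
  rw [Stmt.eval_seq, Stmt.eval_seq, e3]
  have htest := eval_testCode (x := x) (σ := σ₂.set aTst 0 j) (S := S.erase j) hg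
    (c3.of_eq (Store.set_of_ne _ _ _ (by decide)) (Store.set_of_ne _ _ _ (by decide))
    (Store.set_of_ne _ _ _ (by decide))) (w := j) (by simp [Store.set_apply]) hj (fun v => by
      rw [Finset.mem_erase, hS, Store.set_of_ne _ _ _ (by decide), l2]
      tauto)
  have f1 : testCode.eval x (σ₂.set aTst 0 j) aQ 0 = j := by
    rw [Stmt.eval_of_notMem_writes x (by decide), Store.set_of_ne _ _ _ (by decide), e1]
  have f2 : testCode.eval x (σ₂.set aTst 0 j) aNxt = σ₂ aNxt := by
    rw [Stmt.eval_of_notMem_writes x (by decide), Store.set_of_ne _ _ _ (by decide)]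
  generalize testCode.eval x (σ₂.set aTst 0 j) = σ₃ at *
  by_cases h3 : σ₃ aFound 0 = 0
  · rw [Stmt.eval_ite_zero (e := .var aFound) h3, Stmt.eval, f2]
    exact hstep fun _ _ => by
      by_contra h
      exact htest.2 h h3
  · rw [Stmt.eval_ite_ne (e := .var aFound) h3]
    exact .inr ⟨j, (hS j).2 ⟨hj, h2⟩, h1, htest.1 h3, by
      simp [Stmt.eval, Expr.eval, Store.set_apply, f1]⟩

-- The vertex `u`, from which the token came, is a neighbour that is no longer present and takes up
-- one of the three places.
open Classical in
theorem card_filter_adj_le (hd : ∀ v, ((Finset.range n).filter (adj v)).card ≤ 3)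
    (hS : S ⊆ Finset.range n) {u v : ℕ} (hu : u < n) (huS : u ∉ S) (huv : adj v u) :
    (S.filter (adj v)).card ≤ 2 := by
  have h : insert u (S.filter (adj v)) ⊆ (Finset.range n).filter (adj v) := by
    intro w hw
    rw [Finset.mem_filter, Finset.mem_range]
    rcases Finset.mem_insert.1 hw with rfl | hw
    · exact ⟨hu, huv⟩
    · rw [Finset.mem_filter] at hw
      exact ⟨Finset.mem_range.1 (hS hw.1), hw.2⟩
  have := (Finset.card_le_card h).trans (hd v)
  rw [Finset.card_insert_of_notMem fun h => huS (Finset.mem_filter.1 h).1] at this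
  omega

/-- The invariant in the play of a position of value `g` along positions that are not terminal,
with the token on `Tok` and the other vertices in `S`. -/
structure ChainInv (x : List ℕ) (adj : ℕ → ℕ → Prop) (n g : ℕ) (σ : Store) (S : Finset ℕ) :
    Prop where
  ctx : Ctx x adj n σ
  lt : σ aTok 0 < n
  mem : ∀ v, v ∈ S ↔ v < n ∧ v ≠ σ aTok 0 ∧ σ aRem v = 0
  ne : gval adj S (σ aTok 0) ≠ 0
  prev : ∃ u < n, u ∉ S ∧ adj (σ aTok 0) u
  -- The two cases belong to an even and an odd number of moves made so far.
  val : (σ aVal 0 = 1 ∧ g = gval adj S (σ aTok 0)) ∨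
    (σ aVal 0 = 2 ∧ g + gval adj S (σ aTok 0) = 3)

theorem ChainInv.of_eq {g : ℕ} (h : ChainInv x adj n g σ S)
    (he : ∀ k : Fin 63, k ∈ [aNum, aRow, aOff, aTok, aRem, aVal] → τ k = σ k) :
    ChainInv x adj n g τ S := by
  have e1 := he aTok (by decide)
  have e2 := he aRem (by decide)
  have e3 := he aVal (by decide)
  obtain ⟨h1, h2, h3, h4, h5, h6⟩ := h
  exact ⟨h1.of_eq (he _ (by decide)) (he _ (by decide)) (he _ (by decide)), by rwa [e1],
    by rwa [e1, e2], by rwa [e1], by rwa [e1], by rwa [e1, e3]⟩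

open Classical in
theorem eval_chainStep (hg : IsGraphRel adj n)
    (hd : ∀ v, ((Finset.range n).filter (adj v)).card ≤ 3) {g : ℕ} (h : ChainInv x adj n g σ S) :
    (ChainInv x adj n g (chainStep.eval x σ) S ∧
      ∀ w ∈ S, adj (chainStep.eval x σ aTok 0) w → gval adj (S.erase w) w = 0) ∨
    ∃ w ∈ S, adj (σ aTok 0) w ∧ gval adj (S.erase w) w ≠ 0 ∧
      ChainInv x adj n g (chainStep.eval x σ) (S.erase w) := by
  have e1 : chainStep.eval x σ = (Stmt.ite (.dist (.var aNxt) (.var aNum))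
      (.assign aVal (.sub (.lit 3) (.var aVal)) ;; .assign aTok (.var aNxt)) .skip).eval x
      ((Stmt.assign aNxt (.var aNum) ;; .each aQ probeCode).eval x
        (σ.set aRem (σ aTok 0) 1)) := rfl
  have e2 : ∀ k, k ≠ aRem → σ.set aRem (σ aTok 0) 1 k = σ k := fun k hk => Store.set_of_ne _ _ _ hk
  have e3 : ∀ v, v ∈ S ↔ v < n ∧ σ.set aRem (σ aTok 0) 1 aRem v = 0 := by
    intro v
    rw [h.mem, Store.set_apply]
    by_cases hv : v = σ aTok 0 <;> simp [hv]
  rw [e1]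
  have c1 : Ctx x adj n (σ.set aRem (σ aTok 0) 1) :=
    h.ctx.of_eq (e2 _ (by decide)) (e2 _ (by decide)) (e2 _ (by decide))
  have k1 := e2 aTok (by decide)
  have k2 := e2 aVal (by decide)
  generalize σ.set aRem (σ aTok 0) 1 = σ₁ at *
  have hp := eval_probes (t := σ aTok 0) hg c1 (by rw [k1]) h.lt e3 rfl
  have f : ∀ k, k ∉ (Stmt.assign aNxt (.var aNum) ;; .each aQ probeCode).writes →
      (Stmt.assign aNxt (.var aNum) ;; .each aQ probeCode).eval x σ₁ k = σ₁ k := fun k hk =>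
    Stmt.eval_of_notMem_writes x hk σ₁
  have c2 : Ctx x adj n ((Stmt.assign aNxt (.var aNum) ;; .each aQ probeCode).eval x σ₁) := c1.eval
  replace k1 := (f aTok (by decide)).trans k1
  replace k2 := (f aVal (by decide)).trans k2
  rw [← f aRem (by decide)] at e3
  generalize (Stmt.assign aNxt (.var aNum) ;; .each aQ probeCode).eval x σ₁ = σ₂ at *
  have htS : σ aTok 0 ∉ S := fun h' => ((h.mem _).1 h').2.1 rfl
  have hSn : S ⊆ Finset.range n := fun v hv => Finset.mem_range.2 ((h.mem v).1 hv).1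
  rcases hp with ⟨h1, h2⟩ | ⟨w, hw, h1, h2, h3⟩
  · rw [Stmt.eval_ite_zero (e := .dist (.var aNxt) (.var aNum))
      ((eval_dist _ _).2 (by simp [Expr.eval, h1, c2.num])), Stmt.eval, k1]
    refine .inl ⟨⟨c2, by rw [k1]; exact h.lt, fun v => ?_, by rw [k1]; exact h.ne,
      by rw [k1]; exact h.prev, by rw [k1, k2]; exact h.val⟩, h2⟩
    -- The token is now marked in `aRem` although it stays; `ChainInv.mem` excludes the token
    -- separately and is not affected.
    rw [k1, e3]
    have : v ∈ S → v ≠ σ aTok 0 := fun hv => ((h.mem v).1 hv).2.1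
    rw [e3] at this
    tauto
  · have hwn := Finset.mem_range.1 (hSn hw)
    rw [Stmt.eval_ite_ne (e := .dist (.var aNxt) (.var aNum)) (fun h => by
      have := (eval_dist _ _).1 h
      simp [Expr.eval, h3, c2.num] at this
      omega)]
    have e4 : (Stmt.assign aVal (.sub (.lit 3) (.var aVal)) ;; .assign aTok (.var aNxt)).eval x
        σ₂ = (σ₂.set aVal 0 (3 - σ aVal 0)).set aTok 0 w := by
      simp [Stmt.eval, Expr.eval, Store.set_apply, k2, h3]
    have eT : (σ₂.set aVal 0 (3 - σ aVal 0)).set aTok 0 w aTok 0 = w := by simp [Store.set_apply]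
    have eV : (σ₂.set aVal 0 (3 - σ aVal 0)).set aTok 0 w aVal 0 = 3 - σ aVal 0 := by
      simp [Store.set_apply]
    have eR : (σ₂.set aVal 0 (3 - σ aVal 0)).set aTok 0 w aRem = σ₂ aRem := by
      simp [Store.set_of_ne]
    rw [e4]
    refine .inr ⟨w, hw, h1, h2, c2.of_eq ?_ ?_ ?_, by rwa [eT], fun v => ?_, by rwa [eT], ?_, ?_⟩
    · simp [Store.set_of_ne]
    · simp [Store.set_of_ne]
    · simp [Store.set_of_ne]
    · rw [eT, eR, Finset.mem_erase, e3]
      tauto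
    · rw [eT]
      exact ⟨_, h.lt, fun h => htS (Finset.mem_of_mem_erase h), hg.symm h1⟩
    · obtain ⟨u, hu, huS, hut⟩ := h.prev
      have := gval_add_gval h.ne (card_filter_adj_le hd hSn hu huS hut) hw h1 h2
        (card_filter_adj_le hd ((S.erase_subset w).trans hSn) h.lt
          (fun h => htS (Finset.mem_of_mem_erase h)) (hg.symm h1))
      rw [eT, eV]
      have := h.val
      omega

open Classical in
/-- The play ends at a position of value `1`. -/
theorem eval_chain (hg : IsGraphRel adj n)
    (hd : ∀ v, ((Finset.range n).filter (adj v)).card ≤ 3) {g : ℕ}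
    (h : ChainInv x adj n g σ S) : (Stmt.each aC chainStep).eval x σ aVal 0 = g := by
  rw [eval_each _ _ h.ctx]
  -- Every move deletes a vertex, so within `n` rounds the token comes to a position without options
  -- of nonzero value, and there it stays.
  have key := forLoop_induction (f := fun j τ => chainStep.eval x (τ.set aC 0 j))
    (n := n) (a := σ) (fun j τ => ∃ S', ChainInv x adj n g τ S' ∧
      (S'.card + j < n ∨ ∀ w ∈ S', adj (τ aTok 0) w → gval adj (S'.erase w) w = 0))
    ⟨S, h, .inl ?_⟩ ?_
  · obtain ⟨S', h1, h2⟩ := key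
    have := gval_eq_one h1.ne (h2.resolve_left (by omega))
    have := h1.val
    omega
  · have : S ⊂ Finset.range n := by
      refine ⟨fun v hv => Finset.mem_range.2 ((h.mem v).1 hv).1, fun h' => ?_⟩
      exact ((h.mem _).1 (h' (Finset.mem_range.2 h.lt))).2.1 rfl
    simpa using Finset.card_lt_card this
  · rintro j hj τ ⟨S', h1, h2⟩
    have h3 : ChainInv x adj n g (τ.set aC 0 j) S' := h1.of_eq fun k hk =>
      Store.set_of_ne _ _ _ (by rintro rfl; revert hk; decide)
    have e1 : τ.set aC 0 j aTok = τ aTok := Store.set_of_ne _ _ _ (by decide)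
    rcases eval_chainStep hg hd h3 with ⟨h4, h5⟩ | ⟨w, hw, h5, h6, h4⟩
    · exact ⟨S', h4, .inr h5⟩
    · refine ⟨_, h4, ?_⟩
      rcases h2 with h2 | h2
      · rw [Finset.card_erase_of_mem hw]
        have := Finset.card_pos.2 ⟨w, hw⟩
        exact .inl (by omega)
      · exact absurd (h2 w hw (e1 ▸ h5)) h6

end Imp

/-! ### The values of the options and of a whole component. -/

namespace Imp

variable {x : List ℕ} {adj : ℕ → ℕ → Prop} {n : ℕ} {S : Finset ℕ} {s o : ℕ} {σ τ : Store}

/-- The value of the position after the token has been moved from `s` to `o`. -/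
noncomputable def optVal (adj : ℕ → ℕ → Prop) (n s o : ℕ) : ℕ :=
  gval adj (((Finset.range n).erase s).erase o) o

open Classical in
theorem eval_optionCode (hg : IsGraphRel adj n)
    (hd : ∀ v, ((Finset.range n).filter (adj v)).card ≤ 3) (hc : Ctx x adj n σ)
    (hs : σ aStart 0 = s) (ho : σ aOpt 0 = o) (hso : adj s o) :
    optionCode.eval x σ aVal 0 = optVal adj n s o := by
  have hsn := hg.lt hso
  have hon := hg.lt (hg.symm hso)
  set s₀ : Stmt := .each aI (.set aRem (.var aI) (.lit 0)) with hs₀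
  have e0 : optionCode.eval x σ = (Stmt.ite (.var aFound)
      (.assign aVal (.lit 1) ;; .assign aTok (.var aOpt) ;; .each aC chainStep)
      (.assign aVal (.lit 0))).eval x (testCode.eval x ((Stmt.assign aTst (.var aOpt)).eval x
        ((Stmt.set aRem (.var aStart) (.lit 1)).eval x (s₀.eval x σ)))) := rfl
  rw [e0]
  have c1 : Ctx x adj n (s₀.eval x σ) := hc.eval
  have k1 : s₀.eval x σ aStart = σ aStart := Stmt.eval_of_notMem_writes x (by decide) σ
  have k2 : s₀.eval x σ aOpt = σ aOpt := Stmt.eval_of_notMem_writes x (by decide) σ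
  have k3 : ∀ v < n, s₀.eval x σ aRem v = 0 := by
    rw [eval_each _ _ hc]
    refine forLoop_induction (fun j (τ : Store) => ∀ v < j, τ aRem v = 0) (by simp) ?_
    rintro j hj τ h v hv
    rcases Nat.lt_succ_iff_lt_or_eq.1 hv with hv | rfl
    · simp [Stmt.eval, Expr.eval, Store.set_apply, h v hv]
    · simp [Stmt.eval, Expr.eval, Store.set_apply]
  generalize s₀.eval x σ = σ₁ at *
  have e1 : (Stmt.assign aTst (.var aOpt)).eval x
      ((Stmt.set aRem (.var aStart) (.lit 1)).eval x σ₁) =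
      (σ₁.set aRem s 1).set aTst 0 o := by
    simp [Stmt.eval, Expr.eval, Store.set_apply, k1, k2, hs, ho]
  rw [e1]
  have c2 : Ctx x adj n ((σ₁.set aRem s 1).set aTst 0 o) :=
    c1.of_eq (by simp [Store.set_of_ne]) (by simp [Store.set_of_ne]) (by simp [Store.set_of_ne])
  have l1 : (σ₁.set aRem s 1).set aTst 0 o aTst 0 = o := by simp [Store.set_apply]
  have l2 : (σ₁.set aRem s 1).set aTst 0 o aOpt 0 = o := by simp [Store.set_apply, k2, ho]
  have l3 : ∀ v, v ∈ ((Finset.range n).erase s).erase o ↔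
      v < n ∧ v ≠ o ∧ (σ₁.set aRem s 1).set aTst 0 o aRem v = 0 := by
    intro v
    simp [Store.set_apply]
    by_cases hv : v = s
    · simp [hv]
    · simp only [hv, if_false]
      have := k3 v
      tauto
  generalize (σ₁.set aRem s 1).set aTst 0 o = σ₂ at *
  have htest := eval_testCode hg c2 l1 hon l3
  have c3 : Ctx x adj n (testCode.eval x σ₂) := c2.eval
  have f : ∀ k, k ∉ testCode.writes → testCode.eval x σ₂ k = σ₂ k := fun k hk =>
    Stmt.eval_of_notMem_writes x hk σ₂
  rw [← f aOpt (by decide)] at l2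
  rw [← f aRem (by decide)] at l3
  generalize testCode.eval x σ₂ = σ₃ at *
  rw [optVal]
  by_cases h0 : σ₃ aFound 0 = 0
  · rw [Stmt.eval_ite_zero (e := .var aFound) h0]
    have : gval adj (((Finset.range n).erase s).erase o) o = 0 := by
      by_contra h
      exact htest.2 h h0
    simp [Stmt.eval, Expr.eval, Store.set_apply, this]
  · rw [Stmt.eval_ite_ne (e := .var aFound) h0]
    have e2 : (Stmt.assign aVal (.lit 1) ;; .assign aTok (.var aOpt) ;; .each aC chainStep).eval x
        σ₃ = (Stmt.each aC chainStep).eval x ((σ₃.set aVal 0 1).set aTok 0 o) := by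
      rw [Stmt.eval_seq, Stmt.eval_seq]
      congr 1
      simp [Stmt.eval, Expr.eval, Store.set_apply, l2]
    rw [e2]
    have eT : (σ₃.set aVal 0 1).set aTok 0 o aTok 0 = o := by simp [Store.set_apply]
    refine eval_chain (S := ((Finset.range n).erase s).erase o) hg hd ⟨c3.of_eq ?_ ?_ ?_, by rwa [eT], fun v => ?_, ?_, ?_, ?_⟩
    · simp [Store.set_of_ne]
    · simp [Store.set_of_ne]
    · simp [Store.set_of_ne]
    · rw [l3, eT]
      simp [Store.set_of_ne]
    · rw [eT]
      exact htest.1 h0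
    · rw [eT]
      exact ⟨s, hsn, by simp, hg.symm hso⟩
    · rw [eT]
      simp [Store.set_apply]

theorem eval_rowsCode (hn : σ aNum 0 = n) :
    (∀ u < n, rowsCode.eval x σ aRow u = u * n) ∧ rowsCode.eval x σ aSq 0 = n * n := by
  have e : rowsCode.eval x σ = forLoop (fun j τ => (Stmt.set aRow (.var aI) (.var aSq) ;;
      .assign aSq (.add (.var aSq) (.var aNum))).eval x (τ.set aI 0 j)) n (σ.set aSq 0 0) := by
    simp only [rowsCode, Stmt.eval, Expr.eval]
    rw [Store.set_of_ne _ _ _ (by decide), hn]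
  rw [e]
  refine (forLoop_induction (fun j (τ : Store) => τ aNum 0 = n ∧ (∀ u < j, τ aRow u = u * n) ∧
    τ aSq 0 = j * n) ⟨?_, by simp, ?_⟩ ?_).2
  · rwa [Store.set_of_ne _ _ _ (by decide)]
  · simp [Store.set_apply]
  · rintro j hj τ ⟨h1, h2, h3⟩
    refine ⟨?_, fun u hu => ?_, ?_⟩
    · simpa [Stmt.eval, Expr.eval, Store.set_apply] using h1
    · rcases Nat.lt_succ_iff_lt_or_eq.1 hu with hu | rfl
      · simp [Stmt.eval, Expr.eval, Store.set_apply, h2 u hu, Nat.ne_of_lt hu]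
      · simp [Stmt.eval, Expr.eval, Store.set_apply, h3]
    · simp [Stmt.eval, Expr.eval, Store.set_apply, h1, h3, Nat.succ_mul]

open Classical in
/-- The options of the current component and their values. -/
theorem eval_options (hg : IsGraphRel adj n)
    (hd : ∀ v, ((Finset.range n).filter (adj v)).card ≤ 3) (hc : Ctx x adj n σ)
    (hs : σ aStart 0 = s) (hsn : s < n) (h0 : ∀ i ≤ 2, σ aFlag i = 0)
    (hτ : τ = (Stmt.each aOpt optionStep).eval x σ) :
    (∀ v < n, adj s v → τ aH v = optVal adj n s v) ∧
      ∀ i ≤ 2, τ aFlag i ≠ 0 ↔ ∃ v < n, adj s v ∧ optVal adj n s v = i := by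
  rw [eval_each _ _ hc] at hτ
  subst hτ
  refine (forLoop_induction (fun j (τ : Store) => Ctx x adj n τ ∧ τ aStart 0 = s ∧
    (∀ v < j, adj s v → τ aH v = optVal adj n s v) ∧
      ∀ i ≤ 2, τ aFlag i ≠ 0 ↔ ∃ v < j, adj s v ∧ optVal adj n s v = i)
    ⟨hc, hs, by simp, fun i hi => by simp [h0 i hi]⟩ ?_).2.2
  rintro j hj τ ⟨c1, k1, k2, k3⟩
  have e1 : τ.set aOpt 0 j aOpt 0 = j := by simp [Store.set_apply]
  have e2 : ∀ k, k ≠ aOpt → τ.set aOpt 0 j k = τ k := fun k hk => Store.set_of_ne _ _ _ hk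
  rw [← e2 aStart (by decide)] at k1
  rw [← e2 aH (by decide)] at k2
  rw [← e2 aFlag (by decide)] at k3
  have c2 : Ctx x adj n (τ.set aOpt 0 j) :=
    c1.of_eq (e2 _ (by decide)) (e2 _ (by decide)) (e2 _ (by decide))
  generalize τ.set aOpt 0 j = σ₂ at *
  refine ⟨c2.eval, by rw [Stmt.eval_of_notMem_writes x (by decide), k1], ?_⟩
  rw [optionStep]
  have hadj := eval_adjEntry c2 (u := aStart) (v := aOpt) (by rwa [k1]) (by rwa [e1])
  rw [k1, e1] at hadj
  by_cases h1 : adj s j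
  swap
  · rw [Stmt.eval_ite_zero (e := adjEntry aStart aOpt) (hadj.2 h1), Stmt.eval]
    have h2 : ∀ {v}, adj s v → v < j + 1 → v < j := by
      rintro v hv hvj
      rcases Nat.lt_succ_iff_lt_or_eq.1 hvj with h | rfl
      exacts [h, absurd hv h1]
    refine ⟨fun v hv hsv => k2 v (h2 hsv hv) hsv, fun i hi => (k3 i hi).trans ?_⟩
    exact ⟨fun ⟨v, h, h', h''⟩ => ⟨v, by omega, h', h''⟩,
      fun ⟨v, h, h', h''⟩ => ⟨v, h2 h' h, h', h''⟩⟩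
  rw [Stmt.eval_ite_ne (e := adjEntry aStart aOpt) fun h => hadj.1 h h1, Stmt.eval_seq]
  have hv := eval_optionCode hg hd c2 k1 e1 h1
  have f : ∀ k, k ∉ optionCode.writes → optionCode.eval x σ₂ k = σ₂ k := fun k hk =>
    Stmt.eval_of_notMem_writes x hk σ₂
  rw [← f aH (by decide)] at k2
  rw [← f aFlag (by decide)] at k3
  rw [← f aOpt (by decide)] at e1
  generalize optionCode.eval x σ₂ = σ₃ at *
  refine ⟨fun v hvj hsv => ?_, fun i hi => ?_⟩
  · rcases Nat.lt_succ_iff_lt_or_eq.1 hvj with hvj | rfl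
    · simp [Stmt.eval, Expr.eval, Store.set_apply, e1, Nat.ne_of_lt hvj, k2 v hvj hsv]
    · simp [Stmt.eval, Expr.eval, Store.set_apply, e1, hv]
  · have : (Stmt.set aH (.var aOpt) (.var aVal) ;; .set aFlag (.var aVal) (.lit 1)).eval x σ₃
        aFlag i = if i = optVal adj n s j then 1 else σ₃ aFlag i := by
      simp [Stmt.eval, Expr.eval, Store.set_apply, hv]
    rw [this]
    split_ifs with h
    · simp only [ne_eq, one_ne_zero, not_false_eq_true, true_iff]
      exact ⟨j, by omega, h1, h.symm⟩
    · rw [k3 i hi]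
      constructor
      · rintro ⟨v, h, h', h''⟩
        exact ⟨v, by omega, h', h''⟩
      · rintro ⟨v, hvj, h', h''⟩
        rcases Nat.lt_succ_iff_lt_or_eq.1 hvj with hvj | rfl
        exacts [⟨v, hvj, h', h''⟩, absurd h''.symm h]

/-- The effect of the treatment of a component. -/
structure ComponentInv (x : List ℕ) (adj : ℕ → ℕ → Prop) (n s : ℕ) (σ : Store) : Prop where
  ctx : Ctx x adj n σ
  start : σ aStart 0 = s
  sq : σ aSq 0 = n * n
  opt : ∀ v < n, adj s v → σ aH v = optVal adj n s v
  grd : σ aGrd 0 = gval adj ((Finset.range n).erase s) s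

theorem ComponentInv.of_eq (h : ComponentInv x adj n s σ)
    (he : ∀ k : Fin 63, k ∈ [aNum, aRow, aOff, aStart, aSq, aH, aGrd] → τ k = σ k) :
    ComponentInv x adj n s τ := by
  have e1 := he aStart (by decide)
  have e2 := he aSq (by decide)
  have e3 := he aH (by decide)
  have e4 := he aGrd (by decide)
  obtain ⟨h1, h2, h3, h4, h5⟩ := h
  exact ⟨h1.of_eq (he _ (by decide)) (he _ (by decide)) (he _ (by decide)), by rwa [e1],
    by rwa [e2], by rwa [e3], by rwa [e4]⟩

-- The mex is at most the degree of the starting vertex, hence at most three, and is determined by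
-- which of 0, 1, 2 occur among the options.
open Classical in
theorem eval_componentCode (hg : IsGraphRel adj n)
    (hd : ∀ v, ((Finset.range n).filter (adj v)).card ≤ 3) (hn : σ aNum 0 = n)
    (hs : x.getD (σ aOff 0 + 1) 0 = s) (hsn : s < n)
    (hx : ∀ u < n, ∀ v < n, x.getD (σ aOff 0 + 2 + u * n + v) 0 ≠ 0 ↔ adj u v) :
    ComponentInv x adj n s (componentCode.eval x σ) := by
  set s₁ : Stmt := .set aFlag (.lit 0) (.lit 0) ;; .set aFlag (.lit 1) (.lit 0) ;;
    .set aFlag (.lit 2) (.lit 0) with hs₁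
  set s₂ : Stmt := .ite (.get aFlag (.lit 0))
    (.ite (.get aFlag (.lit 1))
      (.ite (.get aFlag (.lit 2)) (.assign aGrd (.lit 3)) (.assign aGrd (.lit 2)))
      (.assign aGrd (.lit 1)))
    (.assign aGrd (.lit 0)) with hs₂
  have e : componentCode.eval x σ = s₂.eval x ((Stmt.each aOpt optionStep).eval x (s₁.eval x
    (rowsCode.eval x ((Stmt.assign aStart (.inp (.add (.var aOff) (.lit 1)))).eval x σ)))) := rfl
  have e0 : (Stmt.assign aStart (.inp (.add (.var aOff) (.lit 1)))).eval x σ =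
      σ.set aStart 0 s := by
    simp only [Stmt.eval, Expr.eval, hs]
  rw [e, e0]
  have a1 : σ.set aStart 0 s aStart 0 = s := by simp [Store.set_apply]
  have a2 : σ.set aStart 0 s aNum 0 = n := by simp [Store.set_apply, hn]
  have a3 : σ.set aStart 0 s aOff = σ aOff := Store.set_of_ne _ _ _ (by decide)
  generalize σ.set aStart 0 s = σ₁ at *
  obtain ⟨h1, h2⟩ := eval_rowsCode (x := x) a2
  have f : ∀ k, k ∉ rowsCode.writes → rowsCode.eval x σ₁ k = σ₁ k := fun k hk =>
    Stmt.eval_of_notMem_writes x hk σ₁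
  have c1 : Ctx x adj n (rowsCode.eval x σ₁) := by
    refine ⟨by rw [f aNum (by decide), a2], h1, ?_⟩
    rw [f aOff (by decide), a3]
    exact hx
  rw [← f aStart (by decide)] at a1
  generalize rowsCode.eval x σ₁ = σ₂ at *
  have b1 : s₁.eval x σ₂ aStart 0 = s := by
    rw [Stmt.eval_of_notMem_writes x (by decide), a1]
  have b2 : s₁.eval x σ₂ aSq 0 = n * n := by
    rw [Stmt.eval_of_notMem_writes x (by decide), h2]
  have b3 : ∀ i ≤ 2, s₁.eval x σ₂ aFlag i = 0 := by
    intro i hi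
    simp [hs₁, Stmt.eval, Expr.eval, Store.set_apply]
    omega
  have c2 : Ctx x adj n (s₁.eval x σ₂) := c1.eval
  generalize s₁.eval x σ₂ = σ₃ at *
  obtain ⟨d1, d2⟩ := eval_options hg hd c2 b1 hsn b3 rfl
  have f : ∀ k, k ∉ (Stmt.each aOpt optionStep).writes →
      (Stmt.each aOpt optionStep).eval x σ₃ k = σ₃ k := fun k hk =>
    Stmt.eval_of_notMem_writes x hk σ₃
  have c3 : Ctx x adj n ((Stmt.each aOpt optionStep).eval x σ₃) := c2.eval
  rw [← f aStart (by decide)] at b1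
  rw [← f aSq (by decide)] at b2
  generalize (Stmt.each aOpt optionStep).eval x σ₃ = σ₄ at *
  refine ⟨c3.eval, by rw [Stmt.eval_of_notMem_writes x (by decide), b1],
    by rw [Stmt.eval_of_notMem_writes x (by decide), b2],
    by rw [Stmt.eval_of_notMem_writes x (by decide)]; exact d1, ?_⟩
  have hopt : ∀ i, (∃ v < n, adj s v ∧ optVal adj n s v = i) ↔
      ∃ w ∈ (Finset.range n).erase s, adj s w ∧
        gval adj (((Finset.range n).erase s).erase w) w = i := by
    intro i
    constructor
    · rintro ⟨v, h1, h2, h3⟩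
      refine ⟨v, ?_, h2, h3⟩
      rw [Finset.mem_erase, Finset.mem_range]
      refine ⟨?_, h1⟩
      rintro rfl
      exact hg.irrefl _ h2
    · rintro ⟨w, h1, h2, h3⟩
      exact ⟨w, by simp at h1; exact h1.2, h2, h3⟩
  have m1 : ∀ i, i < gval adj ((Finset.range n).erase s) s →
      ∃ v < n, adj s v ∧ optVal adj n s v = i := fun i hi =>
    (hopt i).2 (exists_of_lt_gval hi)
  have m2 : ¬ ∃ v < n, adj s v ∧ optVal adj n s v = gval adj ((Finset.range n).erase s) s := by
    rw [hopt]
    rintro ⟨w, h1, h2, h3⟩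
    exact gval_ne h1 h2 h3
  have m3 : gval adj ((Finset.range n).erase s) s ≤ 3 :=
    gval_le_card.trans ((Finset.card_le_card
      (Finset.filter_subset_filter _ (Finset.erase_subset _ _))).trans (hd s))
  generalize gval adj ((Finset.range n).erase s) s = g at *
  have e6 : s₂.eval x σ₄ aGrd 0 = if σ₄ aFlag 0 = 0 then 0 else if σ₄ aFlag 1 = 0 then 1 else
      if σ₄ aFlag 2 = 0 then 2 else 3 := by
    by_cases h0 : σ₄ aFlag 0 = 0 <;> by_cases h1 : σ₄ aFlag 1 = 0 <;>
      by_cases h2 : σ₄ aFlag 2 = 0 <;>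
      simp [hs₂, Stmt.eval, Expr.eval, Store.set_apply, h0, h1, h2]
  have hflag : ∀ i ≤ 2, (i < g → σ₄ aFlag i ≠ 0) ∧ (g = i → σ₄ aFlag i = 0) := by
    refine fun i hi => ⟨fun hig => (d2 i hi).2 (m1 i hig), ?_⟩
    rintro rfl
    by_contra h
    exact m2 ((d2 g hi).1 h)
  have f0 := hflag 0 (by omega)
  have f1 := hflag 1 (by omega)
  have f2 := hflag 2 (by omega)
  rw [e6]
  split_ifs <;> omega

end Imp

/-! ### The passes over the components -/

namespace Imp

/-- The position of the description of a component in the input. -/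
def offset (N : ℕ → ℕ) (j : ℕ) : ℕ := 1 + ∑ i ∈ Finset.range j, (2 + N i * N i)

open Classical in
/-- The input describes `k` graphs of maximum degree at most three, with `N j` vertices and the
adjacency relation `A j`, and with the starting vertices `s j`. -/
structure Describes (x : List ℕ) (k : ℕ) (N s : ℕ → ℕ) (A : ℕ → ℕ → ℕ → Prop) : Prop where
  count : x.getD 0 0 = k
  num : ∀ j < k, x.getD (offset N j) 0 = N j
  start : ∀ j < k, x.getD (offset N j + 1) 0 = s j
  entry : ∀ j < k, ∀ u < N j, ∀ v < N j,
    x.getD (offset N j + 2 + u * N j + v) 0 ≠ 0 ↔ A j u v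
  lt : ∀ j < k, s j < N j
  graph : ∀ j < k, IsGraphRel (A j) (N j)
  deg : ∀ j < k, ∀ v, ((Finset.range (N j)).filter (A j v)).card ≤ 3

/-- The value of a component. -/
noncomputable def startVal (N s : ℕ → ℕ) (A : ℕ → ℕ → ℕ → Prop) (j : ℕ) : ℕ :=
  gval (A j) ((Finset.range (N j)).erase (s j)) (s j)

variable {x : List ℕ} {k : ℕ} {N s : ℕ → ℕ} {A : ℕ → ℕ → ℕ → Prop} {σ τ : Store}

theorem Describes.startVal_le (h : Describes x k N s A) {j : ℕ} (hj : j < k) :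
    startVal N s A j ≤ 3 := by
  classical
  exact gval_le_card.trans ((Finset.card_le_card
    (Finset.filter_subset_filter _ (Finset.erase_subset _ _))).trans (by
      convert h.deg j hj (s j)))

/-- Numbers with two bits are closed under nim addition. This is what allows `xorCode` to deal with
small values only. -/
theorem Describes.nimSum_le (h : Describes x k N s A) {j : ℕ} (hj : j ≤ k) :
    nimSum (startVal N s A) j ≤ 3 := by
  induction j with
  | zero => exact Nat.zero_le _
  | succ j ih =>
    have h1 := ih (by omega)
    have h2 := h.startVal_le (j := j) (by omega)
    have := Nat.xor_lt_two_pow (n := 2) (x := nimSum (startVal N s A) j)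
      (y := startVal N s A j) (by omega) (by omega)
    rw [nimSum]
    omega

theorem eval_xorCode (d : Fin 63) (h1 : σ aNim 0 ≤ 3) (h2 : σ aGrd 0 ≤ 3) :
    (xorCode d).eval x σ = σ.set d 0 (σ aNim 0 ^^^ σ aGrd 0) := by
  have key : ∀ a ≤ 3, ∀ b ≤ 3, a ≠ 0 → b ≠ 0 → a ≠ b → 6 - a - b = a ^^^ b := by decide
  rw [xorCode]
  by_cases h3 : σ aNim 0 = 0
  · rw [Stmt.eval_ite_zero (e := .var aNim) h3, h3, Nat.zero_xor]
    rfl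
  rw [Stmt.eval_ite_ne (e := .var aNim) h3]
  by_cases h4 : σ aGrd 0 = 0
  · rw [Stmt.eval_ite_zero (e := .var aGrd) h4, h4, Nat.xor_zero]
    rfl
  rw [Stmt.eval_ite_ne (e := .var aGrd) h4]
  by_cases h5 : σ aNim 0 = σ aGrd 0
  · rw [Stmt.eval_ite_zero (e := .dist (.var aNim) (.var aGrd)) ((eval_dist _ _).2 h5), h5,
      Nat.xor_self]
    rfl
  · rw [Stmt.eval_ite_ne (e := .dist (.var aNim) (.var aGrd)) fun h => h5 ((eval_dist _ _).1 h),
      ← key _ h1 _ h2 h3 h4 h5]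
    rfl

/-- One round of a pass. -/
abbrev passRound (body : Stmt) : Stmt := .assign aNum (.inp (.var aOff)) ;; body

theorem Describes.component (h : Describes x k N s A) {j : ℕ} (hj : j < k)
    (ho : σ aOff 0 = offset N j) :
    ComponentInv x (A j) (N j) (s j) (componentCode.eval x (σ.set aNum 0 (N j))) := by
  have e : σ.set aNum 0 (N j) aOff 0 = offset N j := by simp [Store.set_apply, ho]
  refine eval_componentCode (h.graph j hj) (h.deg j hj) (by simp [Store.set_apply]) ?_
    (h.lt j hj) ?_
  · rw [e]
    exact h.start j hj
  · rw [e]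
    exact h.entry j hj

theorem Describes.eval_num (h : Describes x k N s A) {j : ℕ} (hj : j < k)
    (ho : σ aOff 0 = offset N j) :
    (Stmt.assign aNum (.inp (.var aOff))).eval x σ = σ.set aNum 0 (N j) := by
  have := h.num j hj
  rw [← ho] at this
  simp only [Stmt.eval, Expr.eval, this]

theorem eval_nextComponent (ho : σ aOff 0 = offset N j) (hs : σ aSq 0 = N j * N j) :
    nextComponent.eval x σ aOff 0 = offset N (j + 1) := by
  simp [nextComponent, Stmt.eval, Expr.eval, Store.set_apply, ho, hs, offset,
    Finset.sum_range_succ]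
  omega

theorem Describes.eval_firstBody (h : Describes x k N s A) {j : ℕ} (hj : j < k)
    (ho : σ aOff 0 = offset N j) (hτ : τ = (passRound firstBody).eval x σ) :
    τ aOff 0 = offset N (j + 1) ∧
      (σ aNim 0 = nimSum (startVal N s A) j → τ aNim 0 = nimSum (startVal N s A) (j + 1)) := by
  have hc := h.component hj ho
  have f : ∀ k, k ∉ componentCode.writes → k ≠ aNum →
      componentCode.eval x (σ.set aNum 0 (N j)) k = σ k := fun k hk hk' => by
    rw [Stmt.eval_of_notMem_writes x hk, Store.set_of_ne _ _ _ hk']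
  have f1 := f aOff (by decide) (by decide)
  have f2 := f aNim (by decide) (by decide)
  have e : τ = nextComponent.eval x ((xorCode aNim).eval x
      (componentCode.eval x (σ.set aNum 0 (N j)))) := by
    rw [hτ, passRound, Stmt.eval_seq, h.eval_num hj ho]
    rfl
  subst e
  generalize componentCode.eval x (σ.set aNum 0 (N j)) = σ₁ at *
  constructor
  · refine eval_nextComponent ?_ ?_
    · rw [Stmt.eval_of_notMem_writes x (by decide), f1, ho]
    · rw [Stmt.eval_of_notMem_writes x (by decide), hc.sq]
  · intro hn
    rw [Stmt.eval_of_notMem_writes x (by decide), eval_xorCode, nimSum, f2, hn, hc.grd]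
    · simp [Store.set_apply, startVal]
    · rw [f2, hn]
      exact h.nimSum_le hj.le
    · rw [hc.grd]
      exact h.startVal_le hj

/-- The move of the token of component `i` to `v` makes the nim sum zero if it is `X` before. -/
def IsGoodMove (N s : ℕ → ℕ) (A : ℕ → ℕ → ℕ → Prop) (X i v : ℕ) : Prop :=
  v < N i ∧ A i (s i) v ∧ optVal (A i) (N i) (s i) v = X ^^^ startVal N s A i

/-- The output after the inspection of the moves in `P`. -/
def Output (k : ℕ) (N s : ℕ → ℕ) (A : ℕ → ℕ → ℕ → Prop) (X : ℕ) (P : ℕ → ℕ → Prop) (τ : Store) :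
    Prop :=
  (τ aOut 0 = 0 ∧ ∀ i v, P i v → ¬ IsGoodMove N s A X i v) ∨
    (τ aOut 0 = 1 ∧ τ aOutComp 0 < k ∧ IsGoodMove N s A X (τ aOutComp 0) (τ aOutVert 0))

theorem Output.of_eq {X : ℕ} {P Q : ℕ → ℕ → Prop} (h : Output k N s A X P σ)
    (he : ∀ k : Fin 63, k ∈ [aOut, aOutComp, aOutVert] → τ k = σ k)
    (hQ : ∀ i v, IsGoodMove N s A X i v → Q i v → P i v) : Output k N s A X Q τ := by
  rw [Output, he aOut (by decide), he aOutComp (by decide), he aOutVert (by decide)]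
  exact h.imp_left fun ⟨h1, h2⟩ => ⟨h1, fun i v hq hg => h2 i v (hQ i v hg hq) hg⟩

/-- `P` stands for the moves inspected in earlier components. A good move found later overwrites an
earlier one, which does no harm. -/
theorem eval_answers {j X : ℕ} (hj : j < k) (hs : s j < N j)
    (hc : ComponentInv x (A j) (N j) (s j) σ) (hcomp : σ aComp 0 = j)
    (hw : σ aWant 0 = X ^^^ startVal N s A j) {P : ℕ → ℕ → Prop} (ho : Output k N s A X P σ) :
    Output k N s A X (fun i v => P i v ∨ i = j) ((Stmt.each aOpt answerStep).eval x σ) := by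
  rw [eval_each _ _ hc.ctx]
  refine (forLoop_induction (fun m (τ : Store) => ComponentInv x (A j) (N j) (s j) τ ∧
    τ aComp 0 = j ∧ τ aWant 0 = X ^^^ startVal N s A j ∧
    Output k N s A X (fun i v => P i v ∨ i = j ∧ v < m) τ)
    ⟨hc, hcomp, hw, ho.of_eq (fun _ _ => rfl) (by simp)⟩ ?_).2.2.2.of_eq (fun _ _ => rfl) ?_
  swap
  · rintro i v hg (h | rfl)
    exacts [.inl h, .inr ⟨rfl, hg.1⟩]
  rintro m hm τ ⟨c1, k1, k2, k3⟩
  have e1 : τ.set aOpt 0 m aOpt 0 = m := by simp [Store.set_apply]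
  have e2 : ∀ k, k ≠ aOpt → τ.set aOpt 0 m k = τ k := fun k hk => Store.set_of_ne _ _ _ hk
  replace c1 : ComponentInv x (A j) (N j) (s j) (τ.set aOpt 0 m) :=
    c1.of_eq fun k hk => e2 k (by rintro rfl; revert hk; decide)
  rw [← e2 aComp (by decide)] at k1
  rw [← e2 aWant (by decide)] at k2
  replace k3 := k3.of_eq (τ := τ.set aOpt 0 m)
    (fun k hk => e2 k (by rintro rfl; revert hk; decide)) fun _ _ _ => id
  generalize τ.set aOpt 0 m = σ₂ at *
  have f : ∀ k, k ∉ answerStep.writes → answerStep.eval x σ₂ k = σ₂ k := fun k hk =>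
    Stmt.eval_of_notMem_writes x hk σ₂
  refine ⟨c1.of_eq fun k hk => f k fun h => ?_, by rw [f _ (by decide), k1],
    by rw [f _ (by decide), k2], ?_⟩
  · revert k
    decide
  have hskip : ¬ IsGoodMove N s A X j m →
      Output k N s A X (fun i v => P i v ∨ i = j ∧ v < m + 1) σ₂ := by
    refine fun h => k3.of_eq (fun _ _ => rfl) ?_
    rintro i v hg (h' | ⟨rfl, h'⟩)
    · exact .inl h'
    · rcases Nat.lt_succ_iff_lt_or_eq.1 h' with h' | rfl
      exacts [.inr ⟨rfl, h'⟩, absurd hg h]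
  have hadj := eval_adjEntry c1.ctx (u := aStart) (v := aOpt) (by rwa [c1.start]) (by rwa [e1])
  rw [c1.start, e1] at hadj
  rw [answerStep]
  by_cases h1 : A j (s j) m
  swap
  · rw [Stmt.eval_ite_zero (e := adjEntry aStart aOpt) (hadj.2 h1)]
    exact hskip fun h => h1 h.2.1
  rw [Stmt.eval_ite_ne (e := adjEntry aStart aOpt) fun h => hadj.1 h h1]
  have hd : (Expr.dist (.get aH (.var aOpt)) (.var aWant)).eval x σ₂ = 0 ↔
      optVal (A j) (N j) (s j) m = X ^^^ startVal N s A j := by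
    rw [eval_dist]
    simp only [Expr.eval, e1, c1.opt m hm h1, k2]
  by_cases h2 : optVal (A j) (N j) (s j) m = X ^^^ startVal N s A j
  · rw [Stmt.eval_ite_zero (e := .dist (.get aH (.var aOpt)) (.var aWant)) (hd.2 h2)]
    have e3 : (Stmt.assign aOut (.lit 1) ;; .assign aOutComp (.var aComp) ;;
        .assign aOutVert (.var aOpt)).eval x σ₂ =
        ((σ₂.set aOut 0 1).set aOutComp 0 j).set aOutVert 0 m := by
      simp [Stmt.eval, Expr.eval, Store.set_apply, k1, e1]
    rw [e3]
    refine .inr ⟨by simp [Store.set_apply], by simpa [Store.set_apply] using hj, ?_⟩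
    simpa [Store.set_apply] using ⟨hm, h1, h2⟩
  · rw [Stmt.eval_ite_ne (e := .dist (.get aH (.var aOpt)) (.var aWant)) fun h => h2 (hd.1 h)]
    exact hskip fun h => h2 h.2.2

theorem Describes.eval_secondBody (h : Describes x k N s A) {j X : ℕ} (hj : j < k)
    (ho : σ aOff 0 = offset N j) (hτ : τ = (passRound secondBody).eval x σ) :
    τ aOff 0 = offset N (j + 1) ∧ (σ aNim 0 = X → σ aComp 0 = j → X ≤ 3 → ∀ P,
      Output k N s A X P σ → Output k N s A X (fun i v => P i v ∨ i = j) τ) := by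
  have hc := h.component hj ho
  have f : ∀ k, k ∉ componentCode.writes → k ≠ aNum →
      componentCode.eval x (σ.set aNum 0 (N j)) k = σ k := fun k hk hk' => by
    rw [Stmt.eval_of_notMem_writes x hk, Store.set_of_ne _ _ _ hk']
  have e : τ = nextComponent.eval x ((Stmt.each aOpt answerStep).eval x ((xorCode aWant).eval x
      (componentCode.eval x (σ.set aNum 0 (N j))))) := by
    rw [hτ, passRound, Stmt.eval_seq, h.eval_num hj ho]
    rfl
  subst e
  have f1 := f aOff (by decide) (by decide)
  have f2 := f aNim (by decide) (by decide)
  have f3 := f aComp (by decide) (by decide)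
  have f4 : ∀ k : Fin 63, k ∈ [aOut, aOutComp, aOutVert] →
      componentCode.eval x (σ.set aNum 0 (N j)) k = σ k := fun k hk => f k
        (by revert k; decide) (by rintro rfl; revert hk; decide)
  clear f
  generalize componentCode.eval x (σ.set aNum 0 (N j)) = σ₁ at *
  constructor
  · refine eval_nextComponent ?_ ?_
    · rw [Stmt.eval_of_notMem_writes x (by decide), Stmt.eval_of_notMem_writes x (by decide), f1,
        ho]
    · rw [Stmt.eval_of_notMem_writes x (by decide), Stmt.eval_of_notMem_writes x (by decide),
        hc.sq]
  · intro hn hcj hX P hP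
    have e1 : (xorCode aWant).eval x σ₁ = σ₁.set aWant 0 (X ^^^ startVal N s A j) := by
      rw [eval_xorCode, f2, hn, hc.grd, startVal]
      · rwa [f2, hn]
      · rw [hc.grd]
        exact h.startVal_le hj
    rw [e1]
    have e2 : ∀ k, k ≠ aWant → σ₁.set aWant 0 (X ^^^ startVal N s A j) k = σ₁ k :=
      fun k hk => Store.set_of_ne _ _ _ hk
    refine Output.of_eq (eval_answers (P := P) hj (h.lt j hj)
      (hc.of_eq fun k hk => e2 k (by rintro rfl; revert hk; decide)) ?_ ?_ (hP.of_eq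
      (fun k hk => (e2 k (by rintro rfl; revert hk; decide)).trans (f4 k hk)) fun _ _ _ => id))
      (fun k hk => Stmt.eval_of_notMem_writes x (by revert k; decide) _) fun _ _ _ => id
    · rw [e2 _ (by decide), f3, hcj]
    · simp [Store.set_apply]

/-- The effect of the two passes. -/
theorem Describes.eval_mainCode (h : Describes x k N s A) :
    Output k N s A (nimSum (startVal N s A) k) (fun i _ => i < k)
      (mainCode.eval x fun _ _ => 0) := by
  have e : mainCode.eval x (fun _ _ => 0) =
      forLoop (fun j τ => (passRound secondBody).eval x (τ.set aComp 0 j)) k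
        (Store.set (forLoop (fun j τ => (passRound firstBody).eval x (τ.set aComp 0 j)) k
          (Store.set (fun _ _ => 0) aOff 0 1)) aOff 0 1) := by
    have := h.count
    simp only [mainCode, passCode, Stmt.eval, Expr.eval, this]
  rw [e]
  obtain ⟨-, h1, h2⟩ := forLoop_induction
    (f := fun j τ => (passRound firstBody).eval x (τ.set aComp 0 j)) (n := k)
    (a := Store.set (fun _ _ => 0) aOff 0 1) (fun j τ => τ aOff 0 = offset N j ∧
      τ aNim 0 = nimSum (startVal N s A) j ∧ τ aOut 0 = 0) ⟨rfl, rfl, rfl⟩ (by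
    rintro j hj τ ⟨h1, h2, h3⟩
    obtain ⟨r1, r2⟩ := h.eval_firstBody (σ := τ.set aComp 0 j) hj
      (by rw [Store.set_of_ne _ _ _ (by decide), h1]) rfl
    refine ⟨r1, r2 (by rw [Store.set_of_ne _ _ _ (by decide), h2]), ?_⟩
    rw [Stmt.eval_of_notMem_writes x (by decide), Store.set_of_ne _ _ _ (by decide), h3])
  generalize forLoop (fun j τ => (passRound firstBody).eval x (τ.set aComp 0 j)) k
          (Store.set (fun _ _ => 0) aOff 0 1) = σ₁ at *
  refine (forLoop_induction
    (f := fun j τ => (passRound secondBody).eval x (τ.set aComp 0 j)) (n := k)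
    (a := σ₁.set aOff 0 1) (fun j τ => τ aOff 0 = offset N j ∧
      τ aNim 0 = nimSum (startVal N s A) k ∧
      Output k N s A (nimSum (startVal N s A) k) (fun i _ => i < j) τ) ⟨?_, ?_, .inl ⟨?_, ?_⟩⟩
    ?_).2.2
  · simp [Store.set_apply, offset]
  · rw [Store.set_of_ne _ _ _ (by decide), h1]
  · rw [Store.set_of_ne _ _ _ (by decide), h2]
  · simp
  · rintro j hj τ ⟨h1, h2, h3⟩
    obtain ⟨r1, r2⟩ := h.eval_secondBody (σ := τ.set aComp 0 j) hj
      (by rw [Store.set_of_ne _ _ _ (by decide), h1]) rfl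
    refine ⟨r1, ?_, ?_⟩
    · rw [Stmt.eval_of_notMem_writes x (by decide), Store.set_of_ne _ _ _ (by decide), h2]
    · refine (r2 (by rw [Store.set_of_ne _ _ _ (by decide), h2]) (by simp [Store.set_apply])
        (h.nimSum_le le_rfl) _ (h3.of_eq (fun k hk => Store.set_of_ne _ _ _
          (by rintro rfl; revert hk; decide)) fun _ _ _ => id)).of_eq (fun _ _ => rfl) ?_
      intro i v _ hi
      omega

theorem eval_polynomial_mono (p : Polynomial ℕ) {a b : ℕ} (h : a ≤ b) : p.eval a ≤ p.eval b := by
  rw [Polynomial.eval_eq_sum, Polynomial.eval_eq_sum]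
  exact Finset.sum_le_sum fun i _ => Nat.mul_le_mul_left _ (Nat.pow_le_pow_left h i)

/-- A bound for the time of a pass. -/
noncomputable def passBound (body : Stmt) : Polynomial ℕ :=
  Polynomial.C (passCode body).size +
    Polynomial.X * (Polynomial.C (passRound body).size + 6 + body.bound)

/-- A component contains its starting vertex, so the total number of vertices bounds the number of
rounds as well as the size of each component. -/
theorem Describes.cost_passCode (h : Describes x k N s A) {body : Stmt} (hb : body.capped aNum)
    (ho : ∀ j < k, ∀ σ : Store, σ aOff 0 = offset N j →
      (passRound body).eval x σ aOff 0 = offset N (j + 1)) (hN : ∀ j < k, 0 < N j) (σ : Store) :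
    (passCode body).cost x σ ≤ (passBound body).eval (∑ j ∈ Finset.range k, N j) := by
  set T := ∑ j ∈ Finset.range k, N j with hT
  have hkT : k ≤ T := by
    have := Finset.card_nsmul_le_sum (Finset.range k) N 1 fun j hj => hN j (Finset.mem_range.1 hj)
    simpa using this
  set F : ℕ → Store → Store := fun j τ => (passRound body).eval x (τ.set aComp 0 j) with hF
  set σ₀ := (Stmt.assign aOff (.lit 1)).eval x σ with hσ₀
  -- The cost of a round depends on the number that is read at `aOff`, so the offset has to be
  -- correct in every round.
  have hoff : ∀ j ≤ k, forLoop F j σ₀ aOff 0 = offset N j := by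
    intro j
    induction j with
    | zero => exact fun _ => by simp [forLoop, hσ₀, Stmt.eval, Expr.eval, Store.set_apply, offset]
    | succ j ih =>
      exact fun hj => ho j hj _ (by rw [Store.set_of_ne _ _ _ (by decide), ih (by omega)])
  have hround : ∀ j < k, (passRound body).cost x ((forLoop F j σ₀).set aComp 0 j) ≤
      (passRound body).size + body.bound.eval T := by
    intro j hj
    have e1 := h.eval_num (σ := (forLoop F j σ₀).set aComp 0 j) hj
      (by rw [Store.set_of_ne _ _ _ (by decide), hoff j hj.le])
    have e2 := body.cost_le x hb (((forLoop F j σ₀).set aComp 0 j).set aNum 0 (N j))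
    have e3 : (((forLoop F j σ₀).set aComp 0 j).set aNum 0 (N j)) aNum 0 = N j := by
      simp [Store.set_apply]
    have e4 := eval_polynomial_mono body.bound (a := N j) (b := T)
      (Finset.single_le_sum (f := N) (fun _ _ => Nat.zero_le _) (Finset.mem_range.2 hj))
    rw [e3] at e2
    have e5 : (passRound body).cost x ((forLoop F j σ₀).set aComp 0 j) =
        (Stmt.assign aNum (.inp (.var aOff))).size +
          body.cost x (((forLoop F j σ₀).set aComp 0 j).set aNum 0 (N j)) := by
      rw [Stmt.cost, e1, Stmt.cost]
    have e6 : (passRound body).size =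
        (Stmt.assign aNum (.inp (.var aOff))).size + body.size := rfl
    omega
  have hsum := Finset.sum_le_card_nsmul (Finset.range k)
    (fun j => 6 + (passRound body).cost x ((forLoop F j σ₀).set aComp 0 j))
    (6 + ((passRound body).size + body.bound.eval T))
    fun j hj => Nat.add_le_add_left (hround j (Finset.mem_range.1 hj)) 6
  rw [Finset.card_range, smul_eq_mul] at hsum
  have hmul := Nat.mul_le_mul_right (6 + ((passRound body).size + body.bound.eval T)) hkT
  have hcost : (passCode body).cost x σ = (Stmt.assign aOff (.lit 1)).size +
      ((Expr.inp (.lit 0)).size + 1 + (∑ j ∈ Finset.range k,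
        (6 + (passRound body).cost x ((forLoop F j σ₀).set aComp 0 j))) + 2) := by
    have : (Expr.inp (.lit 0)).eval x σ₀ = k := h.count
    rw [passCode, Stmt.cost, Stmt.cost, ← hσ₀, Stmt.cost, this]
  have hsize : (passCode body).size = (Stmt.assign aOff (.lit 1)).size +
      ((Expr.inp (.lit 0)).size + 1 + 3 + (passRound body).size + 3) := rfl
  have hbound : (passBound body).eval T =
      (passCode body).size + T * ((passRound body).size + 6 + body.bound.eval T) := by
    simp [passBound]
  have : (passRound body).size + 6 + body.bound.eval T =
    6 + ((passRound body).size + body.bound.eval T) := by omega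
  rw [hbound, hcost, hsize, this]
  omega

/-- A bound for the time of the program. -/
noncomputable def mainBound : Polynomial ℕ := passBound firstBody + passBound secondBody

theorem Describes.cost_mainCode (h : Describes x k N s A) (σ : Store) :
    mainCode.cost x σ ≤ mainBound.eval (∑ j ∈ Finset.range k, N j) := by
  have hN : ∀ j < k, 0 < N j := fun j hj => (Nat.zero_le _).trans_lt (h.lt j hj)
  rw [mainCode, Stmt.cost, mainBound, Polynomial.eval_add]
  exact Nat.add_le_add
    (h.cost_passCode capped_firstBody (fun j hj σ ho => (h.eval_firstBody hj ho rfl).1) hN σ)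
    (h.cost_passCode capped_secondBody
      (fun j hj σ ho => (h.eval_secondBody (X := 0) hj ho rfl).1) hN _)

/-- The program. -/
def program : RAM.Program := mainCode.code 0 0

/-- The program halts in time and gives the output of the two passes. -/
theorem Describes.run_program (h : Describes x k N s A) {t : ℕ}
    (ht : mainBound.eval (∑ j ∈ Finset.range k, N j) ≤ t) :
    RAM.Halted program (RAM.run program x t) ∧
      Rep (mainCode.eval x fun _ _ => 0) (RAM.run program x t).reg := by
  obtain ⟨R, h1, h2, -⟩ := mainCode.run_code (prog := program) (x := x) (t := 0) (b := 0)
    (fun i _ => by rw [Nat.zero_add]; rfl) (σ := fun _ _ => 0) (R := fun _ => 0) fun _ _ => rfl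
  have hh : RAM.Halted program ⟨0 + mainCode.size, R⟩ := by
    rw [RAM.Halted, program, Stmt.length_code, Nat.zero_add]
  -- A halted configuration is a fixed point, so surplus time is harmless.
  have hstep : RAM.step program x ⟨0 + mainCode.size, R⟩ = ⟨0 + mainCode.size, R⟩ := by
    rw [RAM.step, List.getElem?_eq_none hh]
  obtain ⟨d, rfl⟩ := Nat.exists_eq_add_of_le ((h.cost_mainCode fun _ _ => 0).trans ht)
  have : RAM.run program x (mainCode.cost x (fun _ _ => 0) + d) = ⟨0 + mainCode.size, R⟩ := by
    rw [RAM.run, Nat.add_comm, Function.iterate_add_apply, h1, Function.iterate_fixed hstep]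
  rw [this]
  exact ⟨hh, h2⟩

end Imp

/-! ### The collection as input data -/

/-- Lists of given lengths, one after the other. -/
theorem length_flatMap_finRange {α : Type} (k : ℕ) (L : Fin k → List α) (len : ℕ → ℕ)
    (hL : ∀ i, (L i).length = len i) :
    ((List.finRange k).flatMap L).length = ∑ j ∈ Finset.range k, len j := by
  induction k with
  | zero => simp
  | succ k ih =>
    rw [List.finRange_succ_last, List.flatMap_append, List.length_append, List.flatMap_map,
      ih (fun i => L i.castSucc) fun i => hL i.castSucc, Finset.sum_range_succ]
    simp [hL]

theorem getD_flatMap_finRange {α : Type} (k : ℕ) (L : Fin k → List α) (len : ℕ → ℕ)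
    (hL : ∀ i, (L i).length = len i) (i : Fin k) {t : ℕ} (ht : t < len i) (a : α) :
    ((List.finRange k).flatMap L).getD (∑ j ∈ Finset.range i, len j + t) a = (L i).getD t a := by
  induction k with
  | zero => exact i.elim0
  | succ k ih =>
    have hlen := length_flatMap_finRange k (fun i => L i.castSucc) len fun i => hL i.castSucc
    rw [List.finRange_succ_last, List.flatMap_append, List.flatMap_map]
    cases i using Fin.lastCases with
    | last =>
      rw [List.getD_append_right _ _ _ _ (by rw [hlen, Fin.val_last]; omega), hlen]
      simp
    | cast i =>
      have hi : ∑ j ∈ Finset.range (i.castSucc : Fin (k + 1)), len j + t <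
          ∑ j ∈ Finset.range k, len j := by
        have h1 : ∑ j ∈ Finset.range ((i : ℕ) + 1), len j ≤ ∑ j ∈ Finset.range k, len j :=
          Finset.sum_le_sum_of_subset (Finset.range_subset_range.2 i.2)
        rw [Finset.sum_range_succ] at h1
        simp only [Fin.val_castSucc] at ht ⊢
        omega
      rw [List.getD_append _ _ _ _ (by rw [hlen]; exact hi)]
      exact ih (fun i => L i.castSucc) (fun i => hL i.castSucc) i ht

namespace Geography

variable (g : Geography)

/-- The adjacency relation of the graph, as a relation on the natural numbers. -/
def AdjNat (u v : ℕ) : Prop := ∃ (hu : u < g.n) (hv : v < g.n), g.graph.Adj ⟨u, hu⟩ ⟨v, hv⟩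

theorem adjNat_iff (u v : Fin g.n) : g.AdjNat u v ↔ g.graph.Adj u v :=
  ⟨fun ⟨_, _, h⟩ => h, fun h => ⟨u.2, v.2, h⟩⟩

theorem isGraphRel : IsGraphRel g.AdjNat g.n :=
  ⟨fun ⟨hu, hv, h⟩ => ⟨hv, hu, h.symm⟩, fun _ ⟨_, _, h⟩ => g.graph.irrefl h, fun ⟨hu, _, _⟩ => hu⟩

open Classical in
theorem card_adjNat_le {d : ℕ} (h : g.MaxDegreeLE d) (v : ℕ) :
    ((Finset.range g.n).filter (g.AdjNat v)).card ≤ d := by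
  by_cases hv : v < g.n
  · refine le_trans ?_ (h ⟨v, hv⟩)
    rw [← Set.ncard_image_of_injective _ Fin.val_injective, ← Set.ncard_coe_finset]
    refine Set.ncard_le_ncard (fun w hw => ?_) (Set.toFinite _)
    obtain ⟨_, hw, h⟩ := (Finset.mem_filter.1 (Finset.mem_coe.1 hw)).2
    exact ⟨⟨w, hw⟩, h, rfl⟩
  · rw [Finset.filter_false_of_mem fun w _ ⟨h, _⟩ => hv h]
    exact Nat.zero_le _

theorem length_encode : g.encode.length = 2 + g.n * g.n := by
  rw [encode, List.length_cons, List.length_cons,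
    length_flatMap_finRange _ _ (fun _ => g.n) fun u => by simp]
  simp
  omega

open Classical in
theorem getD_encode (u v : Fin g.n) :
    g.encode.getD (2 + u * g.n + v) 0 ≠ 0 ↔ g.AdjNat u v := by
  have h := getD_flatMap_finRange g.n (fun u => (List.finRange g.n).map fun v =>
    if g.graph.Adj u v then 1 else 0) (fun _ => g.n) (fun u => by simp) u v.2 0
  rw [Finset.sum_const, Finset.card_range, smul_eq_mul] at h
  have e : 2 + (u : ℕ) * g.n + v = (u * g.n + v) + 1 + 1 := by omega
  rw [adjNat_iff, encode, e, List.getD_cons_succ, List.getD_cons_succ, h]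
  simp

/-- The value of a state. -/
noncomputable def stateVal (p : GeographyState (Fin g.n)) : ℕ :=
  gval g.AdjNat ((p.remaining.erase p.token).map Fin.valEmbedding) p.token

theorem map_erase (S : Finset (Fin g.n)) (v : Fin g.n) :
    (S.erase v).map Fin.valEmbedding = (S.map Fin.valEmbedding).erase v :=
  Finset.map_erase _ _ _

theorem isGrundy_stateVal : IsGrundy (GeographyMove g.graph) g.stateVal := by
  constructor
  · rintro p q ⟨h1, h2, h3⟩
    rw [stateVal, stateVal, h3, map_erase _ (p.remaining.erase p.token)]
    refine gval_ne ?_ ((g.adjNat_iff _ _).2 h1)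
    exact Finset.mem_map_of_mem _ (Finset.mem_erase.2 ⟨fun e => g.graph.irrefl (e ▸ h1), h2⟩)
  · intro p m hm
    obtain ⟨w, h1, h2, h3⟩ := exists_of_lt_gval hm
    obtain ⟨v, hv, rfl⟩ := Finset.mem_map.1 h1
    refine ⟨⟨p.remaining.erase p.token, v⟩, ⟨(g.adjNat_iff _ _).1 h2,
      Finset.mem_of_mem_erase hv, rfl⟩, ?_⟩
    rw [stateVal, map_erase]
    exact h3

/-- The moves decrease the number of vertices. -/
theorem card_lt_of_move {V : Type} [DecidableEq V] {G : SimpleGraph V} {p q : GeographyState V}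
    (h : GeographyMove G p q) : (insert q.token q.remaining).card <
      (insert p.token p.remaining).card := by
  -- An arbitrary state may have its token outside `remaining`, and then `remaining` alone need not
  -- shrink; hence the insertion of the token in the measure.
  obtain ⟨h1, h2, h3⟩ := h
  have hne : q.token ≠ p.token := fun e => G.irrefl (e ▸ h1)
  refine Finset.card_lt_card ⟨fun v hv => ?_, fun hsub => ?_⟩
  · rw [h3] at hv
    rcases Finset.mem_insert.1 hv with rfl | hv
    exacts [Finset.mem_insert_of_mem h2, Finset.mem_insert_of_mem (Finset.mem_of_mem_erase hv)]
  · have := hsub (Finset.mem_insert_self p.token _)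
    rw [h3] at this
    rcases Finset.mem_insert.1 this with h | h
    exacts [hne h.symm, Finset.notMem_erase _ _ h]

theorem map_univ : (Finset.univ : Finset (Fin g.n)).map Fin.valEmbedding = Finset.range g.n := by
  ext v
  simp only [Finset.mem_map, Finset.mem_univ, true_and, Fin.valEmbedding_apply, Finset.mem_range]
  exact ⟨fun ⟨w, h⟩ => h ▸ w.2, fun h => ⟨⟨v, h⟩, rfl⟩⟩

theorem stateVal_init : g.stateVal g.init =
    gval g.AdjNat ((Finset.range g.n).erase g.start) g.start := by
  rw [stateVal, init, map_erase, map_univ]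

theorem stateVal_after (v : Fin g.n) :
    g.stateVal (g.after v) = Imp.optVal g.AdjNat g.n g.start v := by
  rw [stateVal, after, Imp.optVal, map_erase, map_erase, map_univ]

end Geography

/-! ### From nim sums to winning options of the given collection. -/

section collection

variable {k : ℕ} (C : Fin k → Geography)

/-- The numbers of vertices, the starting vertices and the graphs, as functions on the natural
numbers. -/
def sizeNat (j : ℕ) : ℕ := if h : j < k then (C ⟨j, h⟩).n else 0

def startNat (j : ℕ) : ℕ := if h : j < k then (C ⟨j, h⟩).start else 0

def adjNat (j : ℕ) : ℕ → ℕ → Prop := if h : j < k then (C ⟨j, h⟩).AdjNat else fun _ _ => False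

theorem sizeNat_fin (i : Fin k) : sizeNat C i = (C i).n := dif_pos i.2

theorem startNat_fin (i : Fin k) : startNat C i = (C i).start := dif_pos i.2

theorem adjNat_fin (i : Fin k) : adjNat C i = (C i).AdjNat := dif_pos i.2

theorem getD_encodeSum (i : Fin k) {t : ℕ} (ht : t < 2 + (C i).n * (C i).n) :
    (encodeSum C).getD (Imp.offset (sizeNat C) i + t) 0 = (C i).encode.getD t 0 := by
  rw [Imp.offset, Nat.add_assoc, Nat.add_comm, encodeSum, List.getD_cons_succ]
  refine getD_flatMap_finRange k _ (fun j => 2 + sizeNat C j * sizeNat C j) (fun i => ?_) i ?_ 0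
  · rw [(C i).length_encode, sizeNat_fin]
  · simpa only [sizeNat_fin] using ht

theorem describes_encodeSum (h : ∀ i, (C i).MaxDegreeLE 3) :
    Imp.Describes (encodeSum C) k (sizeNat C) (startNat C) (adjNat C) := by
  refine ⟨rfl, fun j hj => ?_, fun j hj => ?_, fun j hj u hu v hv => ?_, fun j hj => ?_,
    fun j hj => ?_, fun j hj => ?_⟩ <;> lift j to Fin k using hj
  · rw [sizeNat_fin]
    exact getD_encodeSum C j (t := 0) (by omega)
  · rw [startNat_fin]
    exact getD_encodeSum C j (t := 1) (by omega)
  · rw [sizeNat_fin] at hu hv ⊢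
    have := getD_encodeSum C j (t := 2 + u * (C j).n + v) (by nlinarith)
    rw [← Nat.add_assoc, ← Nat.add_assoc] at this
    rw [this, adjNat_fin]
    exact (C j).getD_encode ⟨u, hu⟩ ⟨v, hv⟩
  · rw [sizeNat_fin, startNat_fin]
    exact (C j).start.2
  · rw [sizeNat_fin, adjNat_fin]
    exact (C j).isGraphRel
  · rw [sizeNat_fin, adjNat_fin]
    exact (C j).card_adjNat_le (h j)

theorem startVal_fin (i : Fin k) : Imp.startVal (sizeNat C) (startNat C) (adjNat C) i =
    (C i).stateVal (C i).init := by
  rw [Imp.startVal, sizeNat_fin, startNat_fin, adjNat_fin, (C i).stateVal_init]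

/-- The moves that make the nim sum zero are the winning ones. -/
theorem isWinningOption_iff (i : Fin k) (v : Fin (C i).n) :
    IsWinningOption (GeographySumMove C) (sumInit C)
        (Function.update (sumInit C) i ((C i).after v)) ↔
      Imp.IsGoodMove (sizeNat C) (startNat C) (adjNat C)
        (nimSum (Imp.startVal (sizeNat C) (startNat C) (adjNat C)) k) i v := by
  have hmove : GeographySumMove C (sumInit C) (Function.update (sumInit C) i ((C i).after v)) ↔
      (C i).graph.Adj (C i).start v := by
    constructor
    · rintro ⟨j, y, h1, h2⟩
      have hi := congrFun h2 i
      rw [Function.update_self] at hi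
      by_cases hij : j = i
      · subst hij
        rw [Function.update_self] at hi
        subst hi
        exact h1.1
      -- A move in another component cannot have deleted the starting vertex of component `i`.
      · rw [Function.update_of_ne (Ne.symm hij)] at hi
        have h3 := congrArg GeographyState.remaining hi
        have : (C i).start ∈ (Finset.univ : Finset (Fin (C i).n)).erase (C i).start := by
          have h4 : (Finset.univ.erase (C i).start) = Finset.univ := h3
          rw [h4]
          exact Finset.mem_univ _
        exact absurd this (Finset.notMem_erase _ _)
    · exact fun h => ⟨i, (C i).after v, ⟨h, Finset.mem_univ _, rfl⟩, rfl⟩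
  have hwin := previousPlayerWins_sumMove_iff
    (Move := fun i => GeographyMove (C i).graph)
    (fun i (p : GeographyState (Fin (C i).n)) => (insert p.token p.remaining).card)
    (fun i p q h => Geography.card_lt_of_move h) (fun i => (C i).isGrundy_stateVal)
    (Function.update (sumInit C) i ((C i).after v))
  have hsum : nimSum (componentValues (fun i => (C i).stateVal) (sumInit C)) k =
      nimSum (Imp.startVal (sizeNat C) (startNat C) (adjNat C)) k :=
    nimSum_congr fun j hj => by
      rw [componentValues, dif_pos hj]
      exact (startVal_fin C ⟨j, hj⟩).symm
  rw [nimSum_update_option, hsum, Nat.xor_eq_zero_iff, (C i).stateVal_after] at hwin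
  rw [IsWinningOption, hmove, GeographySumMove, hwin, Imp.IsGoodMove, startVal_fin, sizeNat_fin,
    startNat_fin, adjNat_fin, Geography.adjNat_iff]
  exact ⟨fun ⟨h1, h2⟩ => ⟨v.2, h1, h2.symm⟩, fun ⟨_, h1, h2⟩ => ⟨h1, h2.symm⟩⟩

theorem isStrategicAnswer_of_output {R : ℕ → ℕ} {σ : Imp.Store} (hR : Imp.Rep σ R)
    (h : Imp.Output k (sizeNat C) (startNat C) (adjNat C)
      (nimSum (Imp.startVal (sizeNat C) (startNat C) (adjNat C)) k) (fun i _ => i < k) σ) :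
    IsStrategicAnswer C R := by
  -- The entries 0 of the arrays 0, 1, 2 lie in the registers 0, 1, 2.
  have e0 : R 0 = σ 0 0 := hR 0 0
  have e1 : R 1 = σ 1 0 := hR 1 0
  have e2 : R 2 = σ 2 0 := hR 2 0
  rcases h with ⟨h1, h2⟩ | ⟨h1, h2, h3⟩
  · refine .inr ⟨e0.trans h1, ?_⟩
    rintro ⟨_, ⟨i, y, hy, rfl⟩, hw⟩
    -- An option of the initial state is determined by the vertex to which the token goes.
    have hy' : y = (C i).after y.token := by
      obtain ⟨-, -, h⟩ := hy
      cases y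
      simpa [Geography.after, sumInit, Geography.init] using h
    refine h2 i y.token i.2 ((isWinningOption_iff C i y.token).1 ?_)
    rw [← hy']
    exact ⟨⟨i, y, hy, rfl⟩, hw⟩
  · refine .inl ⟨e0.trans h1, ⟨σ 1 0, h2⟩, ⟨σ 2 0, ?_⟩, e1, e2, ?_⟩
    · have := h3.1
      rwa [sizeNat, dif_pos h2] at this
    · rw [isWinningOption_iff]
      exact h3

end collection

/-- There are one program and one polynomial that serve all finite collections of Undirected
Geography positions on graphs of maximum degree at most three: the program solves the disjunctive
sum of the collection, within a number of steps polynomial in the total number of vertices. -/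
theorem mainTheorem9 :
    ∃ (prog : RAM.Program) (p : Polynomial ℕ),
      ∀ (k : ℕ) (C : Fin k → Geography), (∀ i, (C i).MaxDegreeLE 3) →
        RAM.Halted prog (RAM.run prog (encodeSum C) (p.eval (totalVertices C))) ∧
        IsStrategicAnswer C (RAM.run prog (encodeSum C) (p.eval (totalVertices C))).reg := by
  refine ⟨Imp.program, Imp.mainBound, fun k C hC => ?_⟩
  have hd := describes_encodeSum C hC
  have ht : ∑ j ∈ Finset.range k, sizeNat C j = totalVertices C := by
    rw [Finset.sum_range, totalVertices]
    exact Finset.sum_congr rfl fun i _ => sizeNat_fin C i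
  obtain ⟨h1, h2⟩ := hd.run_program (t := Imp.mainBound.eval (totalVertices C)) (by rw [ht])
  exact ⟨h1, isStrategicAnswer_of_output C h2 hd.eval_mainCode⟩
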